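/- Let $k$ be a commutative ring, $X$ a topological space, and $\mathcal F$ a sheaf of $k$-modules on $X$. Let $\widehat P$ be a finite poset with binary meets and a top element $\hat 1$, let $P=\widehat P\setminus\{\hat 1\}$, and let $(Z_p)_{p\in\widehat P}$ be closed subsets of $X$ with $Z_p\cap Z_q=Z_{p\wedge q}$ for all $p,q$ and $Z_{\hat 1}=X$. Put $U_p=X\setminus Z_p$ and $U=X\setminus\bigcup_{p\in P}Z_p$, with inclusions $j_p:U_p\to X$ and $j:U\to X$, and let $\pi$ denote the map to a point. A $\widehat P$-representation is a functor on $\widehat P$ (as a category with one arrow $p\to q$ for $p\le q$). For a representation $A$ of $\widehat P^{op}$ in $k$-modules and a $\widehat P$-representation $M$ in $k$-modules, $A\otimes_{\widehat P}M$ is the coend of $A(p)\otimes_k M(q)$; if $M$ takes values in sheaves of $k$-modules on $X$, then $A$ is replaced by its constant sheaves and $\otimes_k$ by the tensor product of sheaves. For complexes the total complex is taken. A representation of $\widehat P^{op}$ is free if it is a direct sum of representations $k\widehat P(-,p)$ (the free $k$-module on $\widehat P(-,p)$), and a free resolution of $A$ is a quasi-isomorphism to $A$ from a complex of free representations in cohomological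 degrees $\le 0$. Let $S_{\hat 1}$ be the representation of $\widehat P^{op}$ that is $k$ at $\hat 1$ and $0$ elsewhere, and $k\{*\}_P\subset k\widehat P(-,\hat 1)$ the subrepresentation that is constant with value $k$ on $P$ and $0$ at $\hat 1$. One computes $S_{\hat 1}\otimes^{\mathbf L}_{\widehat P}M$ as $R\otimes_{\widehat P}M$ for a free resolution $R\to S_{\hat 1}$, and $\operatorname{hocolim}_P M$ as $G\otimes_{\widehat P}M$ for a free resolution $G\to k\{*\}_P$. For $M$ with a compatible family of maps $M_p\to N$, $p\in P$, there is a canonical map $G\otimes_{\widehat P}M\to k\{*\}_P\otimes_{\widehat P}M=\operatorname{colim}_PM\to N$. Let $\mathcal F\to\mathcal J$ be a resolution by flabby sheaves in degrees $\ge 0$. Let $\mathcal J_\bullet$ be the constant representation $p\mapsto\mathcal J$, let $j_{\bullet*}\mathcal J|_{U_\bullet}$ be the representation $p\mapsto j_{p*}\mathcal J|_{U_p}$, and put $$i_{\bullet*}i_\bullet^!\mathcal J=\operatorname{cone}(\mathcal J_\bullet\to j_{\bullet*}\mathcal J|_{U_\bullet})[-1],$$ with the restriction maps; it represents $i_{\bullet*}\mathbf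 Ri_\bullet^!\mathcal F$. Then the following hold. 1. Assume $P\neq\emptyset$, and let $G\to k\{*\}_P$ be any free resolution. Then $E=\operatorname{cone}(G\to k\widehat P(-,\hat 1))$ is (the underlying complex of) a free resolution of $S_{\hat 1}$. The canonical map, given by restriction, $$\operatorname{hocolim}_P\, j_{\bullet*}\mathcal J|_{U_\bullet}=G\otimes_{\widehat P}j_{\bullet*}\mathcal J|_{U_\bullet}\longrightarrow j_*\mathcal J|_U$$ is a quasi-isomorphism, and both arrows of the zig-zag $$E\otimes_{\widehat P}i_{\bullet*}i_\bullet^!\mathcal J\longleftarrow E\otimes_{\widehat P}\big(j_{\bullet*}\mathcal J|_{U_\bullet}[-1]\big)\longrightarrow j_*\mathcal J|_U$$ are quasi-isomorphisms. Here the left arrow is induced by the inclusion of $j_{\bullet*}\mathcal J|_{U_\bullet}[-1]$ in the shifted cone, and the right arrow is the connecting map $E\to G[1]$ of the cone, tensored with $j_{\bullet*}\mathcal J|_{U_\bullet}[-1]$, followed by the map $G\otimes_{\widehat P}j_{\bullet*}\mathcal J|_{U_\bullet}\to j_*\mathcal J|_U$. After applying $\pi_*$ to $\mathcal J_\bullet$,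 $j_{\bullet*}\mathcal J|_{U_\bullet}$, $i_{\bullet*}i^!_\bullet\mathcal J$ and $j_*\mathcal J|_U$, the corresponding three maps of complexes of $k$-modules are again quasi-isomorphisms. 2. (With $P$ possibly empty.) In the derived category of sheaves of $k$-modules on $X$, $$\mathbf Rj_*j^*\mathcal F\;\cong\;j_*\mathcal J|_U\;\cong\;S_{\hat 1}\otimes^{\mathbf L}_{\widehat P}i_{\bullet*}\mathbf Ri_\bullet^!\mathcal F,$$ where the right-hand side may be computed from any free resolution of $S_{\hat 1}$ and any complex of $\widehat P$-representations in sheaves that is isomorphic to $i_{\bullet*}i_\bullet^!\mathcal J$ in the derived category of such representations. 3. (With $P$ possibly empty.) Let $C$ be any complex of $\widehat P$-representations in $k$-modules that is isomorphic to $\pi_*i_{\bullet*}i_\bullet^!\mathcal J$ (that is, to $\mathbf R\pi_*\mathbf Ri_\bullet^!\mathcal F$) in the derived category of such representations. Then, computed from any free resolution of $S_{\hat 1}$, $$S_{\hat 1}\otimes^{\mathbf L}_{\widehat P}C\;\cong\;\mathbf R\pi_*(\mathcal F|_U)$$ in the derived category of $k$-modules. Hence $H^i(S_{\hat 1}\otimes^{\mathbf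 L}_{\widehat P}C)\cong H^i(U,\mathcal F)$ for all $i\ge 0$, and $H^i(S_{\hat 1}\otimes^{\mathbf L}_{\widehat P}C)=0$ for $i<0$. -/

import Mathlib

open CategoryTheory Limits MonoidalCategory Opposite TopologicalSpace

universe u w

set_option linter.unusedSectionVars false

noncomputable section

namespace PosetRes

section Posets

variable (k : Type u) [CommRing k] (L : Type u) [PartialOrder L]

/-! Throughout, `L` plays the role of the poset `P̂` with its top element, `Below L` that of
`P = P̂ - {⊤}`.  A left representation is a functor on `L`, a right one a functor on `Lᵒᵖ`. -/

/-- The free right representation `k L(-, p)` on one generator in degree `p`. -/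
def freeOn (p : L) : Lᵒᵖ ⥤ ModuleCat.{u} k := yoneda.obj p ⋙ ModuleCat.free k

variable {k L} in
/-- Free right representations: direct sums of the `k L(-, p)`. -/
def IsFreeModule (A : Lᵒᵖ ⥤ ModuleCat.{u} k) : Prop :=
  ∃ (I : Type u) (b : I → L), Nonempty (A ≅ ∐ fun i => freeOn k L (b i))

variable {k L} in
/-- A resolution by free right representations, as a cochain complex in degrees `≤ 0`. -/
structure FreeResolution (A : Lᵒᵖ ⥤ ModuleCat.{u} k) where
  cplx : CochainComplex (Lᵒᵖ ⥤ ModuleCat.{u} k) ℤ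
  free : ∀ n, IsFreeModule (cplx.X n)
  isStrictlyLE : cplx.IsStrictlyLE 0
  aug : cplx ⟶ (HomologicalComplex.single _ (.up ℤ) 0).obj A
  quasiIso : QuasiIso aug

variable [OrderTop L]

/-- The simple right representation at the top: `k` at `⊤` (functions on a point), and `0`
(functions on the empty type) elsewhere. -/
def simpleTop : Lᵒᵖ ⥤ ModuleCat.{u} k where
  obj p := ModuleCat.of k (PLift (p.unop = ⊤) → k)
  map {p q} f := ModuleCat.ofHom
    (LinearMap.funLeft k k fun h : PLift (q.unop = ⊤) =>
      PLift.up (top_le_iff.mp (h.down ▸ leOfHom f.unop)))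

/-- The presheaf of sets that is a point at every `p < ⊤` and empty at `⊤`. -/
def belowSet : Lᵒᵖ ⥤ Type u where
  obj p := ULift.{u} (PLift (p.unop ≠ ⊤))
  map {p q} f := TypeCat.ofHom fun h =>
    ⟨⟨fun hq => h.down.down (top_le_iff.mp (hq ▸ leOfHom f.unop))⟩⟩

/-- The right representation that is constant with value `k` on `P` and zero at `⊤`. -/
def constBelow : Lᵒᵖ ⥤ ModuleCat.{u} k := belowSet L ⋙ ModuleCat.free k

/-- The inclusion of `constBelow` in the free (that is, constant) representation `k L(-, ⊤)`. -/
def constBelowToFree : constBelow k L ⟶ freeOn k L ⊤ :=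
  Functor.whiskerRight
    { app := fun p => TypeCat.ofHom fun _ => homOfLE le_top
      naturality := fun _ _ _ => by ext; exact Subsingleton.elim (α := ULift (PLift _)) _ _ } (ModuleCat.free k)

/-- The poset `P = P̂ - {⊤}`. -/
abbrev Below := {p : L // p ≠ ⊤}

abbrev belowIncl : Below L ⥤ L := (Subtype.mono_coe (fun p : L => p ≠ ⊤)).functor

end Posets

section Tensor
variable {k : Type u} [CommRing k] (L : Type u) [PartialOrder L]
  {E : Type (u+1)} [Category.{u} E] [MonoidalCategory E] [HasColimitsOfSize.{u, u} E]
  (κ : ModuleCat.{u} k ⥤ E)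

/-- The tensor product over `L` of a right and a left representation in a monoidal category: the
coend of `(p, q) ↦ A p ⊗ M q`. -/
def tensorOver : (Lᵒᵖ ⥤ E) ⥤ (L ⥤ E) ⥤ E where
  obj A := (externalProductBifunctorCurried Lᵒᵖ L E).obj A ⋙ coendFunctor L E
  map f := Functor.whiskerRight ((externalProductBifunctorCurried Lᵒᵖ L E).map f) (coendFunctor L E)

/-- The tensor product of a right representation in `k`-modules with a left representation in `E`,
the former being moved to `E` by `κ` (the identity, or the constant sheaf functor). -/
def tensorK : (Lᵒᵖ ⥤ ModuleCat.{u} k) ⥤ (L ⥤ E) ⥤ E :=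
  (Functor.whiskeringRight _ _ _).obj κ ⋙ tensorOver L

/-- The canonical map `A p ⊗ M p ⟶ A ⊗_L M`. -/
def tensorι (A : Lᵒᵖ ⥤ ModuleCat.{u} k) (M : L ⥤ E) (p : L) :
    κ.obj (A.obj (op p)) ⊗ M.obj p ⟶ ((tensorK L κ).obj A).obj M :=
  coend.ι (((externalProductBifunctorCurried Lᵒᵖ L E).obj (A ⋙ κ)).obj M) p

variable {L}

lemma tensorι_map_left {A B : Lᵒᵖ ⥤ ModuleCat.{u} k} (f : A ⟶ B) (M : L ⥤ E) (p : L) :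
    tensorι L κ A M p ≫ ((tensorK L κ).map f).app M =
      (κ.map (f.app (op p)) ▷ M.obj p) ≫ tensorι L κ B M p :=
  coend.ι_map _ _

lemma tensorι_map_right (A : Lᵒᵖ ⥤ ModuleCat.{u} k) {M N : L ⥤ E} (g : M ⟶ N) (p : L) :
    tensorι L κ A M p ≫ ((tensorK L κ).obj A).map g =
      (κ.obj (A.obj (op p)) ◁ g.app p) ≫ tensorι L κ A N p :=
  coend.ι_map _ _

variable {κ} in
lemma tensor_hom_ext {A : Lᵒᵖ ⥤ ModuleCat.{u} k} {M : L ⥤ E} {N : E}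
    {f g : ((tensorK L κ).obj A).obj M ⟶ N}
    (h : ∀ p, tensorι L κ A M p ≫ f = tensorι L κ A M p ≫ g) : f = g :=
  coend.hom_ext h

/-- The universal property of `A ⊗_L M`. -/
def tensorDesc (A : Lᵒᵖ ⥤ ModuleCat.{u} k) (M : L ⥤ E) {N : E}
    (f : ∀ p, κ.obj (A.obj (op p)) ⊗ M.obj p ⟶ N)
    (hf : ∀ ⦃p q : L⦄ (g : p ⟶ q), (κ.map (A.map g.op) ▷ M.obj p) ≫ f p =
      (κ.obj (A.obj (op q)) ◁ M.map g) ≫ f q) :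
    ((tensorK L κ).obj A).obj M ⟶ N :=
  coend.desc (F := ((externalProductBifunctorCurried Lᵒᵖ L E).obj (A ⋙ κ)).obj M) f hf

lemma tensorι_desc (A : Lᵒᵖ ⥤ ModuleCat.{u} k) (M : L ⥤ E) {N : E}
    (f : ∀ p, κ.obj (A.obj (op p)) ⊗ M.obj p ⟶ N)
    (hf : ∀ ⦃p q : L⦄ (g : p ⟶ q), (κ.map (A.map g.op) ▷ M.obj p) ≫ f p =
      (κ.obj (A.obj (op q)) ◁ M.map g) ≫ f q) (p : L) :
    tensorι L κ A M p ≫ tensorDesc κ A M f hf = f p :=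
  coend.ι_desc _ _ _

variable [Preadditive E] [MonoidalPreadditive E] [κ.Additive]

instance : (tensorK L κ).Additive where
  map_add {A B f g} := by
    ext M
    refine tensor_hom_ext fun p => ?_
    rw [NatTrans.app_add, Preadditive.comp_add]
    simp only [tensorι_map_left, NatTrans.app_add, Functor.map_add,
      MonoidalPreadditive.add_whiskerRight, Preadditive.add_comp]

instance (A : Lᵒᵖ ⥤ ModuleCat.{u} k) : ((tensorK L κ).obj A).Additive where
  map_add {M N f g} := by
    refine tensor_hom_ext fun p => ?_
    rw [Preadditive.comp_add]
    simp only [tensorι_map_right, NatTrans.app_add,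
      MonoidalPreadditive.whiskerLeft_add, Preadditive.add_comp]

/-- The tensor product over `L` of two complexes: the total complex of the bicomplex. -/
abbrev tensorComplex (F : CochainComplex (Lᵒᵖ ⥤ ModuleCat.{u} k) ℤ) (M : CochainComplex (L ⥤ E) ℤ) :
    CochainComplex E ℤ :=
  CochainComplex.mapBifunctor F M (tensorK L κ)

/-- Functoriality of `tensorComplex`. -/
abbrev tensorMap {F F' : CochainComplex (Lᵒᵖ ⥤ ModuleCat.{u} k) ℤ}
    {M M' : CochainComplex (L ⥤ E) ℤ} (f : F ⟶ F') (g : M ⟶ M') :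
    tensorComplex κ F M ⟶ tensorComplex κ F' M' :=
  HomologicalComplex.mapBifunctorMap f g (tensorK L κ) (.up ℤ)

end Tensor

section single

open HomologicalComplex

variable {C₁ C₂ D : Type*} [Category* C₁] [Category* C₂] [Category* D]
  [Preadditive C₁] [HasZeroObject C₁] [Preadditive C₂] [Preadditive D]
  (B : C₁ ⥤ C₂ ⥤ D) [B.Additive] [∀ A, (B.obj A).Additive]
  (A : C₁) (K : CochainComplex C₂ ℤ)
  [CochainComplex.HasMapBifunctor ((single C₁ (.up ℤ) 0).obj A) K B]

/-- The identification of the total complex of `B (A, K)`, for `A` in degree `0`, with `B (A, -)`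
applied to `K`. -/
def singleDesc :
    CochainComplex.mapBifunctor ((single C₁ (.up ℤ) 0).obj A) K B ⟶
      ((B.obj A).mapHomologicalComplex (.up ℤ)).obj K where
  f n := mapBifunctorDesc fun i₁ i₂ h =>
    if h₁ : i₁ = 0 then
      (B.map (singleObjXIsoOfEq (.up ℤ) 0 A i₁ h₁).hom).app (K.X i₂) ≫
        (B.obj A).map (K.XIsoOfEq (show i₂ = n by
          have h' : i₁ + i₂ = n := h
          omega)).hom
    else 0
  comm' n n' hn := by
    ext i₁ i₂ h
    have h' : i₁ + i₂ = n := h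
    have hn' : n + 1 = n' := hn
    by_cases h₁ : i₁ = 0
    · subst h₁
      obtain rfl : i₂ = n := by omega
      subst hn'
      have e₁ : mapBifunctor.d₁ ((single C₁ (.up ℤ) 0).obj A) K B (.up ℤ) 0 i₂ (i₂+1)
          = 0 := by
        rw [mapBifunctor.d₁_eq' _ _ _ _ (show (ComplexShape.up ℤ).Rel 0 1 by simp)]
        have : ((single C₁ (.up ℤ) 0).obj A).d 0 1 = 0 := single_obj_d ..
        rw [this]
        simp
      have e₂ := mapBifunctor.d₂_eq ((single C₁ (.up ℤ) 0).obj A) K B (.up ℤ) 0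
        (show (ComplexShape.up ℤ).Rel i₂ (i₂+1) by simp) (i₂+1) (by simp)
      rw [mapBifunctor.d_eq, Preadditive.add_comp, Preadditive.comp_add,
        mapBifunctor.ι_D₁_assoc, mapBifunctor.ι_D₂_assoc, e₁, e₂, ι_mapBifunctorDesc_assoc]
      simp
      erw [Category.comp_id, Category.comp_id]
      exact ((B.map _).naturality _).symm
    · refine IsZero.eq_of_src ?_ _ _
      rw [IsZero.iff_id_eq_zero]
      have h₀ : 𝟙 (((single C₁ (.up ℤ) 0).obj A).X i₁) = 0 :=
        (isZero_single_obj_X (.up ℤ) 0 A i₁ h₁).eq_of_src _ _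
      rw [← NatTrans.id_app, ← B.map_id, h₀, B.map_zero]
      rfl

end single

section Monoidal

variable {C : Type u} [Category.{u} C] (T : GrothendieckTopology C) (A : Type (u+1))
  [Category.{u} A] [MonoidalCategory A] [Abelian A] [MonoidalPreadditive A]
  [(T.W (A := A)).IsMonoidal] [HasSheafify T A]

attribute [local instance] CategoryTheory.Sheaf.monoidalCategory

instance : MonoidalPreadditive (Cᵒᵖ ⥤ A) where

theorem sheafMonoidalPreadditive : MonoidalPreadditive (Sheaf T A) := by
  let a := presheafToSheaf T A
  let e : ∀ S : Sheaf T A, a.obj S.obj ≅ S := fun S =>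
    asIso ((sheafificationAdjunction T A).counit.app S)
  have he : ∀ {S S' : Sheaf T A} (f : S ⟶ S'), f = (e S).inv ≫ a.map f.hom ≫ (e S').hom :=
    fun f => (Iso.eq_inv_comp _).2 ((sheafificationAdjunction T A).counit.naturality f).symm
  have hl : ∀ (R : Sheaf T A) {S S' : Sheaf T A} (f : S ⟶ S'),
      R ◁ f = ((e R).inv ⊗ₘ (e S).inv) ≫ Functor.LaxMonoidal.μ a _ _ ≫ a.map (R.obj ◁ f.hom) ≫
        Functor.OplaxMonoidal.δ a _ _ ≫ ((e R).hom ⊗ₘ (e S').hom) := by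
    intro R S S' f
    rw [← Functor.LaxMonoidal.μ_natural_right_assoc, Functor.Monoidal.μ_δ_assoc,
      ← id_tensorHom, ← id_tensorHom, tensorHom_comp_tensorHom, tensorHom_comp_tensorHom, Category.id_comp,
      Iso.inv_hom_id, ← he, id_tensorHom]
  have hr : ∀ (R : Sheaf T A) {S S' : Sheaf T A} (f : S ⟶ S'),
      f ▷ R = ((e S).inv ⊗ₘ (e R).inv) ≫ Functor.LaxMonoidal.μ a _ _ ≫ a.map (f.hom ▷ R.obj) ≫
        Functor.OplaxMonoidal.δ a _ _ ≫ ((e S').hom ⊗ₘ (e R).hom) := by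
    intro R S S' f
    rw [← Functor.LaxMonoidal.μ_natural_left_assoc, Functor.Monoidal.μ_δ_assoc,
      ← tensorHom_id, ← tensorHom_id, tensorHom_comp_tensorHom, tensorHom_comp_tensorHom, Category.id_comp,
      Iso.inv_hom_id, ← he, tensorHom_id]
  have h0 : ∀ {S S' : Sheaf T A}, (0 : S ⟶ S').hom = 0 := rfl
  have ha : ∀ {S S' : Sheaf T A} (f g : S ⟶ S'), (f + g).hom = f.hom + g.hom := fun _ _ => rfl
  exact
    { whiskerLeft_zero := by
        intros; rw [hl, h0]; simp
      zero_whiskerRight := by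
        intros; rw [hr, h0]; simp
      whiskerLeft_add := by
        intros; rw [hl, hl, hl, ha, MonoidalPreadditive.whiskerLeft_add, Functor.map_add]
        simp only [Preadditive.add_comp, Preadditive.comp_add]
      add_whiskerRight := by
        intros; rw [hr, hr, hr, ha, MonoidalPreadditive.add_whiskerRight, Functor.map_add]
        simp only [Preadditive.add_comp, Preadditive.comp_add] }
end Monoidal

section Hocolim

variable {k : Type u} [CommRing k] {L : Type u} [PartialOrder L] [OrderTop L]
  {E : Type (u+1)} [Category.{u} E] [MonoidalCategory E] [Abelian E]
  [MonoidalPreadditive E] [HasColimitsOfSize.{u, u} E]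
  (κ : ModuleCat.{u} k ⥤ E) [κ.Additive] (υ : κ.obj (𝟙_ (ModuleCat.{u} k)) ⟶ 𝟙_ E)

/-- The identification of the value of `constBelow` with `k` (away from `⊤`). -/
def belowCoeff (p : L) : (constBelow k L).obj (op p) ⟶ 𝟙_ (ModuleCat.{u} k) :=
  ModuleCat.ofHom (Finsupp.linearCombination k fun _ => (1 : k))

lemma map_belowCoeff {p q : L} (g : p ⟶ q) :
    (constBelow k L).map g.op ≫ belowCoeff p = belowCoeff (k := k) q := by
  refine ModuleCat.hom_ext (Finsupp.lhom_ext' fun x => LinearMap.ext_ring ?_)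
  simp [belowCoeff, constBelow, ModuleCat.free]

variable (k L) in
lemma isZero_constBelow_top : IsZero ((constBelow k L).obj (op ⊤)) := by
  refine ModuleCat.isZero_of_iff_subsingleton.2 ?_
  have : IsEmpty ((belowSet L).obj (op ⊤)) := ⟨fun h => h.down.down rfl⟩
  exact inferInstanceAs (Subsingleton ((belowSet L).obj (op ⊤) →₀ k))

/-- The component at `p < ⊤` of a cocone over the restriction of `M` to `P`. -/
def coconeLeg {M : L ⥤ E} {N : E} (α : belowIncl L ⋙ M ⟶ (Functor.const (Below L)).obj N)
    {p : L} (hp : p ≠ ⊤) : M.obj p ⟶ N :=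
  α.app ⟨p, hp⟩

lemma map_coconeLeg {M : L ⥤ E} {N : E}
    (α : belowIncl L ⋙ M ⟶ (Functor.const (Below L)).obj N) {p q : L} (hp : p ≠ ⊤) (hq : q ≠ ⊤)
    (g : p ⟶ q) : M.map g ≫ coconeLeg α hq = coconeLeg α hp :=
  (α.naturality (X := ⟨p, hp⟩) (Y := ⟨q, hq⟩) (homOfLE (leOfHom g))).trans (Category.comp_id _)

open scoped Classical in
/-- For a cocone `α` on `M` restricted to `P`, the map `k{*}_P ⊗_L M = colim_P M ⟶ N`: on
`k ⊗ M p` it is `α p` for `p < ⊤`. -/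
def colimDesc {M : L ⥤ E} {N : E}
    (α : belowIncl L ⋙ M ⟶ (Functor.const (Below L)).obj N) :
    ((tensorK L κ).obj (constBelow k L)).obj M ⟶ N :=
  tensorDesc κ (constBelow k L) M
    (fun p => if hp : p ≠ ⊤ then
      (κ.map (belowCoeff p) ≫ υ) ▷ M.obj p ≫ (λ_ (M.obj p)).hom ≫ coconeLeg α hp else 0)
    (fun p q g => by
      by_cases hq : q = ⊤
      · subst hq
        refine IsZero.eq_of_src ?_ _ _
        rw [IsZero.iff_id_eq_zero, ← id_whiskerRight, ← κ.map_id,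
          (isZero_constBelow_top k L).eq_of_src (𝟙 _) 0, κ.map_zero,
          MonoidalPreadditive.zero_whiskerRight]
      · have hp : p ≠ ⊤ := fun hp => hq (top_le_iff.mp (hp ▸ leOfHom g))
        rw [dif_pos hp, dif_pos hq, ← map_coconeLeg α hp hq g, ← comp_whiskerRight_assoc,
          ← Category.assoc (κ.map _), ← κ.map_comp, map_belowCoeff, whisker_exchange_assoc,
          leftUnitor_naturality_assoc])

lemma colimDesc_natural {M M' : L ⥤ E} {N N' : E}
    (α : belowIncl L ⋙ M ⟶ (Functor.const (Below L)).obj N)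
    (α' : belowIncl L ⋙ M' ⟶ (Functor.const (Below L)).obj N') (m : M ⟶ M') (n : N ⟶ N')
    (h : α ≫ (Functor.const _).map n = Functor.whiskerLeft (belowIncl L) m ≫ α') :
    colimDesc κ υ α ≫ n = ((tensorK L κ).obj (constBelow k L)).map m ≫ colimDesc κ υ α' := by
  refine tensor_hom_ext fun p => ?_
  rw [← Category.assoc (tensorι L κ _ M p) (colimDesc κ υ α) n,
    ← Category.assoc (tensorι L κ _ M p) _ (colimDesc κ υ α'), tensorι_map_right,
    Category.assoc (_ ◁ _)]
  unfold colimDesc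
  rw [tensorι_desc, tensorι_desc]
  split_ifs with hp
  · have hα : coconeLeg α hp ≫ n = m.app p ≫ coconeLeg α' hp := NatTrans.congr_app h ⟨p, hp⟩
    rw [Category.assoc, Category.assoc, hα, whisker_exchange_assoc, leftUnitor_naturality_assoc]
  · simp

/-- A cocone of complexes with vertex `N` on the restriction of `M` to `P`. -/
abbrev BelowCocone (M : CochainComplex (L ⥤ E) ℤ) (N : CochainComplex E ℤ) :=
  (((Functor.whiskeringLeft (Below L) L E).obj (belowIncl L)).mapHomologicalComplex (.up ℤ)).obj M ⟶
    ((Functor.const (Below L)).mapHomologicalComplex (.up ℤ)).obj N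

variable {M : CochainComplex (L ⥤ E) ℤ} {N : CochainComplex E ℤ}

/-- `colimDesc` for complexes. -/
def colimMap (α : BelowCocone M N) :
    (((tensorK L κ).obj (constBelow k L)).mapHomologicalComplex (.up ℤ)).obj M ⟶ N where
  f n := colimDesc κ υ (α.f n)
  comm' i j _ := colimDesc_natural κ υ _ _ _ _ (α.comm i j)

/-- For a free resolution `G` of `k{*}_P`, the complex `G ⊗_L M` is the homotopy colimit of `M` over
`P`; this is the composite `G ⊗_L M ⟶ k{*}_P ⊗_L M = colim_P M ⟶ N`. -/
def hocolimMap (G : FreeResolution (constBelow k L)) (α : BelowCocone M N) :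
    tensorComplex κ G.cplx M ⟶ N :=
  tensorMap κ G.aug (𝟙 M) ≫ singleDesc (tensorK L κ) (constBelow k L) M ≫ colimMap κ υ α

/-- The composite `G ⟶ k{*}_P ⟶ k L(-, ⊤)`. -/
def toFreeTop (G : FreeResolution (constBelow k L)) :
    G.cplx ⟶ (HomologicalComplex.single _ (.up ℤ) 0).obj (freeOn k L ⊤) :=
  G.aug ≫ (HomologicalComplex.single _ (.up ℤ) 0).map (constBelowToFree k L)

/-- The cone of `G ⟶ k L(-, ⊤)`. -/
abbrev coneComplex (G : FreeResolution (constBelow k L)) :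
    CochainComplex (Lᵒᵖ ⥤ ModuleCat.{u} k) ℤ :=
  CochainComplex.mappingCone (toFreeTop G)

/-- The composite of `cone(G ⟶ k L(-, ⊤)) ⊗_L M[-1] ⟶ G[1] ⊗_L M[-1] ≅ G ⊗_L M`, the connecting map
of the cone, with `hocolimMap`. -/
def zigzagRight (G : FreeResolution (constBelow k L)) (α : BelowCocone M N) :
    tensorComplex κ (coneComplex G) (M⟦(-1 : ℤ)⟧) ⟶ N :=
  tensorMap κ (CochainComplex.mappingCone.triangle (toFreeTop G)).mor₃ (𝟙 (M⟦(-1 : ℤ)⟧)) ≫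
    (CochainComplex.mapBifunctorShift₁Iso G.cplx (M⟦(-1 : ℤ)⟧) (tensorK L κ) 1).hom ≫
    (CochainComplex.mapBifunctorShift₂Iso G.cplx M (tensorK L κ) (-1)).hom⟦(1 : ℤ)⟧' ≫
    (shiftFunctorCompIsoId (CochainComplex E ℤ) (-1 : ℤ) 1 (by simp)).hom.app _ ≫
    hocolimMap κ υ G α

end Hocolim

section Sheaves

variable (k : Type u) [CommRing k] (X : TopCat.{u})

/-- Sheaves of `k`-modules on `X`. -/
abbrev Sh := TopCat.Sheaf (ModuleCat.{u} k) X

instance : MonoidalCategory (Sh k X) :=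
  CategoryTheory.Sheaf.monoidalCategory (Opens.grothendieckTopology X) (ModuleCat.{u} k)

instance : MonoidalPreadditive (Sh k X) :=
  sheafMonoidalPreadditive (Opens.grothendieckTopology X) (ModuleCat.{u} k)

/-- The constant sheaf functor. -/
abbrev constSh : ModuleCat.{u} k ⥤ Sh k X :=
  constantSheaf (Opens.grothendieckTopology X) (ModuleCat.{u} k)

instance : (constSh k X).Additive :=
  inferInstanceAs (constantSheaf (Opens.grothendieckTopology X) (ModuleCat.{u} k)).Additive

/-- The constant sheaf `k` is the unit of the tensor product of sheaves of `k`-modules. -/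
def constShUnit : (constSh k X).obj (𝟙_ (ModuleCat.{u} k)) ⟶ 𝟙_ (Sh k X) :=
  letI := CategoryTheory.Sheaf.monoidalCategory (Opens.grothendieckTopology X) (ModuleCat.{u} k)
  Functor.OplaxMonoidal.η (presheafToSheaf (Opens.grothendieckTopology X) (ModuleCat.{u} k))

variable {k X}

/-- A resolution `F ⟶ J` by flabby sheaves, in degrees `≥ 0`. -/
structure FlabbyResolution (F : Sh k X) where
  cplx : CochainComplex (Sh k X) ℤ
  flabby : ∀ n, (cplx.X n).IsFlasque
  isStrictlyGE : cplx.IsStrictlyGE 0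
  coaug : (HomologicalComplex.single _ (.up ℤ) 0).obj F ⟶ cplx
  quasiIso : QuasiIso coaug

/-- Restriction of sheaves to an open subset. -/
abbrev restr (U : Opens X) : Sh k X ⥤ Sh k ((Opens.toTopCat X).obj U) :=
  U.isOpenEmbedding.sheafPullback (ModuleCat.{u} k)

/-- Direct image of sheaves along the inclusion of an open subset. -/
abbrev push (U : Opens X) : Sh k ((Opens.toTopCat X).obj U) ⥤ Sh k X :=
  TopCat.Sheaf.pushforward (ModuleCat.{u} k) U.inclusion'

/-- The functor `j_* j^*`, with `j` the inclusion of `U`. -/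
abbrev jj (U : Opens X) : Sh k X ⥤ Sh k X := restr U ⋙ push U

lemma sh_hom_ext {F G : Sh k X} {f g : F ⟶ G} (h : ∀ W, f.1.app W = g.1.app W) : f = g :=
  CategoryTheory.Sheaf.hom_ext (NatTrans.ext (funext h))

lemma image_preimage_le (U W : Opens X) :
    U.isOpenEmbedding.functor.obj ((Opens.map U.inclusion').obj W) ≤ W := by
  rintro _ ⟨x, hx, rfl⟩
  exact hx

lemma image_preimage_mono {U V : Opens X} (h : V ≤ U) (W : Opens X) :
    V.isOpenEmbedding.functor.obj ((Opens.map V.inclusion').obj W) ≤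
      U.isOpenEmbedding.functor.obj ((Opens.map U.inclusion').obj W) := by
  rintro _ ⟨x, hx, rfl⟩
  exact ⟨⟨x.1, h x.2⟩, hx, rfl⟩

/-- The restriction map `F ⟶ j_* j^* F`. -/
def jjUnit (U : Opens X) : 𝟭 (Sh k X) ⟶ jj U where
  app F := ⟨{ app W := F.1.map (homOfLE (image_preimage_le U W.unop)).op
              naturality _ _ _ := by
                refine (F.1.map_comp _ _).symm.trans (Eq.trans ?_ (F.1.map_comp _ _))
                rfl }⟩
  naturality F G f := by
    refine sh_hom_ext fun W => ?_
    exact (f.1.naturality _).symm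

/-- The restriction map from the direct image on `U` to the one on `V ≤ U`. -/
def jjMap {U V : Opens X} (h : V ≤ U) : (jj U : Sh k X ⥤ Sh k X) ⟶ jj V where
  app F := ⟨{ app W := F.1.map (homOfLE (image_preimage_mono h W.unop)).op
              naturality _ _ _ := by
                refine (F.1.map_comp _ _).symm.trans (Eq.trans ?_ (F.1.map_comp _ _))
                rfl }⟩
  naturality F G f := by
    refine sh_hom_ext fun W => ?_
    exact (f.1.naturality _).symm

lemma jjUnit_map {U V : Opens X} (h : V ≤ U) :
    jjUnit (k := k) U ≫ jjMap h = jjUnit V := by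
  refine NatTrans.ext (funext fun F => sh_hom_ext fun W => ?_)
  exact (F.1.map_comp _ _).symm

lemma jjMap_refl (U : Opens X) : jjMap (k := k) (le_refl U) = 𝟙 _ := by
  refine NatTrans.ext (funext fun F => sh_hom_ext fun W => ?_)
  exact F.1.map_id _

lemma jjMap_comp {U V W : Opens X} (h : V ≤ U) (h' : W ≤ V) :
    jjMap (k := k) h ≫ jjMap h' = jjMap (h'.trans h) := by
  refine NatTrans.ext (funext fun F => sh_hom_ext fun W => ?_)
  exact (F.1.map_comp _ _).symm

instance (U : Opens X) : (restr U : Sh k X ⥤ _).Additive where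
instance (U : Opens X) : (push U : _ ⥤ Sh k X).Additive where

/-- Global sections, that is, the direct image to a point. -/
abbrev globalSections (X : TopCat.{u}) : Sh k X ⥤ ModuleCat.{u} k :=
  TopCat.Sheaf.forget (ModuleCat.{u} k) X ⋙ (evaluation _ _).obj (op ⊤)

instance : (globalSections X : Sh k X ⥤ _).Additive where

end Sheaves

/-- Closed subsets `Z p` of `X` with `Z p ∩ Z q = Z (p ⊓ q)` and `Z ⊤ = X`. -/
structure Arrangement (X : TopCat.{u}) (L : Type u) [SemilatticeInf L] [OrderTop L] where
  Z : L → Closeds X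
  inf : ∀ p q, Z p ⊓ Z q = Z (p ⊓ q)
  top : Z ⊤ = ⊤

namespace Arrangement

variable {k : Type u} [CommRing k] {X : TopCat.{u}} {L : Type u} [SemilatticeInf L] [OrderTop L]
  (Z : Arrangement X L)

lemma mono {p q : L} (h : p ≤ q) : Z.Z p ≤ Z.Z q := by
  rw [← inf_eq_left, Z.inf, inf_eq_left.2 h]

/-- `U_p = X - Z_p`. -/
def U (p : L) : Opens X := (Z.Z p).compl

lemma U_anti {p q : L} (h : p ≤ q) : Z.U q ≤ Z.U p := fun _ hx hp => hx (Z.mono h hp)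

/-- The complement of the union of the `Z_p`, for `p < ⊤`. -/
def compl [Finite L] : Opens X where
  carrier := (⋃ p : Below L, (Z.Z p : Set X))ᶜ
  is_open' := (isClosed_iUnion_of_finite fun p : Below L => (Z.Z p).isClosed).isOpen_compl

lemma compl_le [Finite L] (p : Below L) : Z.compl ≤ Z.U p :=
  fun _ hx hp => hx (Set.mem_iUnion.2 ⟨p, hp⟩)

/-- The representation `p ↦ j_{p*} F|_{U_p}`, with the restriction maps. -/
def jRep : Sh k X ⥤ (L ⥤ Sh k X) where
  obj F :=
    { obj p := (jj (Z.U p)).obj F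
      map g := (jjMap (Z.U_anti (leOfHom g))).app F
      map_id p := NatTrans.congr_app (jjMap_refl (Z.U p)) F
      map_comp g h := (NatTrans.congr_app
        (jjMap_comp (Z.U_anti (leOfHom g)) (Z.U_anti (leOfHom h))) F).symm }
  map f :=
    { app p := (jj (Z.U p)).map f
      naturality p q g := ((jjMap (Z.U_anti (leOfHom g))).naturality f).symm }

instance : (Z.jRep : Sh k X ⥤ _).Additive where

/-- The restriction map from the constant representation `F` to `p ↦ j_{p*} F|_{U_p}`. -/
def toJRep : Functor.const L ⟶ (Z.jRep : Sh k X ⥤ (L ⥤ Sh k X)) where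
  app F :=
    { app p := (jjUnit (Z.U p)).app F
      naturality p q g := by
        refine (Category.id_comp _).trans ?_
        exact (NatTrans.congr_app (jjUnit_map (Z.U_anti (leOfHom g))) F).symm }
  naturality F G f := by
    ext p : 2
    exact (jjUnit (Z.U p)).naturality f

variable (J : CochainComplex (Sh k X) ℤ)

/-- The constant representation `p ↦ J`. -/
abbrev constComplex : CochainComplex (L ⥤ Sh k X) ℤ :=
  ((Functor.const L).mapHomologicalComplex (.up ℤ)).obj J

/-- The representation `p ↦ j_{p*} J|_{U_p}` for a complex `J`. -/
abbrev jComplex : CochainComplex (L ⥤ Sh k X) ℤ :=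
  ((Z.jRep).mapHomologicalComplex (.up ℤ)).obj J

/-- The restriction map `J ⟶ j_{p*} J|_{U_p}`, for all `p`. -/
abbrev constToJ : constComplex J ⟶ Z.jComplex J :=
  (NatTrans.mapHomologicalComplex Z.toJRep (.up ℤ)).app J

/-- `i_{p*} i_p^! J = cone(J ⟶ j_{p*} J|_{U_p})[-1]`, for all `p`. -/
abbrev iShriek : CochainComplex (L ⥤ Sh k X) ℤ :=
  (CochainComplex.mappingCone (Z.constToJ J))⟦(-1 : ℤ)⟧

/-- The canonical map from `j_{p*} J|_{U_p}[-1]` to `i_{p*} i_p^! J`, for all `p`. -/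
abbrev jToI : (Z.jComplex J)⟦(-1 : ℤ)⟧ ⟶ Z.iShriek J :=
  (CochainComplex.mappingCone.inr (Z.constToJ J))⟦(-1 : ℤ)⟧'

variable [Finite L]

/-- `j_* J|_U`, with `U` the complement of the arrangement. -/
abbrev jCompl : CochainComplex (Sh k X) ℤ :=
  ((jj Z.compl).mapHomologicalComplex (.up ℤ)).obj J

/-- The restriction maps `j_{p*} J|_{U_p} ⟶ j_* J|_U` for `p < ⊤`. -/
def cocone : BelowCocone (Z.jComplex J) (Z.jCompl J) where
  f n :=
    { app p := (jjMap (Z.compl_le p)).app (J.X n)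
      naturality p q g := by
        refine Eq.trans ?_ (Category.comp_id _).symm
        exact NatTrans.congr_app (jjMap_comp (Z.U_anti (leOfHom g)) (Z.compl_le q)) (J.X n) }
  comm' i j _ := by
    ext p : 2
    exact ((jjMap (Z.compl_le p)).naturality (J.d i j)).symm

/-- Global sections of a complex of sheaves. -/
abbrev sectionsComplex (X : TopCat.{u}) : CochainComplex (Sh k X) ℤ ⥤ CochainComplex (ModuleCat.{u} k) ℤ :=
  (globalSections X).mapHomologicalComplex (.up ℤ)

/-- Global sections of a complex of representations in sheaves. -/
abbrev sectionsRep (X : TopCat.{u}) (L : Type u) [PartialOrder L] : CochainComplex (L ⥤ Sh k X) ℤ ⥤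
    CochainComplex (L ⥤ ModuleCat.{u} k) ℤ :=
  ((Functor.whiskeringRight L _ _).obj (globalSections X)).mapHomologicalComplex (.up ℤ)

/-- `cocone` on global sections. -/
def sectionsCocone :
    BelowCocone ((sectionsRep X L).obj (Z.jComplex J)) ((sectionsComplex X).obj (Z.jCompl J)) where
  f n :=
    { app p := (globalSections X).map (((Z.cocone J).f n).app p)
      naturality p q g := by
        refine Eq.trans ?_ (Category.comp_id _).symm
        exact ((globalSections X).map_comp _ _).symm.trans
          (congrArg (globalSections X).map
            ((((Z.cocone J).f n).naturality g).trans (Category.comp_id _))) }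
  comm' i j _ := by
    ext p : 2
    exact ((globalSections X).map_comp _ _).symm.trans ((congrArg (globalSections X).map
      (NatTrans.congr_app ((Z.cocone J).comm i j) p)).trans ((globalSections X).map_comp _ _))

/-- `jToI` on global sections. -/
def sectionsJToI : ((sectionsRep X L).obj (Z.jComplex J))⟦(-1 : ℤ)⟧ ⟶
    (sectionsRep X L).obj (Z.iShriek J) :=
  ((sectionsRep X L).commShiftIso (-1 : ℤ)).inv.app _ ≫ (sectionsRep X L).map (Z.jToI J)

end Arrangement

section Derived
variable {k : Type u} [CommRing k] {X : TopCat.{u}}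

/-- `Rj_* j^* F`, with `j` the inclusion of `U`. -/
def RjStar [HasDerivedCategory.{w} (Sh k X)] (U : Opens X)
    [HasDerivedCategory.{w} (Sh k ((Opens.toTopCat X).obj U))] (F : Sh k X) :
    DerivedCategory (Sh k X) :=
  DerivedCategory.Plus.ι.obj ((push U).rightDerivedFunctorPlus.obj
    ((DerivedCategory.Plus.singleFunctor _ 0).obj ((restr U).obj F)))

/-- The derived global sections of `F`. -/
def RGamma [HasDerivedCategory.{w} (ModuleCat.{u} k)] [HasDerivedCategory.{w} (Sh k X)] (F : Sh k X) :
    DerivedCategory (ModuleCat.{u} k) :=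
  DerivedCategory.Plus.ι.obj ((globalSections X).rightDerivedFunctorPlus.obj
    ((DerivedCategory.Plus.singleFunctor _ 0).obj F))

/-- Sheaf cohomology of `F`. -/
def H (n : ℕ) (F : Sh k X) : ModuleCat.{u} k := ((globalSections X).rightDerived n).obj F

end Derived

end PosetRes

end

/-! The sheaf enters only through the system `O ↦ j_{O*} J|_O` indexed by the open sets `O` (or its
global sections). Its terms are flabby systems: restrictions are epimorphisms, the value at the
empty set is zero, and the square of a union and an intersection is cartesian. The central argument
is carried out for a complex `𝓙` of flabby systems in an abelian monoidal category `E`, and is then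
applied to `E` = sheaves and to `E` = `k`-modules.

Call a representation principal at `p` if it is zero off the elements `≥ p` and constant on them.
For `M` principal at `p` the coend collapses: `A ⊗_L M = A(p) ⊗ M(p)` (`isIso_tensorι`). A bounded
above complex of free representations has K-projective values, and quasi-isomorphisms between such
values are homotopy equivalences, which every additive bifunctor preserves. Hence no flatness of `M`
is needed: `R ⊗ M` is acyclic as soon as `R(p)` is, and a map that is a quasi-isomorphism at `p`
stays one after tensoring with `M` (`quasiIso_tensorMap_of_principal`). So a resolution of the
simple representation at `⊤` kills what is principal at `p < ⊤`, a resolution `G` of `k{*}_P` kills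
what is principal at `⊤`, and `G → k L(-, ⊤)` is a quasi-isomorphism on what is principal at `p <
⊤`.

The geometry is a filtration. For open `O` consider `p ↦ 𝓙(U_p ∪ O)`. For `O = X` this is constant;
for `O = U`, the complement of the arrangement, it is `𝓙(U_p)` at `p < ⊤` and `𝓙(U)` at `⊤`. Let `O`
shrink from `X` to `U` by intersecting with one `U_p` at a time, smaller `p` first. Each restriction
map is an epimorphism whose kernel is principal at that `p` (`isPrincipal_kernel_openUnionMap`,
where the binary meets are used). The remaining restriction from `𝓙(U_p ∪ U)` to `𝓙(U_p)` has kernel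
principal at `⊤`, with value `𝓙(U)` there.

For the homotopy colimit, `G` does not see the last kernel, so `𝓙(U_p)` may be replaced by `𝓙(U_p ∪
U)`; on that representation `G` may be replaced by `k L(-, ⊤)`, whose tensor product is the value
`𝓙(U)` at `⊤`. The base case of the filtration, the constant representation, is principal at the
least element, which is not `⊤` because `P` is nonempty. In the zig-zag, the left arrow has
degreewise constant cokernel, and the right arrow begins with an isomorphism because `U_⊤` is empty.

For the other two assertions, flabbiness turns the fibre defining `i^!` into a kernel. Along the
filtration, the derived tensor product identifies it with that of the kernel principal at `⊤`, which
is `𝓙(U)` (`nonempty_iso_tensorComplex_mappingCone`). Independence of the representing complex,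
which may be unbounded, rests on `acyclic_induction`. Finally, flabby sheaves form a class adapted
to direct images and to global sections (`IsAdapted`), so that `𝓙(U)` computes the derived functors.
-/

namespace PosetRes

/-! ### Quasi-isomorphisms and short exact sequences of complexes -/

section Homological

open HomologicalComplex
open scoped ZeroObject

section Exact

variable {A : Type*} [Category* A] [Abelian A]

/-- Both sequences give distinguished triangles in the derived category, where two out of three is
available. -/
lemma quasiIso_τ₁ {S T : ShortComplex (CochainComplex A ℤ)} (hS : S.ShortExact)
    (hT : T.ShortExact) (φ : S ⟶ T) (h₂ : QuasiIso φ.τ₂) (h₃ : QuasiIso φ.τ₃) :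
    QuasiIso φ.τ₁ := by
  let := HasDerivedCategory.standard A
  rw [← DerivedCategory.isIso_Q_map_iff_quasiIso] at h₂ h₃ ⊢
  exact Pretriangulated.isIso₁_of_isIso₂₃ (DerivedCategory.triangleOfSES.map hS hT φ)
    (DerivedCategory.triangleOfSES_distinguished hS)
    (DerivedCategory.triangleOfSES_distinguished hT) h₂ h₃

lemma acyclic_of_isZero {K : CochainComplex A ℤ} (h : IsZero K) : K.Acyclic := fun i => by
  rw [exactAt_iff_isZero_homology]
  exact (homologyFunctor A _ i).map_isZero h

lemma quasiIso_of_acyclic {K M : CochainComplex A ℤ} (f : K ⟶ M) (hK : K.Acyclic)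
    (hM : M.Acyclic) : QuasiIso f where
  quasiIsoAt i := by
    rw [quasiIsoAt_iff_isIso_homologyMap]
    exact ((hK i).isZero_homology).isIso ((hM i).isZero_homology) _

lemma acyclic_of_quasiIso {K M : CochainComplex A ℤ} (f : K ⟶ M) [QuasiIso f] (hM : M.Acyclic) :
    K.Acyclic := fun i => by
  rw [exactAt_iff_of_quasiIsoAt f]
  exact hM i

lemma quasiIso_f_of_acyclic {S : ShortComplex (CochainComplex A ℤ)} (hS : S.ShortExact)
    (h₃ : S.X₃.Acyclic) : QuasiIso S.f := by
  let T : ShortComplex (CochainComplex A ℤ) := ShortComplex.mk (𝟙 S.X₂) (0 : S.X₂ ⟶ 0) (by simp)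
  have hT : T.ShortExact :=
    (ShortComplex.Splitting.mk (S := T) (𝟙 _) 0 (by simp [T]) ((Limits.isZero_zero _).eq_of_src _ _)
      (by simp [T])).shortExact
  let φ : S ⟶ T := { τ₁ := S.f, τ₂ := 𝟙 _, τ₃ := 0 }
  exact quasiIso_τ₁ hS hT φ (inferInstanceAs (QuasiIso (𝟙 _)))
    (quasiIso_of_acyclic _ h₃ (acyclic_of_isZero (Limits.isZero_zero _)))

lemma quasiIso_g_of_acyclic {S : ShortComplex (CochainComplex A ℤ)} (hS : S.ShortExact)
    (h₁ : S.X₁.Acyclic) : QuasiIso S.g := by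
  let T : ShortComplex (CochainComplex A ℤ) := ShortComplex.mk (0 : 0 ⟶ S.X₂) (𝟙 S.X₂) (by simp)
  have hT : T.ShortExact :=
    (ShortComplex.Splitting.mk (S := T) 0 (𝟙 _) ((Limits.isZero_zero _).eq_of_src _ _) (by simp [T])
      (by simp [T])).shortExact
  let φ : T ⟶ S := { τ₁ := 0, τ₂ := 𝟙 _, τ₃ := S.g, comm₁₂ := (Limits.isZero_zero _).eq_of_src _ _ }
  exact HomologySequence.quasiIso_τ₃ φ hT hS
    (quasiIso_of_acyclic _ (acyclic_of_isZero (Limits.isZero_zero _)) h₁) (inferInstanceAs (QuasiIso (𝟙 _)))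

lemma shortExact_kernel {M N : CochainComplex A ℤ} (f : M ⟶ N) [Epi f] :
    (ShortComplex.mk (kernel.ι f) f (kernel.condition f)).ShortExact where
  exact := ShortComplex.exact_of_f_is_kernel _ (kernelIsKernel f)

lemma shortExact_cokernel {M N : CochainComplex A ℤ} (f : M ⟶ N) [Mono f] :
    (ShortComplex.mk f (cokernel.π f) (cokernel.condition f)).ShortExact where
  exact := ShortComplex.exact_of_g_is_cokernel _ (cokernelIsCokernel f)

lemma acyclic_of_homotopy {K : CochainComplex A ℤ} (h : Homotopy (𝟙 K) 0) : K.Acyclic := fun i => by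
  rw [exactAt_iff_isZero_homology, IsZero.iff_id_eq_zero, ← homologyMap_id,
    h.homologyMap_eq, homologyMap_zero]

/-- A functor on complexes preserving short exact sequences and acyclic complexes preserves
quasi-isomorphisms. -/
lemma quasiIso_map_of_exact {B : Type*} [Category* B] [Abelian B]
    (T : CochainComplex A ℤ ⥤ CochainComplex B ℤ) [T.PreservesZeroMorphisms]
    (hT : ∀ S : ShortComplex (CochainComplex A ℤ), S.ShortExact → (S.map T).ShortExact)
    (hac : ∀ K : CochainComplex A ℤ, K.Acyclic → (T.obj K).Acyclic)
    {M N : CochainComplex A ℤ} (f : M ⟶ N) [QuasiIso f] : QuasiIso (T.map f) := by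
  -- Since `C` is contractible and `M` embeds in it, `f` factors as a monomorphism into `N ⊞ C`
  -- followed by a projection with acyclic kernel. Each factor belongs to a short exact sequence
  -- with an acyclic end, which is all that `T` is known to respect.
  let C := CochainComplex.mappingCone (𝟙 M)
  have hC : C.Acyclic := acyclic_of_homotopy (CochainComplex.mappingCone.homotopyToZeroOfId M)
  let a : M ⟶ N ⊞ C := biprod.lift f (CochainComplex.mappingCone.inr (𝟙 M))
  let S₁ : ShortComplex (CochainComplex A ℤ) :=
    ShortComplex.mk (biprod.inr : C ⟶ N ⊞ C) biprod.fst (by simp)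
  have hS₁ : S₁.ShortExact :=
    (ShortComplex.Splitting.mk (S := S₁) biprod.snd biprod.inl (by simp [S₁]) (by simp [S₁])
      (by simp [S₁, ← biprod.total, add_comm])).shortExact
  have hfst : QuasiIso (biprod.fst : N ⊞ C ⟶ N) := quasiIso_g_of_acyclic hS₁ hC
  have hfac : a ≫ biprod.fst = f := by simp [a]
  have ha : QuasiIso a := by
    have : QuasiIso (a ≫ biprod.fst) := by rw [hfac]; infer_instance
    exact quasiIso_of_comp_right a biprod.fst
  have hm : Mono a := by
    have hinr : Mono (CochainComplex.mappingCone.inr (𝟙 M)) :=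
      mono_of_mono_f _ fun i => (SplitMono.mk _ (CochainComplex.mappingCone.inr_f_snd_v (𝟙 M) i)).mono
    have : Mono (a ≫ biprod.snd) := by simpa [a] using hinr
    exact mono_of_mono a biprod.snd
  have hT₁ : QuasiIso (T.map a) := by
    refine quasiIso_f_of_acyclic (hT _ (shortExact_cokernel a)) (hac _ ?_)
    exact (shortExact_cokernel a).acyclic_X₃ ha
  have hT₂ : QuasiIso (T.map (biprod.fst : N ⊞ C ⟶ N)) :=
    quasiIso_g_of_acyclic (hT _ hS₁) (hac _ hC)
  rw [← hfac, T.map_comp]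
  exact quasiIso_comp _ _

lemma shortExact_of_evaluation {K : Type*} [Category* K] (S : ShortComplex (K ⥤ A))
    (h : ∀ x, (S.map ((evaluation K A).obj x)).ShortExact) : S.ShortExact where
  exact := by
    rw [ShortComplex.exact_iff_isZero_homology, IsZero.iff_id_eq_zero]
    ext x
    exact (IsZero.of_iso ((ShortComplex.exact_iff_isZero_homology _).1 (h x).exact)
      (S.mapHomologyIso ((evaluation K A).obj x)).symm).eq_of_src _ _
  mono_f := by
    have := fun x => (h x).mono_f
    have : ∀ x, Mono (S.f.app x) := this
    exact NatTrans.mono_of_mono_app _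
  epi_g := by
    have := fun x => (h x).epi_g
    have : ∀ x, Epi (S.g.app x) := this
    exact NatTrans.epi_of_epi_app _

lemma shortExact_sigma {I : Type*} [HasColimitsOfShape (Discrete I) A]
    [HasExactColimitsOfShape (Discrete I) A] (S : I → ShortComplex A)
    (hS : ∀ i, (S i).ShortExact) :
    (ShortComplex.mk (Limits.Sigma.map fun i => (S i).f) (Limits.Sigma.map fun i => (S i).g)
      (by ext; simp)).ShortExact := by
  let T : ShortComplex (Discrete I ⥤ A) :=
    { X₁ := Discrete.functor fun i => (S i).X₁
      X₂ := Discrete.functor fun i => (S i).X₂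
      X₃ := Discrete.functor fun i => (S i).X₃
      f := Discrete.natTrans fun i => (S i.as).f
      g := Discrete.natTrans fun i => (S i.as).g
      zero := by ext ⟨i⟩; exact (S i).zero }
  have hT : T.ShortExact := shortExact_of_evaluation _ fun ⟨i⟩ => hS i
  have : PreservesFiniteColimits (colim : (Discrete I ⥤ A) ⥤ A) := inferInstance
  exact hT.map_of_exact colim

end Exact

end Homological

/-! ### Total complexes of additive bifunctors -/

section Total

open HomologicalComplex

variable {C₁ C₂ D : Type*} [Category* C₁] [Category* C₂] [Category* D]
  [Preadditive C₁] [Preadditive C₂]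

section

variable [Preadditive D] [HasCoproducts.{0} D]
  (B : C₁ ⥤ C₂ ⥤ D) [B.Additive] [∀ A, (B.obj A).Additive]

/-- Exhibits the maps of total complexes as maps of coproducts, so that invertibility and exactness
can be tested on the individual summands. -/
lemma mapBifunctorMap_f_eq {K K' : CochainComplex C₁ ℤ} {M M' : CochainComplex C₂ ℤ}
    (f : K ⟶ K') (g : M ⟶ M') (n : ℤ) :
    (mapBifunctorMap f g B (.up ℤ)).f n =
      Limits.Sigma.map fun x : ComplexShape.π (.up ℤ) (.up ℤ) (.up ℤ) ⁻¹' {n} =>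
        (B.map (f.f x.1.1)).app (M.X x.1.2) ≫ (B.obj (K'.X x.1.1)).map (g.f x.1.2) := by
  refine mapBifunctor.hom_ext (fun i j h => ?_)
  rw [ι_mapBifunctorMap]
  refine Eq.trans ?_ (Sigma.ι_map (fun x : ComplexShape.π (.up ℤ) (.up ℤ) (.up ℤ) ⁻¹' {n} =>
        (B.map (f.f x.1.1)).app (M.X x.1.2) ≫ (B.obj (K'.X x.1.1)).map (g.f x.1.2)) ⟨(i, j), h⟩).symm
  rw [Category.assoc]
  rfl

lemma isIso_mapBifunctorMap {K K' : CochainComplex C₁ ℤ} {M M' : CochainComplex C₂ ℤ}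
    (f : K ⟶ K') (g : M ⟶ M')
    (h : ∀ i j, IsIso ((B.map (f.f i)).app (M.X j) ≫ (B.obj (K'.X i)).map (g.f j))) :
    IsIso (mapBifunctorMap f g B (.up ℤ)) := by
  have (n : ℤ) : IsIso ((mapBifunctorMap f g B (.up ℤ)).f n) := by
    rw [mapBifunctorMap_f_eq]
    exact (Sigma.mapIso fun x : ComplexShape.π (.up ℤ) (.up ℤ) (.up ℤ) ⁻¹' {n} =>
      @asIso _ _ _ _ _ (h x.1.1 x.1.2)).isIso_hom
  exact HomologicalComplex.Hom.isIso_of_components _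

lemma mapBifunctorMap_comp {K K' K'' : CochainComplex C₁ ℤ} {M M' M'' : CochainComplex C₂ ℤ}
    (f : K ⟶ K') (f' : K' ⟶ K'') (g : M ⟶ M') (g' : M' ⟶ M'') :
    mapBifunctorMap (f ≫ f') (g ≫ g') B (.up ℤ) =
      mapBifunctorMap f g B (.up ℤ) ≫ mapBifunctorMap f' g' B (.up ℤ) := by
  ext n i j h
  simp

/-- Homotopies survive any additive bifunctor. This replaces flatness: quasi-isomorphisms of free
complexes are turned into homotopy equivalences before tensoring. -/
lemma quasiIso_mapBifunctorMap_of_homotopyEquiv [CategoryWithHomology D]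
    {K K' : CochainComplex C₁ ℤ} (e : HomotopyEquiv K K') (M : CochainComplex C₂ ℤ) :
    QuasiIso (mapBifunctorMap e.hom (𝟙 M) B (.up ℤ)) := by
  let e' : HomotopyEquiv (mapBifunctor K M B (.up ℤ)) (mapBifunctor K' M B (.up ℤ)) :=
    { hom := mapBifunctorMap e.hom (𝟙 M) B (.up ℤ)
      inv := mapBifunctorMap e.inv (𝟙 M) B (.up ℤ)
      homotopyHomInvId := (Homotopy.ofEq (by
          rw [← mapBifunctorMap_comp, Category.comp_id])).trans
        ((mapBifunctorMapHomotopy₁ e.homotopyHomInvId (𝟙 M) B (.up ℤ)).trans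
          (Homotopy.ofEq (by ext n i j h; simp)))
      homotopyInvHomId := (Homotopy.ofEq (by
          rw [← mapBifunctorMap_comp, Category.comp_id])).trans
        ((mapBifunctorMapHomotopy₁ e.homotopyInvHomId (𝟙 M) B (.up ℤ)).trans
          (Homotopy.ofEq (by ext n i j h; simp))) }
  exact e'.quasiIso_hom

variable {C₁' C₂' : Type*} [Category* C₁'] [Category* C₂'] [Preadditive C₁'] [Preadditive C₂']
  (B' : C₁' ⥤ C₂' ⥤ D) [B'.Additive] [∀ A, (B'.obj A).Additive]
  (F₁ : C₁ ⥤ C₁') (F₂ : C₂ ⥤ C₂') [F₁.Additive] [F₂.Additive]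
  (α : F₁ ⋙ B' ⋙ (Functor.whiskeringLeft C₂ C₂' D).obj F₂ ⟶ B)

/-- A natural transformation between bifunctors induces a morphism of total complexes. -/
noncomputable def mapBifunctorTrans (K : CochainComplex C₁ ℤ) (M : CochainComplex C₂ ℤ) :
    mapBifunctor ((F₁.mapHomologicalComplex (.up ℤ)).obj K)
      ((F₂.mapHomologicalComplex (.up ℤ)).obj M) B' (.up ℤ) ⟶ mapBifunctor K M B (.up ℤ) :=
  HomologicalComplex₂.total.map (HomologicalComplex₂.homMk
    (fun x => (α.app (K.X x.1)).app (M.X x.2))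
    (fun i i' j _ => (NatTrans.congr_app (α.naturality (K.d i i')) (M.X j)).symm)
    (fun i j j' _ => ((α.app (K.X i)).naturality (M.d j j')).symm)) _

@[simp]
lemma ι_mapBifunctorTrans (K : CochainComplex C₁ ℤ) (M : CochainComplex C₂ ℤ) (i j n : ℤ)
    (h : ComplexShape.π (.up ℤ) (.up ℤ) (.up ℤ) (i, j) = n) :
    ιMapBifunctor ((F₁.mapHomologicalComplex (.up ℤ)).obj K)
      ((F₂.mapHomologicalComplex (.up ℤ)).obj M) B' (.up ℤ) i j n h ≫
        (mapBifunctorTrans B B' F₁ F₂ α K M).f n =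
      (α.app (K.X i)).app (M.X j) ≫ ιMapBifunctor K M B (.up ℤ) i j n h :=
  HomologicalComplex₂.ιTotal_map _ _ _ _ _ _ _ _

@[simp]
lemma ι_mapBifunctorTrans_assoc (K : CochainComplex C₁ ℤ) (M : CochainComplex C₂ ℤ) (i j n : ℤ)
    (h : ComplexShape.π (.up ℤ) (.up ℤ) (.up ℤ) (i, j) = n) {Z : D}
    (f : (mapBifunctor K M B (.up ℤ)).X n ⟶ Z) :
    ιMapBifunctor ((F₁.mapHomologicalComplex (.up ℤ)).obj K)
      ((F₂.mapHomologicalComplex (.up ℤ)).obj M) B' (.up ℤ) i j n h ≫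
        (mapBifunctorTrans B B' F₁ F₂ α K M).f n ≫ f =
      (α.app (K.X i)).app (M.X j) ≫ ιMapBifunctor K M B (.up ℤ) i j n h ≫ f := by
  refine (Category.assoc _ _ _).symm.trans ?_
  rw [ι_mapBifunctorTrans]
  exact Category.assoc _ _ _

lemma isIso_mapBifunctorTrans (K : CochainComplex C₁ ℤ) (M : CochainComplex C₂ ℤ)
    (h : ∀ i j, IsIso ((α.app (K.X i)).app (M.X j))) :
    IsIso (mapBifunctorTrans B B' F₁ F₂ α K M) := by
  have (n : ℤ) : IsIso ((mapBifunctorTrans B B' F₁ F₂ α K M).f n) := by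
    have e : (mapBifunctorTrans B B' F₁ F₂ α K M).f n =
        Limits.Sigma.map fun x : ComplexShape.π (.up ℤ) (.up ℤ) (.up ℤ) ⁻¹' {n} =>
          (α.app (K.X x.1.1)).app (M.X x.1.2) := by
      refine mapBifunctor.hom_ext (fun i j h => ?_)
      rw [ι_mapBifunctorTrans]
      exact (Sigma.ι_map (fun x : ComplexShape.π (.up ℤ) (.up ℤ) (.up ℤ) ⁻¹' {n} =>
        (α.app (K.X x.1.1)).app (M.X x.1.2)) ⟨(i, j), h⟩).symm
    rw [e]
    exact (Sigma.mapIso fun x : ComplexShape.π (.up ℤ) (.up ℤ) (.up ℤ) ⁻¹' {n} => @asIso _ _ _ _ _ (h x.1.1 x.1.2)).isIso_hom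
  exact HomologicalComplex.Hom.isIso_of_components _

lemma mapBifunctorTrans_natural {K K' : CochainComplex C₁ ℤ} (f : K ⟶ K')
    (M : CochainComplex C₂ ℤ) :
    mapBifunctorMap ((F₁.mapHomologicalComplex (.up ℤ)).map f) (𝟙 _) B' (.up ℤ) ≫
        mapBifunctorTrans B B' F₁ F₂ α K' M =
      mapBifunctorTrans B B' F₁ F₂ α K M ≫ mapBifunctorMap f (𝟙 M) B (.up ℤ) := by
  ext n i j h
  have e : (B'.map (F₁.map (f.f i))).app (F₂.obj (M.X j)) ≫ (α.app (K'.X i)).app (M.X j) =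
      (α.app (K.X i)).app (M.X j) ≫ (B.map (f.f i)).app (M.X j) :=
    NatTrans.congr_app (α.naturality (f.f i)) (M.X j)
  simp only [comp_f, ι_mapBifunctorMap_assoc, ι_mapBifunctorTrans, ι_mapBifunctorTrans_assoc]
  have e' := ι_mapBifunctorMap f (𝟙 M) B (.up ℤ) i j n h
  rw [id_f, CategoryTheory.Functor.map_id, Category.id_comp] at e'
  refine (congrArg (fun t => (B'.map (F₁.map (f.f i))).app (F₂.obj (M.X j)) ≫ t ≫
    (α.app (K'.X i)).app (M.X j) ≫ ιMapBifunctor K' M B (.up ℤ) i j n h)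
    ((B'.obj _).map_id _)).trans ?_
  rw [Category.id_comp, reassoc_of% e]
  exact (congrArg (fun t => (α.app (K.X i)).app (M.X j) ≫ t) e'.symm)

end

section

variable [Abelian D] [HasCoproducts.{0} D] [AB4OfSize.{0} D]
  (B : C₁ ⥤ C₂ ⥤ D) [B.Additive] [∀ A, (B.obj A).Additive]

/-- The total complex as a functor of the second complex. -/
noncomputable abbrev totalFunctor (K : CochainComplex C₁ ℤ) :
    CochainComplex C₂ ℤ ⥤ CochainComplex D ℤ :=
  (Functor.map₂CochainComplex B).obj K

lemma mapBifunctorMap_id_add (K : CochainComplex C₁ ℤ) {M N : CochainComplex C₂ ℤ} (f g : M ⟶ N) :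
    mapBifunctorMap (𝟙 K) (f + g) B (.up ℤ) =
      mapBifunctorMap (𝟙 K) f B (.up ℤ) + mapBifunctorMap (𝟙 K) g B (.up ℤ) := by
  refine HomologicalComplex.hom_ext _ _ (fun n => mapBifunctor.hom_ext fun i j h => ?_)
  rw [add_f_apply, Preadditive.comp_add]
  simp

instance (K : CochainComplex C₁ ℤ) : (totalFunctor B K).Additive where
  map_add {_ _ f g} := mapBifunctorMap_id_add B K f g

/-- Each degree of the total complex is a coproduct, possibly infinite, and coproducts are exact by
AB4; no boundedness is required. -/
lemma shortExact_totalFunctor (K : CochainComplex C₁ ℤ) (S : ShortComplex (CochainComplex C₂ ℤ))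
    (h : ∀ i j, ((S.map (eval C₂ (.up ℤ) j)).map (B.obj (K.X i))).ShortExact) :
    (S.map (totalFunctor B K)).ShortExact := by
  refine shortExact_of_degreewise_shortExact _ fun n => ?_
  let T := fun x : ComplexShape.π (.up ℤ) (.up ℤ) (.up ℤ) ⁻¹' {n} =>
    (S.map (eval C₂ (.up ℤ) x.1.2)).map (B.obj (K.X x.1.1))
  have hT := shortExact_sigma T fun x => h _ _
  have e {M N : CochainComplex C₂ ℤ} (f : M ⟶ N) :
      (mapBifunctorMap (𝟙 K) f B (.up ℤ)).f n =
        Limits.Sigma.map fun x : ComplexShape.π (.up ℤ) (.up ℤ) (.up ℤ) ⁻¹' {n} =>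
          (B.obj (K.X x.1.1)).map (f.f x.1.2) := by
    rw [mapBifunctorMap_f_eq]
    congr 1
    ext x
    simp
  have e' : (S.map (totalFunctor B K)).map (eval D (.up ℤ) n) =
      ShortComplex.mk (Limits.Sigma.map fun i => (T i).f) (Limits.Sigma.map fun i => (T i).g)
        (by ext; simp) := by
    have e₁ := e S.f
    have e₂ := e S.g
    simp only [ShortComplex.map, T]
    congr
  rw [e']
  exact hT

end

section

variable [HasZeroObject C₁] [Preadditive D] [HasCoproducts.{0} D]
  (B : C₁ ⥤ C₂ ⥤ D) [B.Additive] [∀ A, (B.obj A).Additive]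

lemma ι_singleDesc (A : C₁) (K : CochainComplex C₂ ℤ) (n : ℤ) :
    ιMapBifunctor ((single C₁ (.up ℤ) 0).obj A) K B (.up ℤ) 0 n n (zero_add n) ≫
      (singleDesc B A K).f n = (B.map (singleObjXSelf (.up ℤ) 0 A).hom).app (K.X n) := by
  dsimp only [singleDesc]
  erw [ι_mapBifunctorDesc, dif_pos rfl]
  exact (congrArg _ ((B.obj A).map_id _)).trans (Category.comp_id _)

/-- Every summand other than `(0, n)` involves a zero term of the single complex. -/
lemma isIso_ι_single (A : C₁) (K : CochainComplex C₂ ℤ) (n : ℤ) :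
    IsIso (ιMapBifunctor ((single C₁ (.up ℤ) 0).obj A) K B (.up ℤ) 0 n n (zero_add n)) := by
  let r : (mapBifunctor ((single C₁ (.up ℤ) 0).obj A) K B (.up ℤ)).X n ⟶
      (B.obj (((single C₁ (.up ℤ) 0).obj A).X 0)).obj (K.X n) :=
    mapBifunctorDesc fun i j h =>
      if h₁ : i = 0 then (B.map (eqToHom (by rw [h₁]))).app (K.X j) ≫
        (B.obj _).map (eqToHom (by
          have h' : i + j = n := h
          congr 1
          omega))
      else 0
  have hr : ιMapBifunctor ((single C₁ (.up ℤ) 0).obj A) K B (.up ℤ) 0 n n (zero_add n) ≫ r = 𝟙 _ := by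
    refine (ι_mapBifunctorDesc _ _ _ _).trans ((dif_pos rfl).trans ?_)
    simp
  refine ⟨r, hr, mapBifunctor.hom_ext fun i j h => ?_⟩
  by_cases hi : i = 0
  · subst hi
    have h' : 0 + j = n := h
    obtain rfl : j = n := by omega
    rw [reassoc_of% hr, Category.comp_id]
  · refine IsZero.eq_of_src ?_ _ _
    rw [IsZero.iff_id_eq_zero]
    have h₀ : 𝟙 (((single C₁ (.up ℤ) 0).obj A).X i) = 0 :=
      (isZero_single_obj_X (.up ℤ) 0 A i hi).eq_of_src _ _
    rw [← NatTrans.id_app, ← B.map_id, h₀, B.map_zero]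
    rfl

lemma isIso_singleDesc (A : C₁) (K : CochainComplex C₂ ℤ) : IsIso (singleDesc B A K) := by
  have (n : ℤ) : IsIso ((singleDesc B A K).f n) := by
    have := isIso_ι_single B A K n
    have h : IsIso ((B.map (singleObjXSelf (.up ℤ) 0 A).hom).app (K.X n)) := inferInstance
    rw [← ι_singleDesc] at h
    exact @IsIso.of_isIso_comp_left _ _ _ _ _ _ _ this h
  exact HomologicalComplex.Hom.isIso_of_components _

end

end Total

/-! ### Principal representations and the tensor product over the poset -/

section Principal

variable {L : Type*} [Preorder L] {E : Type*} [Category* E]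

/-- A representation that vanishes outside of the elements `≥ p` and is constant on those. -/
structure IsPrincipal (p : L) (M : L ⥤ E) : Prop where
  isZero : ∀ q, ¬ p ≤ q → IsZero (M.obj q)
  isIso : ∀ q (h : p ≤ q), IsIso (M.map (homOfLE h))

end Principal

section TensorIso

variable {k : Type u} [CommRing k] {L : Type u} [PartialOrder L]
  {E : Type (u+1)} [Category.{u} E] [MonoidalCategory E] [Abelian E]
  [MonoidalPreadditive E] [HasColimitsOfSize.{u, u} E]
  (κ : ModuleCat.{u} k ⥤ E) [κ.Additive]

lemma tensorι_condition (A : Lᵒᵖ ⥤ ModuleCat.{u} k) (M : L ⥤ E) {p q : L} (g : p ⟶ q) :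
    (κ.map (A.map g.op) ▷ M.obj p) ≫ tensorι L κ A M p =
      (κ.obj (A.obj (op q)) ◁ M.map g) ≫ tensorι L κ A M q :=
  coend.condition (((externalProductBifunctorCurried Lᵒᵖ L E).obj (A ⋙ κ)).obj M) g

lemma isZero_whiskerLeft {A M : E} (h : IsZero M) : IsZero (A ⊗ M) := by
  rw [IsZero.iff_id_eq_zero, ← whiskerLeft_id, h.eq_of_src (𝟙 M) 0,
    MonoidalPreadditive.whiskerLeft_zero]

lemma isZero_whiskerRight {A M : E} (h : IsZero A) : IsZero (A ⊗ M) := by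
  rw [IsZero.iff_id_eq_zero, ← id_whiskerRight, h.eq_of_src (𝟙 A) 0,
    MonoidalPreadditive.zero_whiskerRight]

-- The coend collapses: above `p` every `M q` is identified with `M p`, so the restriction of `A`
-- from `q` to `p` gives a map back to `A p ⊗ M p`, and the other summands vanish.
open scoped Classical in
lemma isIso_tensorι (A : Lᵒᵖ ⥤ ModuleCat.{u} k) {p : L} {M : L ⥤ E} (hM : IsPrincipal p M) :
    IsIso (tensorι L κ A M p) := by
  have := hM.isIso
  let r : ((tensorK L κ).obj A).obj M ⟶ κ.obj (A.obj (op p)) ⊗ M.obj p :=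
    tensorDesc κ A M (fun q => if h : p ≤ q then
        (κ.map (A.map (homOfLE h).op) ▷ M.obj q) ≫ (κ.obj (A.obj (op p)) ◁ inv (M.map (homOfLE h)))
      else 0) fun q q' g => by
        by_cases h : p ≤ q
        · have h' : p ≤ q' := h.trans (leOfHom g)
          rw [dif_pos h, dif_pos h', ← comp_whiskerRight_assoc, ← κ.map_comp, ← A.map_comp,
            whisker_exchange_assoc, ← whiskerLeft_comp]
          have e : M.map g ≫ inv (M.map (homOfLE h')) = inv (M.map (homOfLE h)) := by
            rw [IsIso.comp_inv_eq, IsIso.eq_inv_comp, ← M.map_comp]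
            rfl
          rw [e]
          rfl
        · exact (isZero_whiskerLeft (hM.isZero q h)).eq_of_src _ _
  refine ⟨r, ?_, ?_⟩
  · refine (tensorι_desc κ A M _ _ p).trans ?_
    rw [dif_pos le_rfl]
    have e₁ : A.map (homOfLE (le_refl p)).op = 𝟙 _ := A.map_id _
    have e₂ : inv (M.map (homOfLE (le_refl p))) = 𝟙 _ := by
      rw [IsIso.inv_eq_of_hom_inv_id]
      exact (Category.comp_id _).trans (M.map_id _)
    rw [e₁, e₂]
    simp
  · refine tensor_hom_ext fun q => ?_
    rw [Category.comp_id]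
    refine (Category.assoc _ _ _).symm.trans ?_
    refine (congrArg (· ≫ tensorι L κ A M p) (tensorι_desc κ A M _ _ q)).trans ?_
    by_cases h : p ≤ q
    · rw [dif_pos h, ← whisker_exchange, Category.assoc, tensorι_condition, ← whiskerLeft_comp_assoc,
        IsIso.inv_hom_id]
      simp
    · exact (isZero_whiskerLeft (hM.isZero q h)).eq_of_src _ _

variable (υ : κ.obj (𝟙_ (ModuleCat.{u} k)) ⟶ 𝟙_ E)

/-- The augmentation of `k L(q, p)`. -/
noncomputable def freeCoeff (p q : L) : (freeOn k L p).obj (op q) ⟶ 𝟙_ (ModuleCat.{u} k) :=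
  ModuleCat.ofHom (Finsupp.linearCombination k fun _ => (1 : k))

lemma map_freeCoeff (p : L) {q q' : L} (g : q ⟶ q') :
    (freeOn k L p).map g.op ≫ freeCoeff p q = freeCoeff p q' := by
  refine ModuleCat.hom_ext (Finsupp.lhom_ext' fun x => LinearMap.ext_ring ?_)
  simp [freeCoeff, freeOn, ModuleCat.free]

/-- The generator of `k L(q, p)`, for `q ≤ p`. -/
noncomputable def freeGen {p q : L} (h : q ⟶ p) :
    𝟙_ (ModuleCat.{u} k) ⟶ (freeOn k L p).obj (op q) :=
  ModuleCat.ofHom (Finsupp.lsingle h)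

lemma freeGen_coeff {p q : L} (h : q ⟶ p) :
    freeGen h ≫ freeCoeff p q = 𝟙 (𝟙_ (ModuleCat.{u} k)) := by
  refine ModuleCat.hom_ext (LinearMap.ext_ring ?_)
  exact (Finsupp.linearCombination_single k (1 : k) h).trans (by simp)

lemma coeff_freeGen {p q : L} (h : q ⟶ p) :
    freeCoeff p q ≫ freeGen h = 𝟙 ((freeOn k L p).obj (op q)) := by
  refine ModuleCat.hom_ext (Finsupp.lhom_ext' fun x => LinearMap.ext_ring ?_)
  obtain rfl : x = h := Subsingleton.elim (α := ULift (PLift _)) _ _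
  exact (congrArg (Finsupp.lsingle (R := k) x)
    ((Finsupp.linearCombination_single k (1 : k) x).trans (one_smul _ _)))

lemma isZero_freeOn_obj {p q : L} (h : ¬ q ≤ p) : IsZero ((freeOn k L p).obj (op q)) := by
  have : IsEmpty ((yoneda.obj p).obj (op q)) := ⟨fun f => h (leOfHom f)⟩
  exact ModuleCat.isZero_of_iff_subsingleton.2
    (inferInstanceAs (Subsingleton ((yoneda.obj p).obj (op q) →₀ k)))

open scoped Classical in
/-- The evaluation `k L(-, p) ⊗_L M ⟶ M p`. -/
noncomputable def freeEval (p : L) (M : L ⥤ E) :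
    ((tensorK L κ).obj (freeOn k L p)).obj M ⟶ M.obj p :=
  tensorDesc κ (freeOn k L p) M (fun q => if h : q ≤ p then
      (κ.map (freeCoeff p q) ≫ υ) ▷ M.obj q ≫ (λ_ (M.obj q)).hom ≫ M.map (homOfLE h) else 0)
    (fun q q' g => by
      by_cases h' : q' ≤ p
      · rw [dif_pos h', dif_pos ((leOfHom g).trans h'), ← comp_whiskerRight_assoc,
          ← Category.assoc (κ.map _), ← κ.map_comp, map_freeCoeff, whisker_exchange_assoc,
          leftUnitor_naturality_assoc, ← M.map_comp]
        rfl
      · exact (isZero_whiskerRight (κ.map_isZero (isZero_freeOn_obj h'))).eq_of_src _ _)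

lemma tensorι_freeEval (p : L) (M : L ⥤ E) {q : L} (h : q ≤ p) :
    tensorι L κ _ M q ≫ freeEval κ υ p M =
      (κ.map (freeCoeff p q) ≫ υ) ▷ M.obj q ≫ (λ_ (M.obj q)).hom ≫ M.map (homOfLE h) :=
  (tensorι_desc κ _ M _ _ q).trans (dif_pos h)

lemma freeEval_natural (p : L) {M N : L ⥤ E} (f : M ⟶ N) :
    ((tensorK L κ).obj (freeOn k L p)).map f ≫ freeEval κ υ p N = freeEval κ υ p M ≫ f.app p := by
  refine tensor_hom_ext fun q => ?_
  rw [← Category.assoc, tensorι_map_right, Category.assoc]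
  refine Eq.trans ?_ (Category.assoc _ _ _)
  by_cases h : q ≤ p
  · rw [tensorι_freeEval κ υ p N h, tensorι_freeEval κ υ p M h, whisker_exchange_assoc,
      leftUnitor_naturality_assoc]
    simp
  · exact (isZero_whiskerRight (κ.map_isZero (isZero_freeOn_obj h))).eq_of_src _ _

/-- The co-Yoneda isomorphism. Its inverse inserts the generator `𝟙 p` at `p`, which needs `υ` to
identify the image of `k` with the unit. -/
lemma isIso_freeEval [IsIso υ] (p : L) (M : L ⥤ E) : IsIso (freeEval κ υ p M) := by
  let r : M.obj p ⟶ ((tensorK L κ).obj (freeOn k L p)).obj M :=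
    (λ_ (M.obj p)).inv ≫ (inv υ ≫ κ.map (freeGen (𝟙 p))) ▷ M.obj p ≫ tensorι L κ _ M p
  refine ⟨r, ?_, ?_⟩
  · refine tensor_hom_ext fun q => ?_
    by_cases h : q ≤ p
    · rw [Category.comp_id]
      refine (Category.assoc _ _ _).symm.trans ?_
      rw [tensorι_freeEval κ υ p M h]
      have e : ((κ.map (freeCoeff p q) ≫ υ) ≫ inv υ ≫ κ.map (freeGen (𝟙 p))) ≫
          κ.map ((freeOn k L p).map (homOfLE h).op) = 𝟙 _ := by
        simp only [Category.assoc, IsIso.hom_inv_id_assoc, ← κ.map_comp]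
        have e' : freeGen (𝟙 p) ≫ (freeOn k L p).map (homOfLE h).op = freeGen (homOfLE h) := by
          rw [← Category.comp_id ((freeOn k L p).map (homOfLE h).op), ← coeff_freeGen (homOfLE h),
            reassoc_of% map_freeCoeff, reassoc_of% freeGen_coeff]
        rw [e', coeff_freeGen, κ.map_id]
      simp only [r, Category.assoc]
      rw [leftUnitor_inv_naturality_assoc, Iso.hom_inv_id_assoc, whisker_exchange_assoc,
        ← tensorι_condition, ← comp_whiskerRight_assoc, ← comp_whiskerRight_assoc, e]
      simp
    · exact (isZero_whiskerRight (κ.map_isZero (isZero_freeOn_obj h))).eq_of_src _ _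
  · simp only [r, Category.assoc]
    rw [tensorι_freeEval κ υ p M le_rfl]
    have e₁ : M.map (homOfLE (le_refl p)) = 𝟙 _ := M.map_id _
    have e₂ : (inv υ ≫ κ.map (freeGen (𝟙 p))) ≫ κ.map (freeCoeff p p) ≫ υ = 𝟙 _ := by
      rw [Category.assoc, ← κ.map_comp_assoc, freeGen_coeff]
      simp
    rw [← comp_whiskerRight_assoc, e₂, e₁]
    simp


section Colimits

variable {J : Type*} [Category* J] [HasColimitsOfShape J (ModuleCat.{u} k)]

/-- The tensor product over `L` commutes with colimits in the first variable. -/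
lemma preservesColimits_tensorK (hκ : ∀ S : E, PreservesColimitsOfShape J (κ ⋙ tensorRight S))
    (M : L ⥤ E) :
    PreservesColimitsOfShape J ((tensorK L κ).flip.obj M) where
  preservesColimit {F} := ⟨fun {c} hc => by
    have hP (p q : L) : PreservesColimitsOfShape J
        ((evaluation Lᵒᵖ (ModuleCat.{u} k)).obj (op q) ⋙ κ ⋙ tensorRight (M.obj p)) :=
      have := hκ (M.obj p)
      inferInstance
    -- The off-diagonal pairs are needed as well: compatibility of a map out of the coend with `p ⟶
    -- q` is an equation on `A q ⊗ M p`.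
    let Q (p q : L) := isColimitOfPreserves
      ((evaluation Lᵒᵖ (ModuleCat.{u} k)).obj (op q) ⋙ κ ⋙ tensorRight (M.obj p)) hc
    let t (s : Cocone (F ⋙ (tensorK L κ).flip.obj M)) (p : L) :
        Cocone (F ⋙ (evaluation Lᵒᵖ (ModuleCat.{u} k)).obj (op p) ⋙ κ ⋙ tensorRight (M.obj p)) :=
      { pt := s.pt
        ι :=
          { app j := tensorι L κ (F.obj j) M p ≫ s.ι.app j
            naturality j j' f := by
              refine (Category.assoc _ _ _).symm.trans ?_
              refine (congrArg (· ≫ s.ι.app j') (tensorι_map_left κ (F.map f) M p).symm).trans ?_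
              refine (Category.assoc _ _ _).trans ?_
              refine (congrArg (tensorι L κ (F.obj j) M p ≫ ·) (s.w f)).trans ?_
              exact (Category.comp_id _).symm } }
    have ht (s) (p : L) (j : J) : κ.map ((c.ι.app j).app (op p)) ▷ M.obj p ≫ (Q p p).desc (t s p) =
        tensorι L κ (F.obj j) M p ≫ s.ι.app j := (Q p p).fac (t s p) j
    let d (s : Cocone (F ⋙ (tensorK L κ).flip.obj M)) :
        ((tensorK L κ).flip.obj M).obj c.pt ⟶ s.pt :=
      tensorDesc κ c.pt M (fun p => (Q p p).desc (t s p)) fun p q g => by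
        refine (Q p q).hom_ext fun j => ?_
        change κ.map ((c.ι.app j).app (op q)) ▷ M.obj p ≫ _ = κ.map ((c.ι.app j).app (op q)) ▷ M.obj p ≫ _
        have nat : (c.ι.app j).app (op q) ≫ c.pt.map g.op =
            (F.obj j).map g.op ≫ (c.ι.app j).app (op p) := ((c.ι.app j).naturality g.op).symm
        rw [← comp_whiskerRight_assoc, ← κ.map_comp, nat, κ.map_comp,
          comp_whiskerRight_assoc, ht, reassoc_of% tensorι_condition κ (F.obj j) M g, ← ht]
        exact whisker_exchange_assoc _ _ _
    refine ⟨⟨d, fun s j => ?_, fun s m hm => ?_⟩⟩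
    · refine tensor_hom_ext fun p => ?_
      refine (Category.assoc _ _ _).symm.trans ?_
      refine (congrArg (· ≫ d s) (tensorι_map_left κ (c.ι.app j) M p)).trans ?_
      refine (Category.assoc _ _ _).trans ?_
      exact (congrArg (_ ≫ ·) (tensorι_desc κ c.pt M _ _ p)).trans (ht s p j)
    · refine tensor_hom_ext fun p => (Q p p).hom_ext fun j => ?_
      change κ.map ((c.ι.app j).app (op p)) ▷ M.obj p ≫ _ = κ.map ((c.ι.app j).app (op p)) ▷ M.obj p ≫ _
      rw [tensorι_desc, ht, ← hm j]
      refine Eq.trans ?_ (Category.assoc _ _ _)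
      refine (Category.assoc _ _ _).symm.trans ?_
      exact congrArg (· ≫ m) (tensorι_map_left κ (c.ι.app j) M p).symm⟩

end Colimits

section Free

variable [IsIso υ]
  (hκ : ∀ (I : Type u) (S : E), PreservesColimitsOfShape (Discrete I) (κ ⋙ tensorRight S))

variable {κ} in
include υ in
lemma shortExact_tensorK_freeOn (p : L) (S : ShortComplex (L ⥤ E)) (hS : S.ShortExact) :
    (S.map ((tensorK L κ).obj (freeOn k L p))).ShortExact := by
  let e (M : L ⥤ E) : ((tensorK L κ).obj (freeOn k L p)).obj M ≅ M.obj p :=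
    have := isIso_freeEval κ υ p M
    asIso (freeEval κ υ p M)
  exact ShortComplex.shortExact_of_iso
    (ShortComplex.isoMk (e S.X₁) (e S.X₂) (e S.X₃) (freeEval_natural κ υ p S.f).symm
      (freeEval_natural κ υ p S.g).symm).symm (hS.map_of_exact ((evaluation L E).obj p))

include υ hκ in
variable {κ} in
/-- The tensor product with a free right representation is exact. -/
lemma shortExact_tensorK [AB4OfSize.{u} E] {A : Lᵒᵖ ⥤ ModuleCat.{u} k} (hA : IsFreeModule A)
    (S : ShortComplex (L ⥤ E)) (hS : S.ShortExact) :
    (S.map ((tensorK L κ).obj A)).ShortExact := by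
  obtain ⟨I, b, ⟨e⟩⟩ := hA
  have hP := fun M : L ⥤ E => preservesColimits_tensorK κ (hκ I) M
  let T := fun i => S.map ((tensorK L κ).obj (freeOn k L (b i)))
  have hT := shortExact_sigma T fun i => shortExact_tensorK_freeOn υ (b i) S hS
  let φ (M : L ⥤ E) : (∐ fun i => ((tensorK L κ).obj (freeOn k L (b i))).obj M) ≅
      ((tensorK L κ).obj A).obj M :=
    (asIso (sigmaComparison ((tensorK L κ).flip.obj M) (fun i => freeOn k L (b i)))) ≪≫
      ((tensorK L κ).mapIso e.symm).app M
  have hι (M : L ⥤ E) (i : I) : Sigma.ι _ i ≫ (φ M).hom =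
      ((tensorK L κ).map (Sigma.ι (fun i => freeOn k L (b i)) i ≫ e.inv)).app M := by
    refine (Category.assoc _ _ _).symm.trans ?_
    refine (congrArg (· ≫ ((tensorK L κ).map e.inv).app M)
      (ι_comp_sigmaComparison ((tensorK L κ).flip.obj M) (fun i => freeOn k L (b i)) i)).trans ?_
    rw [Functor.map_comp, NatTrans.comp_app]
    rfl
  have hφ {M N : L ⥤ E} (f : M ⟶ N) : (φ M).hom ≫ ((tensorK L κ).obj A).map f =
      Limits.Sigma.map (fun i => ((tensorK L κ).obj (freeOn k L (b i))).map f) ≫ (φ N).hom := by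
    refine Sigma.hom_ext _ _ fun i => ?_
    rw [← Category.assoc, ← Category.assoc, hι, Sigma.ι_map, Category.assoc, hι]
    exact (NatTrans.naturality _ f).symm
  exact ShortComplex.shortExact_of_iso
    (ShortComplex.isoMk (φ S.X₁) (φ S.X₂) (φ S.X₃) (hφ S.f) (hφ S.g)) hT

end Free
end TensorIso

/-! ### Acyclic complexes of functors -/

section Acyclic

open HomologicalComplex

variable {A B : Type*} [Category* A] [Abelian A] [Category* B] [Abelian B]

lemma acyclic_map_of_exact (F : A ⥤ B) [F.Additive] [PreservesFiniteLimits F]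
    [PreservesFiniteColimits F] {K : CochainComplex A ℤ} (hK : K.Acyclic) :
    ((F.mapHomologicalComplex (.up ℤ)).obj K).Acyclic := fun i => (hK i).map F

lemma exact_of_evaluation {L : Type*} [Category* L] (S : ShortComplex (L ⥤ A))
    (h : ∀ x, (S.map ((evaluation L A).obj x)).Exact) : S.Exact := by
  rw [ShortComplex.exact_iff_isZero_homology, IsZero.iff_id_eq_zero]
  ext x
  exact (IsZero.of_iso ((ShortComplex.exact_iff_isZero_homology _).1 (h x))
    (S.mapHomologyIso ((evaluation L A).obj x)).symm).eq_of_src _ _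

/-- The value at `x` of a complex of functors. -/
abbrev evalComplex {L : Type*} [Category* L] (A : Type*) [Category* A] [Preadditive A] (x : L) :
    CochainComplex (L ⥤ A) ℤ ⥤ CochainComplex A ℤ :=
  ((evaluation L A).obj x).mapHomologicalComplex (.up ℤ)

lemma acyclic_of_evaluation {L : Type*} [Category* L] {K : CochainComplex (L ⥤ A) ℤ}
    (h : ∀ x, ((evalComplex A x).obj K).Acyclic) : K.Acyclic := fun i =>
  exact_of_evaluation _ fun x => h x i

lemma biproduct_total {C : Type*} [Category* C] [Preadditive C] {I : Type*} [Fintype I] (K : I → C)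
    [HasBiproduct K] : 𝟙 (⨁ K) = ∑ i, biproduct.π K i ≫ biproduct.ι K i := by
  classical
  refine biproduct.hom_ext' _ _ fun j => ?_
  rw [Category.comp_id, Preadditive.comp_sum, Finset.sum_eq_single j]
  · simp
  · intro b _ hb
    rw [biproduct.ι_π_ne_assoc _ hb.symm, zero_comp]
  · simp

lemma quasiIso_zero_iff (K : CochainComplex A ℤ) : QuasiIso (0 : K ⟶ K) ↔ K.Acyclic := by
  refine ⟨fun h i => ?_, fun h => quasiIso_of_acyclic _ h h⟩
  have := (quasiIsoAt_iff_isIso_homologyMap (0 : K ⟶ K) i).1 inferInstance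
  rw [homologyMap_zero] at this
  rw [exactAt_iff_isZero_homology, IsZero.iff_id_eq_zero]
  exact (isIsoZeroEquiv _ _ this).1

-- The identity on homology is a finite sum of maps that factor through the homology of the `T.obj
-- (K i)`.
attribute [local instance] Abelian.hasFiniteBiproducts in
lemma acyclic_biproduct {I : Type*} [Finite I] (T : CochainComplex A ℤ ⥤ CochainComplex B ℤ)
    [T.Additive] (K : I → CochainComplex A ℤ) (h : ∀ i, (T.obj (K i)).Acyclic) :
    (T.obj (⨁ K)).Acyclic := fun n => by
  have := Fintype.ofFinite I
  rw [exactAt_iff_isZero_homology, IsZero.iff_id_eq_zero]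
  have e : 𝟙 ((T.obj (⨁ K)).homology n) =
      ∑ i, homologyMap (T.map (biproduct.π K i)) n ≫ homologyMap (T.map (biproduct.ι K i)) n := by
    rw [← homologyMap_id, ← CategoryTheory.Functor.map_id]
    refine (congrArg (fun φ => homologyMap (T.map φ) n)
      (biproduct_total K)).trans ?_
    rw [T.map_sum]
    refine ((homologyFunctor B (.up ℤ) n).map_sum _ _).trans (Finset.sum_congr rfl fun i _ => ?_)
    rw [T.map_comp]
    exact homologyMap_comp _ _ _
  rw [e]
  refine Finset.sum_eq_zero fun i _ => ?_
  rw [((exactAt_iff_isZero_homology _ _).1 (h i n)).eq_of_tgt (homologyMap (T.map (biproduct.π K i)) n) 0,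
    zero_comp]

end Acyclic

/-! ### Complexes of free right representations -/

section Free

variable {k : Type u} [CommRing k] {L : Type u} [PartialOrder L]

instance (p q : L) : Projective ((freeOn k L p).obj (op q)) :=
  ModuleCat.projective_of_free (Finsupp.basisSingleOne (R := k) (ι := (yoneda.obj p).obj (op q)))

lemma IsFreeModule.projective_obj {A : Lᵒᵖ ⥤ ModuleCat.{u} k} (hA : IsFreeModule A) (p : Lᵒᵖ) :
    Projective (A.obj p) := by
  obtain ⟨I, b, ⟨e⟩⟩ := hA
  have h (i : I) : Projective ((freeOn k L (b i)).obj p) :=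
    inferInstanceAs (Projective ((freeOn k L (b i)).obj (op p.unop)))
  have : Projective (∐ fun i => (freeOn k L (b i)).obj p) := inferInstance
  have e' : A.obj p ≅ ∐ fun i => (freeOn k L (b i)).obj p :=
    ((evaluation _ _).obj p).mapIso e ≪≫
      (asIso (sigmaComparison ((evaluation _ (ModuleCat.{u} k)).obj p)
        (fun i => freeOn k L (b i)))).symm
  exact Projective.of_iso e'.symm this

lemma isFreeModule_freeOn (p : L) : IsFreeModule (freeOn k L p) :=
  ⟨PUnit, fun _ => p, ⟨(coproductUniqueIso fun _ : PUnit => freeOn k L p).symm⟩⟩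

lemma isFreeModule_of_isZero {A : Lᵒᵖ ⥤ ModuleCat.{u} k} (hA : IsZero A) : IsFreeModule A :=
  ⟨PEmpty, PEmpty.elim, ⟨hA.iso ((IsZero.iff_id_eq_zero _).2 (Sigma.hom_ext _ _ fun i => i.elim))⟩⟩

lemma IsFreeModule.of_iso {A B : Lᵒᵖ ⥤ ModuleCat.{u} k} (hA : IsFreeModule A) (e : A ≅ B) :
    IsFreeModule B := by
  obtain ⟨I, b, ⟨e'⟩⟩ := hA
  exact ⟨I, b, ⟨e.symm ≪≫ e'⟩⟩

lemma IsFreeModule.biprod {A B : Lᵒᵖ ⥤ ModuleCat.{u} k} (hA : IsFreeModule A)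
    (hB : IsFreeModule B) : IsFreeModule (A ⊞ B) := by
  obtain ⟨I, b, ⟨e⟩⟩ := hA
  obtain ⟨J, c, ⟨e'⟩⟩ := hB
  let d : I ⊕ J → Lᵒᵖ ⥤ ModuleCat.{u} k := fun i => freeOn k L (Sum.elim b c i)
  let f (x : I ⊕ J) : d x ⟶ (∐ fun i => freeOn k L (b i)) ⊞ ∐ fun j => freeOn k L (c j) :=
    Sum.rec (motive := fun x => d x ⟶ _)
      (fun i => Sigma.ι (fun i => freeOn k L (b i)) i ≫ biprod.inl)
      (fun j => Sigma.ι (fun j => freeOn k L (c j)) j ≫ biprod.inr) x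
  let g : ((∐ fun i => freeOn k L (b i)) ⊞ ∐ fun j => freeOn k L (c j)) ⟶ ∐ d :=
    biprod.desc (Sigma.desc fun i => Sigma.ι d (.inl i)) (Sigma.desc fun j => Sigma.ι d (.inr j))
  have hf (x : I ⊕ J) : Sigma.ι d x ≫ Sigma.desc f = f x := Sigma.ι_desc _ _
  have hg₁ (i : I) : Sigma.ι (fun i => freeOn k L (b i)) i ≫ biprod.inl ≫ g = Sigma.ι d (.inl i) := by
    rw [biprod.inl_desc]
    exact Sigma.ι_desc _ _
  have hg₂ (j : J) : Sigma.ι (fun j => freeOn k L (c j)) j ≫ biprod.inr ≫ g = Sigma.ι d (.inr j) := by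
    rw [biprod.inr_desc]
    exact Sigma.ι_desc _ _
  refine ⟨I ⊕ J, Sum.elim b c, ⟨biprod.mapIso e e' ≪≫
    { hom := g, inv := Sigma.desc f, hom_inv_id := ?_, inv_hom_id := ?_ }⟩⟩
  · refine biprod.hom_ext' _ _ (Sigma.hom_ext _ _ fun i => ?_) (Sigma.hom_ext _ _ fun j => ?_)
    · rw [reassoc_of% hg₁ i, Category.comp_id]
      exact hf (.inl i)
    · rw [reassoc_of% hg₂ j, Category.comp_id]
      exact hf (.inr j)
  · refine Sigma.hom_ext _ _ fun x => ?_
    rw [reassoc_of% hf x, Category.comp_id]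
    rcases x with i | j
    · exact (Category.assoc _ _ _).trans (hg₁ i)
    · exact (Category.assoc _ _ _).trans (hg₂ j)

/-- A bounded above complex of free right representations. -/
structure IsFreeComplex (R : CochainComplex (Lᵒᵖ ⥤ ModuleCat.{u} k) ℤ) : Prop where
  free : ∀ n, IsFreeModule (R.X n)
  isStrictlyLE : R.IsStrictlyLE 0

/-- At each point the terms are sums of copies of `k` and of zero modules, hence projective, and the
complex is bounded above. -/
lemma IsFreeComplex.isKProjective {R : CochainComplex (Lᵒᵖ ⥤ ModuleCat.{u} k) ℤ}
    (hR : IsFreeComplex R) (p : Lᵒᵖ) : ((evalComplex _ p).obj R).IsKProjective := by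
  have := hR.isStrictlyLE
  have (n : ℤ) : Projective (((evalComplex _ p).obj R).X n) := (hR.free n).projective_obj p
  have : ((evalComplex _ p).obj R).IsStrictlyLE 0 := inferInstance
  exact CochainComplex.isKProjective_of_projective _ 0

lemma FreeResolution.isFreeComplex {A : Lᵒᵖ ⥤ ModuleCat.{u} k} (R : FreeResolution A) :
    IsFreeComplex R.cplx := ⟨R.free, R.isStrictlyLE⟩

lemma isFreeComplex_single (p : L) :
    IsFreeComplex ((HomologicalComplex.single _ (.up ℤ) 0).obj (freeOn k L p)) where
  free n := by
    by_cases h : n = 0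
    · exact (isFreeModule_freeOn p).of_iso
        (HomologicalComplex.singleObjXIsoOfEq (.up ℤ) 0 _ n h).symm
    · exact isFreeModule_of_isZero (HomologicalComplex.isZero_single_obj_X (.up ℤ) 0 _ n h)
  isStrictlyLE := inferInstance

end Free

/-- A complex of representations that are principal at `p`. -/
abbrev IsPrincipalComplex {L : Type*} [Preorder L] {E : Type*} [Category* E] [Preadditive E] (p : L)
    (M : CochainComplex (L ⥤ E) ℤ) : Prop := ∀ n, IsPrincipal p (M.X n)

/-! ### Tensor products of free complexes with principal complexes -/

section TensorComplex

open HomologicalComplex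

variable {k : Type u} [CommRing k] {L : Type u} [PartialOrder L]
  {E : Type (u+1)} [Category.{u} E] [MonoidalCategory E] [Abelian E]
  [MonoidalPreadditive E] [HasColimitsOfSize.{u, u} E] [AB4OfSize.{u} E] [AB4OfSize.{0} E]
  (κ : ModuleCat.{u} k ⥤ E) [κ.Additive]

/-- The external tensor product of a module and an object of `E`. -/
abbrev tensorCoeff : ModuleCat.{u} k ⥤ E ⥤ E := κ ⋙ curriedTensor E

instance : (tensorCoeff κ).Additive where
  map_add {A B f g} := by
    ext M
    simp [Functor.map_add]

instance (A : ModuleCat.{u} k) : ((tensorCoeff κ).obj A).Additive where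
  map_add {A B f g} := by
    simp [MonoidalPreadditive.whiskerLeft_add]

/-- The maps `A p ⊗ M p ⟶ A ⊗_L M`, as a natural transformation. -/
noncomputable def tensorιTrans (p : L) :
    (evaluation Lᵒᵖ (ModuleCat.{u} k)).obj (op p) ⋙ tensorCoeff κ ⋙
      (Functor.whiskeringLeft (L ⥤ E) E E).obj ((evaluation L E).obj p) ⟶ tensorK L κ where
  app A :=
    { app M := tensorι L κ A M p
      naturality M N f := (tensorι_map_right κ A f p).symm }
  naturality A B f := by
    ext M
    exact (tensorι_map_left κ f M p).symm

variable {κ}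

/-- The tensor product with a complex that is principal at `p` only involves values at `p`. -/
noncomputable def tensorPrincipalIso (R : CochainComplex (Lᵒᵖ ⥤ ModuleCat.{u} k) ℤ) {p : L}
    {M : CochainComplex (L ⥤ E) ℤ} (hM : IsPrincipalComplex p M) :
    mapBifunctor ((evalComplex _ (op p)).obj R) ((evalComplex _ p).obj M) (tensorCoeff κ) (.up ℤ) ≅
      tensorComplex κ R M :=
  have := isIso_mapBifunctorTrans (tensorK L κ) (tensorCoeff κ) _ _ (tensorιTrans κ p) R M
    fun i j => isIso_tensorι κ (R.X i) (hM j)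
  asIso (mapBifunctorTrans (tensorK L κ) (tensorCoeff κ) _ _ (tensorιTrans κ p) R M)

/-- Only the values at `p` matter. There `f` is a quasi-isomorphism of K-projective complexes, hence
a homotopy equivalence, and it remains one after tensoring with an arbitrary complex. -/
lemma quasiIso_tensorMap_of_principal {R R' : CochainComplex (Lᵒᵖ ⥤ ModuleCat.{u} k) ℤ}
    (hR : IsFreeComplex R) (hR' : IsFreeComplex R') (f : R ⟶ R') {p : L}
    (hf : QuasiIso ((evalComplex _ (op p)).map f)) {M : CochainComplex (L ⥤ E) ℤ}
    (hM : IsPrincipalComplex p M) : QuasiIso (tensorMap κ f (𝟙 M)) := by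
  have := hR.isKProjective (op p)
  have := hR'.isKProjective (op p)
  obtain ⟨e, he⟩ := (CochainComplex.IsKProjective.quasiIso_iff _).1 hf
  have h := quasiIso_mapBifunctorMap_of_homotopyEquiv (tensorCoeff κ) e ((evalComplex _ p).obj M)
  rw [he] at h
  have nat := mapBifunctorTrans_natural (tensorK L κ) (tensorCoeff κ) _ _ (tensorιTrans κ p) f M
  have i₁ := isIso_mapBifunctorTrans (tensorK L κ) (tensorCoeff κ) _ _ (tensorιTrans κ p) R M
    fun i j => isIso_tensorι κ (R.X i) (hM j)
  have i₂ := isIso_mapBifunctorTrans (tensorK L κ) (tensorCoeff κ) _ _ (tensorιTrans κ p) R' M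
    fun i j => isIso_tensorι κ (R'.X i) (hM j)
  have h' := quasiIso_comp
    (mapBifunctorMap ((evalComplex _ (op p)).map f) (𝟙 _) (tensorCoeff κ) (.up ℤ))
    (mapBifunctorTrans (tensorK L κ) (tensorCoeff κ) _ _ (tensorιTrans κ p) R' M)
  rw [nat] at h'
  exact quasiIso_of_comp_left (mapBifunctorTrans (tensorK L κ) (tensorCoeff κ) _ _
    (tensorιTrans κ p) R M) _

lemma acyclic_tensorComplex_of_principal {R : CochainComplex (Lᵒᵖ ⥤ ModuleCat.{u} k) ℤ}
    (hR : IsFreeComplex R) {p : L} (h : ((evalComplex _ (op p)).obj R).Acyclic)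
    {M : CochainComplex (L ⥤ E) ℤ} (hM : IsPrincipalComplex p M) :
    (tensorComplex κ R M).Acyclic := by
  -- Acyclicity means that the zero endomorphism is a quasi-isomorphism, and this property is
  -- transported from the value at `p`.
  have h₀ := quasiIso_tensorMap_of_principal (κ := κ) hR hR (0 : R ⟶ R) (p := p)
    (by rw [Functor.map_zero]; exact (quasiIso_zero_iff _).2 h) hM
  have e : tensorMap κ (0 : R ⟶ R) (𝟙 M) = 0 := by
    refine HomologicalComplex.hom_ext _ _ fun n => mapBifunctor.hom_ext fun i j h => ?_
    simp
  rw [e] at h₀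
  exact (quasiIso_zero_iff _).1 h₀

variable (υ : κ.obj (𝟙_ (ModuleCat.{u} k)) ⟶ 𝟙_ E) [IsIso υ]
  (hκ : ∀ (I : Type u) (S : E), PreservesColimitsOfShape (Discrete I) (κ ⋙ tensorRight S))

include υ hκ in
/-- The tensor product with a complex of free right representations is exact. -/
lemma shortExact_tensorComplex {R : CochainComplex (Lᵒᵖ ⥤ ModuleCat.{u} k) ℤ}
    (hR : IsFreeComplex R) (S : ShortComplex (CochainComplex (L ⥤ E) ℤ)) (hS : S.ShortExact) :
    (S.map (totalFunctor (tensorK L κ) R)).ShortExact :=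
  shortExact_totalFunctor _ _ _ fun i j =>
    shortExact_tensorK υ hκ (hR.free i) _ (hS.map_of_exact (eval (L ⥤ E) (.up ℤ) j))

end TensorComplex

/-! ### Representations generated at one point, and an induction for acyclic complexes -/

section FreeOnPoint

variable {L : Type u} [PartialOrder L] {E : Type*} [Category* E] [Abelian E]
  [∀ p q : L, HasCoproductsOfShape (p ⟶ q) E]

/-- In a poset the coproduct over `p ⟶ q` has exactly one term or none. -/
lemma isPrincipal_evaluationLeftAdjoint (p : L) (X : E) :
    IsPrincipal p ((evaluationLeftAdjoint E p).obj X) where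
  isZero q h := (IsZero.iff_id_eq_zero _).2
    (Sigma.hom_ext _ _ fun g => (h (leOfHom g)).elim)
  isIso q h := by
    let r : (∐ fun _ : p ⟶ q => X) ⟶ ∐ fun _ : p ⟶ p => X :=
      Sigma.desc fun _ => Sigma.ι (fun _ : p ⟶ p => X) (𝟙 p)
    refine ⟨r, ?_, ?_⟩
    · refine Sigma.hom_ext _ _ fun g => ?_
      obtain rfl : g = 𝟙 p := Subsingleton.elim (α := ULift (PLift _)) _ _
      exact (Sigma.ι_desc_assoc _ _ _).trans ((Sigma.ι_desc _ _).trans (Category.comp_id _).symm)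
    · refine Sigma.hom_ext _ _ fun g => ?_
      obtain rfl : g = 𝟙 p ≫ homOfLE h := Subsingleton.elim (α := ULift (PLift _)) _ _
      exact (Sigma.ι_desc_assoc _ _ _).trans ((Sigma.ι_desc _ _).trans (Category.comp_id _).symm)

lemma isIso_ι_evaluationLeftAdjoint {p q : L} (g : p ⟶ q) (X : E) :
    IsIso (Sigma.ι (fun _ : p ⟶ q => X) g) := by
  refine ⟨Sigma.desc fun _ => 𝟙 X, Sigma.ι_desc _ _, Sigma.hom_ext _ _ fun g' => ?_⟩
  obtain rfl : g' = g := Subsingleton.elim (α := ULift (PLift _)) _ _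
  exact (Sigma.ι_desc_assoc _ _ _).trans ((Category.id_comp _).trans (Category.comp_id _).symm)

/-- The evaluation at `q ≥ p` of the free representation on an object at `p`. -/
noncomputable def evaluationLeftAdjointIso {p q : L} (g : p ⟶ q) :
    𝟭 E ≅ evaluationLeftAdjoint E p ⋙ (evaluation L E).obj q :=
  NatIso.ofComponents
    (fun X => @asIso _ _ _ _ (Sigma.ι (fun _ : p ⟶ q => X) g) (isIso_ι_evaluationLeftAdjoint g X))
    (fun {X Y} f => (Sigma.ι_desc (f := fun _ : p ⟶ q => X)
      (fun h => f ≫ Sigma.ι (fun _ : p ⟶ q => Y) h) g).symm)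

instance (p : L) : (evaluationLeftAdjoint E p).Additive :=
  (evaluationAdjunctionRight E p).left_adjoint_additive

/-- The map from the free representation on the value of `M` at `p` to `M`. -/
noncomputable def pointCounit (E : Type*) [Category* E] [Abelian E]
    [∀ p q : L, HasCoproductsOfShape (p ⟶ q) E] (p : L) :
    (evaluation L E).obj p ⋙ evaluationLeftAdjoint E p ⟶ 𝟭 (L ⥤ E) where
  app M :=
    { app q := Sigma.desc fun g => M.map g
      naturality q q' f := Sigma.hom_ext _ _ fun g =>
        (Sigma.ι_desc_assoc _ _ _).trans ((Sigma.ι_desc _ _).trans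
          ((M.map_comp g f).trans (Sigma.ι_desc_assoc _ _ _).symm)) }
  naturality M N f := by
    ext q : 2
    refine Sigma.hom_ext _ _ fun g => ?_
    exact (Sigma.ι_desc_assoc _ _ _).trans ((Category.assoc _ _ _).trans
      ((congrArg (f.app p ≫ ·)
        (Sigma.ι_desc (f := fun _ : p ⟶ q => N.obj p) (fun g => N.map g) g)).trans ((f.naturality g).symm.trans
        (Sigma.ι_desc_assoc _ _ _).symm)))

lemma isIso_pointCounit (p : L) (M : L ⥤ E) : IsIso (((pointCounit E p).app M).app p) := by
  have h : Sigma.ι (fun _ : p ⟶ p => M.obj p) (𝟙 p) ≫ ((pointCounit E p).app M).app p = 𝟙 _ :=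
    (Sigma.ι_desc _ _).trans (M.map_id p)
  have := isIso_ι_evaluationLeftAdjoint (𝟙 p) (M.obj p)
  have h' : IsIso (Sigma.ι (fun _ : p ⟶ p => M.obj p) (𝟙 p) ≫ ((pointCounit E p).app M).app p) := by
    rw [h]
    infer_instance
  exact @IsIso.of_isIso_comp_left _ _ _ _ _ _ _ this h'

/-- The free representations on the values at `p` of a complex of representations. -/
noncomputable abbrev pointComplex (C : CochainComplex (L ⥤ E) ℤ) (p : L) :
    CochainComplex (L ⥤ E) ℤ :=
  ((evaluationLeftAdjoint E p).mapHomologicalComplex (.up ℤ)).obj ((evalComplex E p).obj C)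

lemma acyclic_pointComplex {C : CochainComplex (L ⥤ E) ℤ} (hC : C.Acyclic) (p : L) :
    (pointComplex C p).Acyclic := by
  refine acyclic_of_evaluation fun q => ?_
  by_cases h : p ≤ q
  · intro n
    have h₁ : ((C.sc n).map ((evaluation L E).obj p)).Exact := (hC n).map _
    exact (ShortComplex.exact_iff_of_iso (ShortComplex.mapNatIso
      ((C.sc n).map ((evaluation L E).obj p)) (evaluationLeftAdjointIso (homOfLE h)))).1 h₁
  · refine acyclic_of_isZero ?_
    rw [IsZero.iff_id_eq_zero]
    refine HomologicalComplex.hom_ext _ _ fun n => ?_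
    exact ((isPrincipal_evaluationLeftAdjoint p _).isZero q h).eq_of_src _ _

/-- The map to `C` from the free representation on the value of `C` at `p`. -/
noncomputable def pointComplexCounit (C : CochainComplex (L ⥤ E) ℤ) (p : L) : pointComplex C p ⟶ C where
  f n := (pointCounit E p).app (C.X n)
  comm' i j _ := ((pointCounit E p).naturality (C.d i j)).symm

section

attribute [local instance] Abelian.hasFiniteBiproducts

variable [Finite L]

/-- The sum over all `p` of the free representations on the values at `p`. -/
noncomputable def pointCover (C : CochainComplex (L ⥤ E) ℤ) : (⨁ pointComplex C) ⟶ C :=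
  biproduct.desc (pointComplexCounit C)

lemma isIso_ι_pointCover_f_app (C : CochainComplex (L ⥤ E) ℤ) (n : ℤ) (q : L) :
    IsIso (((biproduct.ι (pointComplex C) q ≫ pointCover C).f n).app q) := by
  have : biproduct.ι (pointComplex C) q ≫ pointCover C = pointComplexCounit C q :=
    biproduct.ι_desc _ _
  rw [this]
  exact isIso_pointCounit q (C.X n)

/-- At `q`, the summand generated at `q` already maps isomorphically onto the value of `C`. -/
instance (C : CochainComplex (L ⥤ E) ℤ) : Epi (pointCover C) := by
  have (n : ℤ) : Epi ((pointCover C).f n) := by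
    have (q : L) : Epi (((pointCover C).f n).app q) := by
      have := isIso_ι_pointCover_f_app C n q
      rw [HomologicalComplex.comp_f, NatTrans.comp_app] at this
      exact epi_of_epi (((biproduct.ι (pointComplex C) q).f n).app q) _
    exact NatTrans.epi_of_epi_app _
  exact HomologicalComplex.epi_of_epi_f _ this

/-- At `q` only the summands generated at some `p ≤ q` contribute. Those with `p < q` vanish by
hypothesis, and the remaining one maps isomorphically to `C`. Thus passing to the kernel enlarges
the set of points where a complex vanishes. -/
lemma isZero_kernel_pointCover (C : CochainComplex (L ⥤ E) ℤ) (q : L)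
    (h : ∀ p < q, ∀ n, IsZero ((C.X n).obj p)) (n : ℤ) :
    IsZero (((kernel (pointCover C)).X n).obj q) := by
  have := Fintype.ofFinite L
  let F := HomologicalComplex.eval (L ⥤ E) (.up ℤ) n ⋙ (evaluation L E).obj q
  have hF (p : L) (hp : p ≠ q) : F.map (biproduct.π (pointComplex C) p) = 0 := by
    refine IsZero.eq_of_tgt ?_ _ _
    by_cases hpq : p ≤ q
    · exact IsZero.of_iso (h p (lt_of_le_of_ne hpq hp) n)
        ((evaluationLeftAdjointIso (homOfLE hpq)).app _).symm
    · exact (isPrincipal_evaluationLeftAdjoint p _).isZero q hpq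
  have h₁ : F.map (biproduct.π (pointComplex C) q) ≫ F.map (biproduct.ι (pointComplex C) q) = 𝟙 _ := by
    rw [← F.map_id, biproduct_total, F.map_sum, Finset.sum_eq_single q, F.map_comp]
    · intro p _ hp
      rw [F.map_comp, hF p hp, zero_comp]
    · simp
  have h₂ : F.map (kernel.ι (pointCover C)) = 0 := by
    have hi := isIso_ι_pointCover_f_app C n q
    have e : F.map (kernel.ι (pointCover C)) ≫ F.map (biproduct.π (pointComplex C) q) ≫
        F.map (biproduct.ι (pointComplex C) q ≫ pointCover C) = 0 := by
      rw [F.map_comp, reassoc_of% h₁, ← F.map_comp, kernel.condition, F.map_zero]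
    have e' : F.map (kernel.ι (pointCover C)) ≫ F.map (biproduct.π (pointComplex C) q) = 0 := by
      have : IsIso (F.map (biproduct.ι (pointComplex C) q ≫ pointCover C)) := hi
      rw [← cancel_mono (F.map (biproduct.ι (pointComplex C) q ≫ pointCover C)), zero_comp,
        Category.assoc, e]
    rw [← Category.comp_id (F.map (kernel.ι _)), ← h₁, reassoc_of% e', zero_comp]
  have : Mono (F.map (kernel.ι (pointCover C))) := inferInstance
  exact (IsZero.iff_id_eq_zero (F.obj (kernel (pointCover C)))).2
    ((cancel_mono (F.map (kernel.ι (pointCover C)))).1 (by rw [h₂, comp_zero, comp_zero]))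

/-- An induction principle for acyclic complexes of representations. -/
lemma acyclic_induction {B : Type*} [Category* B] [Abelian B]
    (T : CochainComplex (L ⥤ E) ℤ ⥤ CochainComplex B ℤ) [T.Additive]
    (hT : ∀ S : ShortComplex (CochainComplex (L ⥤ E) ℤ), S.ShortExact → (S.map T).ShortExact)
    (hp : ∀ (p : L) (C : CochainComplex (L ⥤ E) ℤ), C.Acyclic → (∀ n, IsPrincipal p (C.X n)) →
      (T.obj C).Acyclic)
    {C : CochainComplex (L ⥤ E) ℤ} (hC : C.Acyclic) : (T.obj C).Acyclic := by
  -- The induction enlarges the lower set `s` on which the complex vanishes, until it is all of `L`.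
  suffices ∀ (s : Set L), IsLowerSet s → ∀ C : CochainComplex (L ⥤ E) ℤ, C.Acyclic →
      (∀ p ∈ s, ∀ n, IsZero ((C.X n).obj p)) → (T.obj C).Acyclic from
    this ∅ isLowerSet_empty C hC fun _ h => h.elim
  intro s
  induction s using WellFoundedGT.induction with | ind s ih => ?_
  intro hs C hC h
  by_cases hu : s = Set.univ
  · refine acyclic_of_isZero (T.map_isZero ?_)
    rw [IsZero.iff_id_eq_zero]
    ext n q
    exact (h q (hu ▸ Set.mem_univ q) n).eq_of_src _ _
  -- By minimality everything below `m` lies in `s`, so the kernel of the cover vanishes at `m` too.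
  -- It is again acyclic, as both the cover and `C` are.
  · obtain ⟨m, hm, hmin⟩ := (Set.toFinite sᶜ).exists_minimal (Set.nonempty_compl.2 hu)
    have hlt (p : L) (hp : p < m) : p ∈ s := by
      by_contra hps
      exact (lt_irrefl _ (hp.trans_le (hmin hps hp.le))).elim
    have hS := shortExact_kernel (pointCover C)
    have hcov : (⨁ pointComplex C).Acyclic :=
      acyclic_biproduct (𝟭 _) (pointComplex C) fun p => acyclic_pointComplex hC p
    have h₂ : (T.obj (⨁ pointComplex C)).Acyclic := acyclic_biproduct T _ fun p =>
      hp p _ (acyclic_pointComplex hC p) fun n => isPrincipal_evaluationLeftAdjoint p _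
    have h₁ : (T.obj (kernel (pointCover C))).Acyclic := by
      refine ih (insert m s) (Set.ssubset_insert hm) ?_ _ (hS.acyclic_X₁ (quasiIso_of_acyclic _ hcov hC)) ?_
      · intro a b hab ha
        rcases ha with rfl | ha
        · rcases hab.eq_or_lt with rfl | hlt'
          · exact Or.inl rfl
          · exact Or.inr (hlt _ hlt')
        · exact Or.inr (hs hab ha)
      · rintro q (rfl | hq) n
        · exact isZero_kernel_pointCover C _ (fun p hp => h p (hlt p hp)) n
        · exact isZero_kernel_pointCover C _ (fun p hp => h p (hs hp.le hq)) n
    exact (hT _ hS).acyclic_X₃ (quasiIso_of_acyclic _ h₁ h₂)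

end

end FreeOnPoint

/-! ### The derived tensor product with the simple representation at the top -/

section SimpleTop

open HomologicalComplex

variable {k : Type u} [CommRing k] {L : Type u} [PartialOrder L] [OrderTop L]

lemma isZero_simpleTop_obj {p : L} (hp : p ≠ ⊤) : IsZero ((simpleTop k L).obj (op p)) := by
  have : IsEmpty (PLift (p = ⊤)) := ⟨fun h => hp h.down⟩
  exact ModuleCat.isZero_of_iff_subsingleton.2
    (inferInstanceAs (Subsingleton (PLift (p = ⊤) → k)))

/-- The value of `simpleTop` at `⊤`. -/
noncomputable def simpleTopObjTop : (simpleTop k L).obj (op ⊤) ≅ 𝟙_ (ModuleCat.{u} k) :=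
  let _ : Unique (PLift ((⊤ : L) = ⊤)) := ⟨⟨⟨rfl⟩⟩, fun ⟨_⟩ => rfl⟩
  (LinearEquiv.funUnique (PLift ((⊤ : L) = ⊤)) k k).toModuleIso

lemma isZero_evalComplex_single {A : Lᵒᵖ ⥤ ModuleCat.{u} k} {p : L} (h : IsZero (A.obj (op p))) :
    IsZero ((evalComplex _ (op p)).obj ((single _ (.up ℤ) 0).obj A)) :=
  ((single _ (.up ℤ) 0).map_isZero h).of_iso
    ((singleMapHomologicalComplex ((evaluation Lᵒᵖ (ModuleCat.{u} k)).obj (op p)) (.up ℤ) 0).app A)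

lemma FreeResolution.acyclic_eval {A : Lᵒᵖ ⥤ ModuleCat.{u} k} (R : FreeResolution A) {p : L}
    (h : IsZero (A.obj (op p))) : ((evalComplex _ (op p)).obj R.cplx).Acyclic := by
  have := R.quasiIso
  exact acyclic_of_quasiIso ((evalComplex _ (op p)).map R.aug)
    (acyclic_of_isZero (isZero_evalComplex_single h))

instance : Projective (𝟙_ (ModuleCat.{u} k)) :=
  (ModuleCat.of k k).projective_of_categoryTheory_projective

instance {A : Type*} [Category* A] [Abelian A] (P : A) [Projective P] :
    CochainComplex.IsKProjective ((single A (.up ℤ) 0).obj P) := by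
  have (n : ℤ) : Projective (((single A (.up ℤ) 0).obj P).X n) := by
    by_cases h : n = 0
    · exact Projective.of_iso (singleObjXIsoOfEq (.up ℤ) 0 P n h).symm inferInstance
    · exact (isZero_single_obj_X (.up ℤ) 0 P n h).projective
  exact CochainComplex.isKProjective_of_projective _ 0

variable {E : Type (u+1)} [Category.{u} E] [MonoidalCategory E] [Abelian E]
  [MonoidalPreadditive E] [HasColimitsOfSize.{u, u} E] [AB4OfSize.{u} E] [AB4OfSize.{0} E]
  {κ : ModuleCat.{u} k ⥤ E} [κ.Additive] (υ : κ.obj (𝟙_ (ModuleCat.{u} k)) ⟶ 𝟙_ E) [IsIso υ]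

/-- Tensoring with the unit is the identity. -/
noncomputable def tensorCoeffUnitIso : (tensorCoeff κ).obj (𝟙_ (ModuleCat.{u} k)) ≅ 𝟭 E :=
  (curriedTensor E).mapIso (asIso υ) ≪≫ leftUnitorNatIso E

include υ in
/-- The derived tensor product of `simpleTop` with a complex that is principal at `⊤` is the value
of the latter at `⊤`. -/
lemma exists_quasiIso_tensorComplex_simpleTop (R : FreeResolution (simpleTop k L))
    {M : CochainComplex (L ⥤ E) ℤ} (hM : IsPrincipalComplex ⊤ M) :
    ∃ f : tensorComplex κ R.cplx M ⟶ (evalComplex E ⊤).obj M, QuasiIso f := by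
  have := R.quasiIso
  have := R.isFreeComplex.isKProjective (op ⊤)
  -- At `⊤` the free resolution is a projective resolution of `k`, hence homotopy equivalent to `k`
  -- in degree zero.
  let f₁ : (evalComplex _ (op ⊤)).obj R.cplx ⟶ (single _ (.up ℤ) 0).obj (𝟙_ (ModuleCat.{u} k)) :=
    (evalComplex _ (op ⊤)).map R.aug ≫
      (singleMapHomologicalComplex ((evaluation Lᵒᵖ (ModuleCat.{u} k)).obj (op ⊤)) (.up ℤ) 0).hom.app _ ≫
      (single _ (.up ℤ) 0).map simpleTopObjTop.hom
  have hf₁ : QuasiIso f₁ := inferInstance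
  obtain ⟨e, he⟩ := (CochainComplex.IsKProjective.quasiIso_iff _).1 hf₁
  have h := quasiIso_mapBifunctorMap_of_homotopyEquiv (tensorCoeff κ) e ((evalComplex _ ⊤).obj M)
  have h' := isIso_singleDesc (tensorCoeff κ) (𝟙_ (ModuleCat.{u} k)) ((evalComplex _ ⊤).obj M)
  let t : (((tensorCoeff κ).obj (𝟙_ (ModuleCat.{u} k))).mapHomologicalComplex (.up ℤ)).obj
      ((evalComplex E ⊤).obj M) ⟶ (evalComplex E ⊤).obj M :=
    (NatTrans.mapHomologicalComplex (tensorCoeffUnitIso υ).hom (.up ℤ)).app _ ≫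
      (Functor.mapHomologicalComplexIdIso E (.up ℤ)).hom.app _
  have ht : IsIso t := by
    have : IsIso ((NatTrans.mapHomologicalComplex (tensorCoeffUnitIso υ).hom (.up ℤ)).app
        ((evalComplex E ⊤).obj M)) :=
      ((NatIso.mapHomologicalComplex (tensorCoeffUnitIso υ) (.up ℤ)).app _).isIso_hom
    infer_instance
  exact ⟨(tensorPrincipalIso R.cplx hM).inv ≫ mapBifunctorMap e.hom (𝟙 _) (tensorCoeff κ) (.up ℤ) ≫
    singleDesc (tensorCoeff κ) _ _ ≫ t, inferInstance⟩


variable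
  (hκ : ∀ (I : Type u) (S : E), PreservesColimitsOfShape (Discrete I) (κ ⋙ tensorRight S))
  [Finite L]

-- By `acyclic_induction` the complex may be taken principal at some `p`. For `p = ⊤` the tensor
-- product is quasi-isomorphic to the value at `⊤`; for `p < ⊤` the resolution is acyclic at `p`.
include υ hκ in
lemma acyclic_tensorComplex_simpleTop (R : FreeResolution (simpleTop k L))
    {C : CochainComplex (L ⥤ E) ℤ} (hC : C.Acyclic) : (tensorComplex κ R.cplx C).Acyclic := by
  refine acyclic_induction (totalFunctor (tensorK L κ) R.cplx)
    (shortExact_tensorComplex υ hκ R.isFreeComplex) (fun p C hC hp => ?_) hC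
  by_cases h : p = ⊤
  · subst h
    obtain ⟨f, hf⟩ := exists_quasiIso_tensorComplex_simpleTop υ R hp
    exact @acyclic_of_quasiIso _ _ _ _ _ f hf (acyclic_map_of_exact _ hC)
  · exact acyclic_tensorComplex_of_principal R.isFreeComplex
      (R.acyclic_eval (isZero_simpleTop_obj h)) hp

include υ hκ in
/-- The tensor product with a free resolution of `simpleTop` preserves quasi-isomorphisms. -/
lemma quasiIso_tensorMap_simpleTop (R : FreeResolution (simpleTop k L))
    {C C' : CochainComplex (L ⥤ E) ℤ} (f : C ⟶ C') [QuasiIso f] :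
    QuasiIso (tensorMap κ (𝟙 R.cplx) f) :=
  quasiIso_map_of_exact (totalFunctor (tensorK L κ) R.cplx)
    (shortExact_tensorComplex υ hκ R.isFreeComplex)
    (fun _ hK => acyclic_tensorComplex_simpleTop υ hκ R hK) f

include υ hκ in
lemma nonempty_iso_tensorComplex_simpleTop [HasDerivedCategory.{w} E]
    [HasDerivedCategory.{w} (L ⥤ E)] (R : FreeResolution (simpleTop k L))
    {C C' : CochainComplex (L ⥤ E) ℤ}
    (e : DerivedCategory.Q.obj C ≅ DerivedCategory.Q.obj C') :
    Nonempty (DerivedCategory.Q.obj (tensorComplex κ R.cplx C) ≅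
      DerivedCategory.Q.obj (tensorComplex κ R.cplx C')) := by
  have h : (quasiIso (L ⥤ E) (.up ℤ)).IsInvertedBy
      (totalFunctor (tensorK L κ) R.cplx ⋙ DerivedCategory.Q) := fun C C' f hf => by
    have : QuasiIso f := hf
    have := quasiIso_tensorMap_simpleTop υ hκ R f
    exact (DerivedCategory.isIso_Q_map_iff_quasiIso _ _).2 this
  let T := Localization.lift _ h DerivedCategory.Q
  let i := Localization.fac _ h DerivedCategory.Q
  exact ⟨(i.app C).symm ≪≫ T.mapIso e ≪≫ i.app C'⟩

end SimpleTop

/-! ### Kernels that are principal -/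

section Kernel

variable {L : Type*} [Preorder L] {E : Type*} [Category* E] [Abelian E]

/-- Where the epimorphism is invertible its kernel is zero, and the two parallel epimorphisms of a
cartesian square have the same kernel. The inverse of the transition map glues the kernel at `q`
with zero. -/
lemma isPrincipal_of_shortExact {S : ShortComplex (L ⥤ E)} (hS : S.ShortExact) (p : L)
    (h₀ : ∀ q, ¬ p ≤ q → IsIso (S.g.app q))
    (h : ∀ q (hpq : p ≤ q), IsPullback (S.g.app p) (S.X₂.map (homOfLE hpq)) (S.X₃.map (homOfLE hpq))
      (S.g.app q)) : IsPrincipal p S.X₁ where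
  isZero q hq := by
    have := h₀ q hq
    have hSq := hS.map_of_exact ((evaluation L E).obj q)
    have hm : Mono (S.f.app q) := hSq.mono_f
    have hz : S.f.app q ≫ S.g.app q = 0 := NatTrans.congr_app S.zero q
    have hf : S.f.app q = 0 := by
      rw [← cancel_mono (S.g.app q), hz, zero_comp]
    rw [IsZero.iff_id_eq_zero, ← cancel_mono (S.f.app q), hf, comp_zero, comp_zero]
  isIso q hpq := by
    have hk (x : L) : IsLimit (KernelFork.ofι (S.f.app x) (NatTrans.congr_app S.zero x)) :=
      (hS.map_of_exact ((evaluation L E).obj x)).fIsKernel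
    have hm (x : L) : Mono (S.f.app x) := (hS.map_of_exact ((evaluation L E).obj x)).mono_f
    have hz (x : L) : S.f.app x ≫ S.g.app x = 0 := NatTrans.congr_app S.zero x
    let a := (h q hpq).lift 0 (S.f.app q) (by rw [zero_comp, hz])
    have ha₁ : a ≫ S.g.app p = 0 := (h q hpq).lift_fst _ _ _
    have ha₂ : a ≫ S.X₂.map (homOfLE hpq) = S.f.app q := (h q hpq).lift_snd _ _ _
    let b := (hk p).lift (KernelFork.ofι a ha₁)
    have hb : b ≫ S.f.app p = a := (hk p).fac _ WalkingParallelPair.zero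
    refine ⟨b, ?_, ?_⟩
    · rw [← cancel_mono (S.f.app p), Category.assoc, hb, Category.id_comp]
      refine (h q hpq).hom_ext ?_ ?_
      · rw [Category.assoc, ha₁, comp_zero, hz]
      · rw [Category.assoc, ha₂, S.f.naturality]
    · rw [← cancel_mono (S.f.app q), Category.assoc, S.f.naturality, reassoc_of% hb, ha₂,
        Category.id_comp]

end Kernel

/-! ### Flabby systems and the filtration by open subsets -/

section Flabby

variable {X : TopCat.{u}} {E : Type*} [Category* E] [Abelian E]

/-- A system of objects indexed by open subsets, with epimorphic restriction maps, and satisfying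
the sheaf condition for finite coverings. -/
structure IsFlabbySystem (F : (Opens X)ᵒᵖ ⥤ E) : Prop where
  epi {U V : Opens X} (h : U ⟶ V) : Epi (F.map h.op)
  isZero : IsZero (F.obj (op ⊥))
  isPullback (U V : Opens X) : IsPullback (F.map (homOfLE (le_sup_left : U ≤ U ⊔ V)).op)
    (F.map (homOfLE (le_sup_right : V ≤ U ⊔ V)).op) (F.map (homOfLE (inf_le_left : U ⊓ V ≤ U)).op)
    (F.map (homOfLE (inf_le_right : U ⊓ V ≤ V)).op)

lemma IsFlabbySystem.isPullback' {F : (Opens X)ᵒᵖ ⥤ E} (hF : IsFlabbySystem F) {U V W T : Opens X}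
    (hW : W = U ⊔ V) (hT : T = U ⊓ V) (a : op W ⟶ op U) (b : op W ⟶ op V) (c : op U ⟶ op T)
    (d : op V ⟶ op T) : IsPullback (F.map a) (F.map b) (F.map c) (F.map d) := by
  subst hW hT
  exact hF.isPullback U V

variable {L : Type u} [SemilatticeInf L] [OrderTop L]

/-- The restriction of a complex of systems along a functor to open subsets. -/
abbrev pullComplex (𝓙 : CochainComplex ((Opens X)ᵒᵖ ⥤ E) ℤ) (a : L ⥤ (Opens X)ᵒᵖ) :
    CochainComplex (L ⥤ E) ℤ :=
  (((Functor.whiskeringLeft L (Opens X)ᵒᵖ E).obj a).mapHomologicalComplex (.up ℤ)).obj 𝓙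

/-- The functoriality of `pullComplex`. -/
abbrev pullMap (𝓙 : CochainComplex ((Opens X)ᵒᵖ ⥤ E) ℤ) {a b : L ⥤ (Opens X)ᵒᵖ} (τ : a ⟶ b) :
    pullComplex 𝓙 a ⟶ pullComplex 𝓙 b :=
  (NatTrans.mapHomologicalComplex ((Functor.whiskeringLeft L (Opens X)ᵒᵖ E).map τ) (.up ℤ)).app 𝓙

lemma pullMap_comp (𝓙 : CochainComplex ((Opens X)ᵒᵖ ⥤ E) ℤ) {a b c : L ⥤ (Opens X)ᵒᵖ} (τ : a ⟶ b)
    (σ : b ⟶ c) : pullMap 𝓙 (τ ≫ σ) = pullMap 𝓙 τ ≫ pullMap 𝓙 σ := by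
  ext n q
  exact (𝓙.X n).map_comp _ _

/-- All the terms of a complex are flabby systems. -/
abbrev IsFlabbyComplex (𝓙 : CochainComplex ((Opens X)ᵒᵖ ⥤ E) ℤ) : Prop :=
  ∀ n, IsFlabbySystem (𝓙.X n)

variable {𝓙 : CochainComplex ((Opens X)ᵒᵖ ⥤ E) ℤ} (h𝓙 : IsFlabbyComplex 𝓙)

include h𝓙 in
lemma epi_pullMap {a b : L ⥤ (Opens X)ᵒᵖ} (τ : a ⟶ b) : Epi (pullMap 𝓙 τ) := by
  have (n : ℤ) : Epi ((pullMap 𝓙 τ).f n) := by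
    have (q : L) : Epi (((pullMap 𝓙 τ).f n).app q) := (h𝓙 n).epi (τ.app q).unop
    exact NatTrans.epi_of_epi_app _
  exact HomologicalComplex.epi_of_epi_f _ this

-- For `q ≥ p` the open set `a p` is the union of `b p` and `a q`, and `b q` is their intersection.
-- By the sheaf condition, sections on `a p` that vanish on `b p` are the same as sections on `a q`
-- that vanish on `b q`.
include h𝓙 in
lemma isPrincipal_kernel_pullMap {a b : L ⥤ (Opens X)ᵒᵖ} (τ : a ⟶ b) (p : L)
    (h₀ : ∀ q, ¬ p ≤ q → a.obj q = b.obj q)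
    (h₁ : ∀ q, p ≤ q → (a.obj p).unop = (b.obj p).unop ⊔ (a.obj q).unop)
    (h₂ : ∀ q, p ≤ q → (b.obj q).unop = (b.obj p).unop ⊓ (a.obj q).unop) :
    IsPrincipalComplex p (kernel (pullMap 𝓙 τ)) := fun n => by
  have := epi_pullMap h𝓙 τ
  have hS := (shortExact_kernel (pullMap 𝓙 τ)).map_of_exact
    (HomologicalComplex.eval (L ⥤ E) (.up ℤ) n)
  refine isPrincipal_of_shortExact hS p (fun q hq => ?_) (fun q hq => ?_)
  · have : IsIso (τ.app q) := ⟨eqToHom (h₀ q hq).symm, Subsingleton.elim _ _, Subsingleton.elim _ _⟩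
    exact inferInstanceAs (IsIso ((𝓙.X n).map (τ.app q)))
  · exact (h𝓙 n).isPullback' (h₁ q hq) (h₂ q hq) (τ.app p) (a.map (homOfLE hq)) (b.map (homOfLE hq))
      (τ.app q)

variable (Z : Arrangement X L)

lemma Arrangement.U_top : Z.U ⊤ = ⊥ := by
  ext x
  simp [Arrangement.U, Z.top]

lemma Arrangement.U_inf (p q : L) : Z.U (p ⊓ q) = Z.U p ⊔ Z.U q := by
  ext x
  simp [Arrangement.U, ← Z.inf, or_iff_not_imp_left]

/-- The functor `p ↦ U_p ∪ O`. -/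
def Arrangement.openUnion (O : Opens X) : L ⥤ (Opens X)ᵒᵖ where
  obj p := op (Z.U p ⊔ O)
  map g := (homOfLE (sup_le_sup_right (Z.U_anti (leOfHom g)) O)).op

/-- The functor `p ↦ U_p`. -/
def Arrangement.openFunctor : L ⥤ (Opens X)ᵒᵖ where
  obj p := op (Z.U p)
  map g := (homOfLE (Z.U_anti (leOfHom g))).op

/-- The restriction maps for `O' ≤ O`. -/
def Arrangement.openUnionMap {O O' : Opens X} (h : O' ≤ O) : Z.openUnion O ⟶ Z.openUnion O' where
  app p := (homOfLE (sup_le_sup_left h (Z.U p))).op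

/-- The restriction maps from `U_p ∪ O` to `U_p`. -/
def Arrangement.openUnionToOpen (O : Opens X) : Z.openUnion O ⟶ Z.openFunctor where
  app p := (homOfLE le_sup_left).op

-- The binary meets enter here. If `q` is not above `p`, then `p ⊓ q < p`, so `O` lies in `U (p ⊓ q)
-- = U p ⊔ U q`. The part of `O` lost in the intersection with `U p` is therefore contained in `U
-- q`, and nothing changes at `q`.
include h𝓙 in
lemma isPrincipal_kernel_openUnionMap (O : Opens X) (p : L) (hO : ∀ q < p, O ≤ Z.U q) :
    IsPrincipalComplex p
      (kernel (pullMap 𝓙 (Z.openUnionMap (inf_le_left : O ⊓ Z.U p ≤ O)))) := by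
  refine isPrincipal_kernel_pullMap h𝓙 _ p (fun q hq => ?_) (fun q hq => ?_) fun q hq => ?_
  · have h₁ : p ⊓ q < p := inf_lt_left.2 hq
    have h₂ := hO _ h₁
    rw [Z.U_inf] at h₂
    refine congrArg op (le_antisymm (sup_le le_sup_left ?_) (sup_le_sup_left inf_le_left _))
    calc O ≤ O ⊓ (Z.U p ⊔ Z.U q) := le_inf le_rfl h₂
      _ = O ⊓ Z.U p ⊔ O ⊓ Z.U q := inf_sup_left _ _ _
      _ ≤ Z.U q ⊔ O ⊓ Z.U p := sup_le le_sup_right (inf_le_right.trans le_sup_left)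
  · have := Z.U_anti hq
    change Z.U p ⊔ O = (Z.U p ⊔ O ⊓ Z.U p) ⊔ (Z.U q ⊔ O)
    rw [sup_eq_left.2 (inf_le_right : O ⊓ Z.U p ≤ Z.U p), ← sup_assoc, sup_eq_left.2 this]
  · have := Z.U_anti hq
    change Z.U q ⊔ O ⊓ Z.U p = (Z.U p ⊔ O ⊓ Z.U p) ⊓ (Z.U q ⊔ O)
    rw [sup_eq_left.2 (inf_le_right : O ⊓ Z.U p ≤ Z.U p), inf_sup_left, inf_eq_right.2 this,
      inf_comm O]

variable [Finite L]

-- For `q < ⊤` the complement of the arrangement is contained in `U q`, so both systems take the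
-- same value at `q`; above `⊤` there is only `⊤`.
include h𝓙 in
lemma isPrincipal_kernel_openUnionToOpen :
    IsPrincipalComplex ⊤ (kernel (pullMap 𝓙 (Z.openUnionToOpen Z.compl))) := by
  refine isPrincipal_kernel_pullMap h𝓙 _ ⊤ (fun q hq => ?_) (fun q hq => ?_) fun q hq => ?_
  · exact congrArg op (sup_eq_left.2 (Z.compl_le ⟨q, fun h => hq h.ge⟩))
  · obtain rfl := top_le_iff.1 hq
    change Z.U ⊤ ⊔ _ = Z.U ⊤ ⊔ (Z.U ⊤ ⊔ _)
    rw [← sup_assoc, sup_idem]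
  · obtain rfl := top_le_iff.1 hq
    change Z.U ⊤ = Z.U ⊤ ⊓ (Z.U ⊤ ⊔ _)
    rw [inf_sup_self]

include h𝓙 in
/-- The restriction to the complement of the arrangement is a composite of epimorphisms whose
kernels are principal at elements `p < ⊤`. -/
lemma openUnionMap_induction (W : MorphismProperty (CochainComplex (L ⥤ E) ℤ)) [W.IsMultiplicative]
    (hW : ∀ ⦃M N : CochainComplex (L ⥤ E) ℤ⦄ (f : M ⟶ N) [Epi f] (p : L), p ≠ ⊤ →
      IsPrincipalComplex p (kernel f) → W f) :
    W (pullMap 𝓙 (Z.openUnionMap (le_top : Z.compl ≤ ⊤))) := by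
  classical
  have := Fintype.ofFinite (Below L)
  -- The open sets in question are the intersections of the `U p` over lower sets `s`. Splitting off
  -- a maximal `p` of `s` leaves a lower set that contains every `q < p`, as
  -- `isPrincipal_kernel_openUnionMap` requires.
  have key (s : Finset (Below L)) (hs : IsLowerSet (s : Set (Below L))) :
      W (pullMap 𝓙 (Z.openUnionMap (le_top : (s.inf fun p => Z.U p.1) ≤ ⊤))) := by
    induction s using Finset.strongInduction with | H s ih => ?_
    by_cases h : s.Nonempty
    · obtain ⟨p, hp⟩ := s.exists_maximal h
      have hs' : IsLowerSet ((s.erase p : Finset _) : Set (Below L)) := by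
        intro a b hab ha
        rw [Finset.mem_coe, Finset.mem_erase] at ha ⊢
        refine ⟨fun hb => ha.1 ?_, hs hab ha.2⟩
        subst hb
        exact le_antisymm (hp.2 ha.2 hab) hab
      have h₁ := ih _ (Finset.erase_ssubset hp.1) hs'
      have e : (s.inf fun p => Z.U p.1) = ((s.erase p).inf fun p => Z.U p.1) ⊓ Z.U p := by
        nth_rewrite 1 [← Finset.insert_erase hp.1]
        rw [Finset.inf_insert, inf_comm]
      have := epi_pullMap h𝓙 (Z.openUnionMap
        (inf_le_left : ((s.erase p).inf fun p => Z.U p.1) ⊓ Z.U p ≤ _))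
      have h₂ := hW (pullMap 𝓙 (Z.openUnionMap
        (inf_le_left : ((s.erase p).inf fun p => Z.U p.1) ⊓ Z.U p ≤ _)))
        p.1 p.2 (isPrincipal_kernel_openUnionMap h𝓙 Z _ _ fun q hq => by
          refine Finset.inf_le (f := fun p : Below L => Z.U p.1)
            (b := ⟨q, fun h => not_top_lt (h ▸ hq)⟩) (Finset.mem_erase.2 ⟨fun h => ?_, ?_⟩)
          · exact hq.ne (congrArg Subtype.val h)
          · exact hs (show (⟨q, _⟩ : Below L) ≤ p from hq.le) hp.1)
      have h₃ := W.comp_mem _ _ h₁ h₂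
      rw [← pullMap_comp] at h₃
      rw [e]
      exact h₃
    · rw [Finset.not_nonempty_iff_eq_empty] at h
      subst h
      have : pullMap 𝓙 (Z.openUnionMap (le_top : ((∅ : Finset (Below L)).inf fun p => Z.U p.1) ≤ ⊤)) =
          𝟙 _ := by
        ext n q
        exact (𝓙.X n).map_id _
      rw [this]
      exact W.id_mem _
  have e : Z.compl = Finset.univ.inf fun p : Below L => Z.U p.1 := by
    refine le_antisymm (Finset.le_inf fun p _ => Z.compl_le p) fun x hx hx' => ?_
    obtain ⟨p, hp⟩ := Set.mem_iUnion.1 hx'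
    exact (Finset.inf_le (f := fun p : Below L => Z.U p.1) (Finset.mem_univ p) hx) hp
  have h := key Finset.univ (by simpa using isLowerSet_univ)
  rw [e]
  exact h

end Flabby

/-! ### Quasi-isomorphisms of mapping cones, and degenerate short exact sequences -/

section Cone

variable {A : Type*} [Category* A] [Abelian A]

lemma quasiIso_mappingCone_map {K₁ L₁ K₂ L₂ : CochainComplex A ℤ} (φ₁ : K₁ ⟶ L₁) (φ₂ : K₂ ⟶ L₂)
    (a : K₁ ⟶ K₂) (b : L₁ ⟶ L₂) (comm : φ₁ ≫ b = a ≫ φ₂) (ha : QuasiIso a) (hb : QuasiIso b) :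
    QuasiIso (CochainComplex.mappingCone.map φ₁ φ₂ a b comm) := by
  let := HasDerivedCategory.standard A
  rw [← DerivedCategory.isIso_Q_map_iff_quasiIso] at ha hb ⊢
  exact Pretriangulated.isIso₃_of_isIso₁₂
    (DerivedCategory.Q.mapTriangle.map (CochainComplex.mappingCone.triangleMap φ₁ φ₂ a b comm))
    ((DerivedCategory.mem_distTriang_iff _).2 ⟨_, _, φ₁, ⟨Iso.refl _⟩⟩)
    ((DerivedCategory.mem_distTriang_iff _).2 ⟨_, _, φ₂, ⟨Iso.refl _⟩⟩) ha hb

lemma quasiIso_comp_of {K M N : CochainComplex A ℤ} (f : K ⟶ M) (g : M ⟶ N) (_ : QuasiIso f)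
    (_ : QuasiIso g) : QuasiIso (f ≫ g) := inferInstance

lemma shortExact_of_isIso_f (S : ShortComplex A) [IsIso S.f] (h : IsZero S.X₃) : S.ShortExact :=
  (ShortComplex.Splitting.mk (S := S) (inv S.f) 0 (by simp) (h.eq_of_src _ _) (by simp)).shortExact

lemma shortExact_of_isIso_g (S : ShortComplex A) [IsIso S.g] (h : IsZero S.X₁) : S.ShortExact :=
  (ShortComplex.Splitting.mk (S := S) 0 (inv S.g) (h.eq_of_src _ _) (by simp) (by simp)).shortExact

end Cone

/-! ### The cone as a resolution of the simple representation at the top -/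

section SimpleTop

open HomologicalComplex

variable {k : Type u} [CommRing k] {L : Type u} [PartialOrder L] [OrderTop L]

lemma isIso_constBelowToFree_app {p : L} (hp : p ≠ ⊤) :
    IsIso ((constBelowToFree k L).app (op p)) := by
  let t : belowSet L ⟶ yoneda.obj (⊤ : L) :=
    { app := fun p => TypeCat.ofHom fun _ => homOfLE le_top
      naturality := fun _ _ _ => by ext; exact Subsingleton.elim (α := ULift (PLift _)) _ _ }
  have : IsIso (t.app (op p)) := (isIso_iff_bijective _).2
    ⟨fun _ _ _ => Subsingleton.elim (α := ULift (PLift _)) _ _,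
      fun _ => ⟨⟨⟨hp⟩⟩, Subsingleton.elim (α := ULift (PLift _)) _ _⟩⟩
  exact inferInstanceAs (IsIso ((ModuleCat.free k).map (t.app (op p))))

variable (k L) in
/-- The quotient map from `k L(-, ⊤)` to `simpleTop`. -/
noncomputable def freeToSimpleTop : freeOn k L ⊤ ⟶ simpleTop k L where
  app p := ModuleCat.ofHom (Finsupp.linearCombination k fun _ _ => (1 : k))
  naturality p q f := by
    refine ModuleCat.hom_ext (Finsupp.lhom_ext' fun x => LinearMap.ext_ring ?_)
    refine funext fun (y : PLift (q.unop = ⊤)) => ?_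
    change (Finsupp.linearCombination k fun _ _ => (1 : k)) (Finsupp.mapDomain
      (fun g : p.unop ⟶ ⊤ => f.unop ≫ g) (Finsupp.single x 1)) y =
      (Finsupp.linearCombination k fun _ _ => (1 : k)) (Finsupp.single x 1) _
    rw [Finsupp.mapDomain_single, Finsupp.linearCombination_single,
      Finsupp.linearCombination_single]
    rfl

lemma isIso_freeToSimpleTop_app : IsIso ((freeToSimpleTop k L).app (op ⊤)) := by
  have h : (freeToSimpleTop k L).app (op ⊤) ≫ simpleTopObjTop.hom = freeCoeff ⊤ ⊤ := by
    refine ModuleCat.hom_ext (Finsupp.lhom_ext' fun x => LinearMap.ext_ring ?_)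
    let _ : Unique (PLift ((⊤ : L) = ⊤)) := ⟨⟨⟨rfl⟩⟩, fun ⟨_⟩ => rfl⟩
    change LinearEquiv.funUnique (PLift ((⊤ : L) = ⊤)) k k
      (Finsupp.linearCombination k (fun _ _ => (1 : k)) (Finsupp.single x 1)) =
      Finsupp.linearCombination k (fun _ => (1 : k)) (Finsupp.single x 1)
    rw [Finsupp.linearCombination_single, Finsupp.linearCombination_single]
    rfl
  have : IsIso (freeCoeff (k := k) (⊤ : L) ⊤) := ⟨freeGen (𝟙 _), coeff_freeGen _, freeGen_coeff _⟩
  rw [← h] at this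
  exact IsIso.of_isIso_comp_right _ simpleTopObjTop.hom

variable (k L) in
/-- The sequence `0 ⟶ k{*}_P ⟶ k L(-, ⊤) ⟶ simpleTop ⟶ 0`. -/
noncomputable abbrev simpleTopSequence : ShortComplex (Lᵒᵖ ⥤ ModuleCat.{u} k) :=
  ShortComplex.mk (constBelowToFree k L) (freeToSimpleTop k L) (by
    ext p : 2
    by_cases hp : p = op ⊤
    · subst hp
      exact (isZero_constBelow_top k L).eq_of_src _ _
    · exact (isZero_simpleTop_obj (fun h => hp (congrArg op h))).eq_of_tgt _ _)

variable (k L) in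
lemma shortExact_simpleTopSequence : (simpleTopSequence k L).ShortExact := by
  refine shortExact_of_evaluation _ fun p => ?_
  by_cases hp : p = op ⊤
  · subst hp
    have : IsIso (((simpleTopSequence k L).map ((evaluation _ _).obj (op ⊤))).g) :=
      isIso_freeToSimpleTop_app
    exact shortExact_of_isIso_g _ (isZero_constBelow_top k L)
  · have hp' : p.unop ≠ ⊤ := fun h => hp (congrArg op h)
    have : IsIso (((simpleTopSequence k L).map ((evaluation _ _).obj p)).f) :=
      isIso_constBelowToFree_app hp'
    exact shortExact_of_isIso_f _ (isZero_simpleTop_obj hp')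

/-- The cone of `G ⟶ k L(-, ⊤)` resolves `simpleTop`. -/
lemma exists_freeResolution_coneComplex (G : FreeResolution (constBelow k L)) :
    ∃ R : FreeResolution (simpleTop k L), R.cplx = coneComplex G := by
  have hG := G.quasiIso
  have := G.isStrictlyLE
  have hS := (shortExact_simpleTopSequence k L).map_of_exact (single _ (.up ℤ) 0)
  -- The cone of the inclusion of `k{*}_P` in `k L(-, ⊤)` resolves the quotient, and `G` may replace
  -- `k{*}_P` in this cone.
  have h₁ := CochainComplex.mappingCone.quasiIso_descShortComplex hS
  have h₂ := quasiIso_mappingCone_map (toFreeTop G)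
    ((single _ (.up ℤ) 0).map (constBelowToFree k L)) G.aug (𝟙 _) (Category.comp_id _) hG
    inferInstance
  refine ⟨
    { cplx := coneComplex G
      free := fun n => ?_
      isStrictlyLE := ?_
      aug := CochainComplex.mappingCone.map (toFreeTop G)
        ((single _ (.up ℤ) 0).map (constBelowToFree k L)) G.aug (𝟙 _) (Category.comp_id _) ≫
          CochainComplex.mappingCone.descShortComplex
            ((simpleTopSequence k L).map (single _ (.up ℤ) 0))
      quasiIso := quasiIso_comp_of _ _ h₂ h₁ }, rfl⟩
  · exact ((G.free (n + 1)).biprod ((isFreeComplex_single ⊤).free n)).of_iso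
      (homotopyCofiber.XIsoBiprod (toFreeTop G) n (n + 1) rfl).symm
  · rw [CochainComplex.isStrictlyLE_iff]
    intro i hi
    rw [CochainComplex.mappingCone.isZero_X_iff]
    exact ⟨G.cplx.isZero_of_isStrictlyLE 0 _ (by omega), isZero_single_obj_X (.up ℤ) 0 _ _ (by omega)⟩

/-- Away from `⊤`, `k{*}_P` and `k L(-, ⊤)` coincide, so only the augmentation of `G` remains. -/
lemma quasiIso_evalComplex_toFreeTop (G : FreeResolution (constBelow k L)) {p : L} (hp : p ≠ ⊤) :
    QuasiIso ((evalComplex _ (op p)).map (toFreeTop G)) := by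
  have := G.quasiIso
  have h : IsIso ((evalComplex _ (op p)).map
      ((single _ (.up ℤ) 0).map (constBelowToFree k L))) := by
    have := isIso_constBelowToFree_app (k := k) hp
    have e := (singleMapHomologicalComplex ((evaluation Lᵒᵖ (ModuleCat.{u} k)).obj (op p))
      (.up ℤ) 0).hom.naturality (constBelowToFree k L)
    have : IsIso ((single _ (.up ℤ) 0).map ((constBelowToFree k L).app (op p))) := inferInstance
    exact (NatIso.isIso_map_iff (singleMapHomologicalComplex
      ((evaluation Lᵒᵖ (ModuleCat.{u} k)).obj (op p)) (.up ℤ) 0) (constBelowToFree k L)).2 this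
  rw [toFreeTop, Functor.map_comp]
  infer_instance

end SimpleTop

/-! ### Naturality of tensoring with an object in degree zero -/

section Single

open HomologicalComplex

variable {C₁ C₂ D : Type*} [Category* C₁] [Category* C₂] [Category* D]
  [Preadditive C₁] [HasZeroObject C₁] [Preadditive C₂] [Preadditive D] [HasCoproducts.{0} D]
  (B : C₁ ⥤ C₂ ⥤ D) [B.Additive] [∀ A, (B.obj A).Additive]

lemma single_hom_ext {A : C₁} {K : CochainComplex C₂ ℤ} {n : ℤ} {Y : D}
    {f g : (mapBifunctor ((single C₁ (.up ℤ) 0).obj A) K B (.up ℤ)).X n ⟶ Y}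
    (h : ιMapBifunctor ((single C₁ (.up ℤ) 0).obj A) K B (.up ℤ) 0 n n (zero_add n) ≫ f =
      ιMapBifunctor ((single C₁ (.up ℤ) 0).obj A) K B (.up ℤ) 0 n n (zero_add n) ≫ g) : f = g := by
  have := isIso_ι_single B A K n
  exact (cancel_epi _).1 h

lemma singleDesc_natural_left {A A' : C₁} (c : A ⟶ A') (K : CochainComplex C₂ ℤ) :
    mapBifunctorMap ((single C₁ (.up ℤ) 0).map c) (𝟙 K) B (.up ℤ) ≫ singleDesc B A' K =
      singleDesc B A K ≫ (NatTrans.mapHomologicalComplex (B.map c) (.up ℤ)).app K := by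
  refine HomologicalComplex.hom_ext _ _ fun n => single_hom_ext B ?_
  rw [comp_f, comp_f, ι_mapBifunctorMap_assoc, ← Category.assoc
    (ιMapBifunctor ((single C₁ (.up ℤ) 0).obj A) K B (.up ℤ) 0 n n (zero_add n)), ι_singleDesc,
    ι_singleDesc, id_f, CategoryTheory.Functor.map_id]
  refine (congrArg (_ ≫ ·) (Category.id_comp _)).trans ?_
  have e : ((single C₁ (.up ℤ) 0).map c).f 0 ≫ (singleObjXSelf (.up ℤ) 0 A').hom =
      (singleObjXSelf (.up ℤ) 0 A).hom ≫ c := by simp [single_map_f_self]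
  have e' := congrArg (fun t => (B.map t).app (K.X n)) e
  simp only [B.map_comp, NatTrans.comp_app] at e'
  exact e'

lemma singleDesc_natural_right (A : C₁) {K K' : CochainComplex C₂ ℤ} (g : K ⟶ K') :
    mapBifunctorMap (𝟙 ((single C₁ (.up ℤ) 0).obj A)) g B (.up ℤ) ≫ singleDesc B A K' =
      singleDesc B A K ≫ ((B.obj A).mapHomologicalComplex (.up ℤ)).map g := by
  refine HomologicalComplex.hom_ext _ _ fun n => single_hom_ext B ?_
  rw [comp_f, comp_f, ι_mapBifunctorMap_assoc, ← Category.assoc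
    (ιMapBifunctor ((single C₁ (.up ℤ) 0).obj A) K B (.up ℤ) 0 n n (zero_add n)), ι_singleDesc,
    ι_singleDesc, id_f, B.map_id, NatTrans.id_app, Category.id_comp]
  exact (B.map (singleObjXSelf (.up ℤ) 0 A).hom).naturality (g.f n)

end Single

/-! ### The homotopy colimit as the value at the complement -/

section Hocolim

open HomologicalComplex

variable {k : Type u} [CommRing k] {L : Type u}
  {E : Type (u+1)} [Category.{u} E] [MonoidalCategory E] [Abelian E]
  [MonoidalPreadditive E] [HasColimitsOfSize.{u, u} E]
  {κ : ModuleCat.{u} k ⥤ E} [κ.Additive] (υ : κ.obj (𝟙_ (ModuleCat.{u} k)) ⟶ 𝟙_ E)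

section

variable [PartialOrder L] [OrderTop L]

lemma constBelowToFree_coeff (p : L) :
    (constBelowToFree k L).app (op p) ≫ freeCoeff ⊤ p = belowCoeff p := by
  refine ModuleCat.hom_ext (Finsupp.lhom_ext' fun x => LinearMap.ext_ring ?_)
  change (Finsupp.linearCombination k fun _ => (1 : k)) (Finsupp.mapDomain
    (fun _ => homOfLE le_top : (belowSet L).obj (op p) → (p ⟶ ⊤)) (Finsupp.single x 1)) =
    (Finsupp.linearCombination k fun _ => (1 : k)) (Finsupp.single x 1)
  rw [Finsupp.mapDomain_single, Finsupp.linearCombination_single, Finsupp.linearCombination_single]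

lemma map_colimDesc {M M' : L ⥤ E} {N : E} (τ : M ⟶ M')
    (α : belowIncl L ⋙ M' ⟶ (Functor.const (Below L)).obj N) (ρ : M.obj ⊤ ⟶ N)
    (h : ∀ p (hp : p ≠ ⊤), τ.app p ≫ coconeLeg α hp = M.map (homOfLE le_top) ≫ ρ) :
    ((tensorK L κ).obj (constBelow k L)).map τ ≫ colimDesc κ υ α =
      ((tensorK L κ).map (constBelowToFree k L)).app M ≫ freeEval κ υ ⊤ M ≫ ρ := by
  refine tensor_hom_ext fun p => ?_
  by_cases hp : p = ⊤
  · subst hp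
    exact (isZero_whiskerRight (κ.map_isZero (isZero_constBelow_top k L))).eq_of_src _ _
  · have h₁ : tensorι L κ (constBelow k L) M' p ≫ colimDesc κ υ α =
        (κ.map (belowCoeff p) ≫ υ) ▷ M'.obj p ≫ (λ_ (M'.obj p)).hom ≫ coconeLeg α hp :=
      (tensorι_desc κ _ M' _ _ p).trans (dif_pos hp)
    rw [← Category.assoc, tensorι_map_right, Category.assoc, h₁, whisker_exchange_assoc,
      leftUnitor_naturality_assoc, h p hp]
    refine Eq.trans ?_ (Category.assoc _ _ _)
    rw [tensorι_map_left, Category.assoc]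
    refine Eq.trans ?_ (congrArg (_ ≫ ·) (Category.assoc _ _ _))
    rw [tensorι_freeEval κ υ ⊤ M le_top, Category.assoc, Category.assoc, ← comp_whiskerRight_assoc,
      ← Category.assoc (κ.map _) (κ.map _), ← κ.map_comp, constBelowToFree_coeff]

/-- The evaluation `k L(-, p) ⊗_L M ⟶ M p` for complexes. -/
noncomputable def freeEvalComplex (p : L) (M : CochainComplex (L ⥤ E) ℤ) :
    (((tensorK L κ).obj (freeOn k L p)).mapHomologicalComplex (.up ℤ)).obj M ⟶
      (evalComplex E p).obj M where
  f n := freeEval κ υ p (M.X n)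
  comm' i j _ := (freeEval_natural κ υ p (M.d i j)).symm

lemma isIso_freeEvalComplex [IsIso υ] (p : L) (M : CochainComplex (L ⥤ E) ℤ) :
    IsIso (freeEvalComplex (κ := κ) υ p M) := by
  have (n : ℤ) : IsIso ((freeEvalComplex (κ := κ) υ p M).f n) := isIso_freeEval κ υ p (M.X n)
  exact HomologicalComplex.Hom.isIso_of_components _

/-- If the cocone, pulled back along `τ`, factors through the value of `M` at `⊤`, then the map out
of `k{*}_P ⊗_L M` extends along `k{*}_P → k L(-, ⊤)`. This reduces the study of `hocolimMap` to that
of `toFreeTop`. -/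
lemma tensorMap_hocolimMap (G : FreeResolution (constBelow k L)) {M M' : CochainComplex (L ⥤ E) ℤ}
    {N : CochainComplex E ℤ} (τ : M ⟶ M') (α : BelowCocone M' N) (ρ : (evalComplex E ⊤).obj M ⟶ N)
    (h : ∀ n p (hp : p ≠ ⊤), (τ.f n).app p ≫ coconeLeg (α.f n) hp =
      (M.X n).map (homOfLE le_top) ≫ ρ.f n) :
    tensorMap κ (𝟙 G.cplx) τ ≫ hocolimMap κ υ G α =
      tensorMap κ (toFreeTop G) (𝟙 M) ≫ singleDesc (tensorK L κ) (freeOn k L ⊤) M ≫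
        freeEvalComplex υ ⊤ M ≫ ρ := by
  have e : (((tensorK L κ).obj (constBelow k L)).mapHomologicalComplex (.up ℤ)).map τ ≫
      colimMap κ υ α = (NatTrans.mapHomologicalComplex ((tensorK L κ).map (constBelowToFree k L))
        (.up ℤ)).app M ≫ freeEvalComplex υ ⊤ M ≫ ρ := by
    refine HomologicalComplex.hom_ext _ _ fun n => ?_
    exact map_colimDesc υ (τ.f n) (α.f n) (ρ.f n) (h n)
  have e₁ : tensorMap κ (𝟙 G.cplx) τ ≫ tensorMap κ G.aug (𝟙 M') =
      tensorMap κ G.aug (𝟙 M) ≫ tensorMap κ (𝟙 _) τ := by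
    rw [← mapBifunctorMap_comp, ← mapBifunctorMap_comp, Category.id_comp, Category.comp_id,
      Category.id_comp, Category.comp_id]
  have e₂ : tensorMap κ (toFreeTop G) (𝟙 M) = tensorMap κ G.aug (𝟙 M) ≫
      tensorMap κ ((single _ (.up ℤ) 0).map (constBelowToFree k L)) (𝟙 M) := by
    rw [← mapBifunctorMap_comp, Category.comp_id]
    rfl
  rw [hocolimMap, reassoc_of% e₁, reassoc_of% singleDesc_natural_right, e, e₂, Category.assoc,
    reassoc_of% singleDesc_natural_left]

end


section

variable [SemilatticeInf L] [OrderTop L] [Finite L] {X : TopCat.{u}} (Z : Arrangement X L)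
  (𝓙 : CochainComplex ((Opens X)ᵒᵖ ⥤ E) ℤ)

/-- The restriction maps from `U_p` to the complement of the arrangement. -/
def Arrangement.pullCocone :
    BelowCocone (pullComplex 𝓙 Z.openFunctor) ((evalComplex E (op Z.compl)).obj 𝓙) where
  f n :=
    { app p := (𝓙.X n).map (homOfLE (Z.compl_le p)).op
      naturality p q g := ((𝓙.X n).map_comp _ _).symm.trans (Category.comp_id _).symm }
  comm' i j _ := by
    ext p : 2
    exact ((𝓙.d i j).naturality _)

/-- The value of `p ↦ 𝓙 (U_p ∪ O)` at `⊤`. -/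
noncomputable def Arrangement.openUnionTopIso (O : Opens X) :
    (evalComplex E ⊤).obj (pullComplex 𝓙 (Z.openUnion O)) ≅ (evalComplex E (op O)).obj 𝓙 :=
  have h : O = Z.U ⊤ ⊔ O := by rw [Z.U_top, bot_sup_eq]
  (NatIso.mapHomologicalComplex ((evaluation (Opens X)ᵒᵖ E).mapIso
    (eqToIso (congrArg op h.symm))) (.up ℤ)).app 𝓙

variable [IsIso υ] [AB4OfSize.{u} E] [AB4OfSize.{0} E]
  (hκ : ∀ (I : Type u) (S : E), PreservesColimitsOfShape (Discrete I) (κ ⋙ tensorRight S))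
  {𝓙} (h𝓙 : IsFlabbyComplex 𝓙)

-- The assertion holds for the constant representation and passes along each epimorphism of the
-- filtration, because the kernel is principal at some `p < ⊤`, where `G` and `k L(-, ⊤)` are
-- quasi-isomorphic.
include h𝓙 hκ υ in
lemma quasiIso_tensorMap_toFreeTop [Nonempty (Below L)] (G : FreeResolution (constBelow k L)) :
    QuasiIso (tensorMap κ (toFreeTop G) (𝟙 (pullComplex 𝓙 (Z.openUnion Z.compl)))) := by
  have hF := isFreeComplex_single (k := k) (⊤ : L)
  -- A property of objects, phrased as an implication from source to target, so that
  -- `openUnionMap_induction` propagates it from `O = X` to the complement.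
  let W : MorphismProperty (CochainComplex (L ⥤ E) ℤ) := fun M N _ =>
    QuasiIso (tensorMap κ (toFreeTop G) (𝟙 M)) → QuasiIso (tensorMap κ (toFreeTop G) (𝟙 N))
  have : W.IsMultiplicative :=
    { id_mem _ h := h
      comp_mem _ _ h h' h'' := h' (h h'') }
  refine openUnionMap_induction h𝓙 Z W (fun M N f _ p hp hk hM => ?_) ?_
  · have hS := shortExact_kernel f
    let φ : (ShortComplex.mk (kernel.ι f) f (kernel.condition f)).map (totalFunctor (tensorK L κ) G.cplx) ⟶
        (ShortComplex.mk (kernel.ι f) f (kernel.condition f)).map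
          (totalFunctor (tensorK L κ) ((single _ (.up ℤ) 0).obj (freeOn k L ⊤))) :=
      { τ₁ := tensorMap κ (toFreeTop G) (𝟙 _)
        τ₂ := tensorMap κ (toFreeTop G) (𝟙 _)
        τ₃ := tensorMap κ (toFreeTop G) (𝟙 _)
        comm₁₂ := by
          refine (mapBifunctorMap_comp (tensorK L κ) _ _ _ _).symm.trans (Eq.trans ?_
            (mapBifunctorMap_comp (tensorK L κ) _ _ _ _))
          rw [Category.id_comp, Category.id_comp, Category.comp_id, Category.comp_id]
        comm₂₃ := by
          refine (mapBifunctorMap_comp (tensorK L κ) _ _ _ _).symm.trans (Eq.trans ?_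
            (mapBifunctorMap_comp (tensorK L κ) _ _ _ _))
          rw [Category.id_comp, Category.id_comp, Category.comp_id, Category.comp_id] }
    exact HomologySequence.quasiIso_τ₃ φ (shortExact_tensorComplex υ hκ G.isFreeComplex _ hS)
      (shortExact_tensorComplex υ hκ hF _ hS)
      (quasiIso_tensorMap_of_principal G.isFreeComplex hF _
        (quasiIso_evalComplex_toFreeTop G hp) hk) hM
  -- For `O = X` all the values agree, so the representation is principal at the least element, the
  -- meet of all of `L`. It differs from `⊤` because `P` is nonempty.
  · obtain ⟨b, hb⟩ : ∃ b : L, ∀ x, b ≤ x := by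
      have := Fintype.ofFinite L
      exact ⟨Finset.univ.inf id, fun x => Finset.inf_le (f := id) (Finset.mem_univ x)⟩
    have hb' : b ≠ ⊤ := fun h => by
      obtain ⟨p, hp⟩ := ‹Nonempty (Below L)›
      exact hp (top_le_iff.1 (h ▸ hb p))
    refine quasiIso_tensorMap_of_principal G.isFreeComplex hF _
      (quasiIso_evalComplex_toFreeTop G hb') fun n => ⟨fun q hq => (hq (hb q)).elim, fun q h => ?_⟩
    have : IsIso ((Z.openUnion ⊤).map (homOfLE h)) :=
      ⟨eqToHom (congrArg op ((sup_top_eq _).trans (sup_top_eq _).symm)), Subsingleton.elim _ _,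
        Subsingleton.elim _ _⟩
    exact inferInstanceAs (IsIso ((𝓙.X n).map ((Z.openUnion ⊤).map (homOfLE h))))

include h𝓙 hκ in
/-- The homotopy colimit of the `𝓙 (U_p)` over `P` is the value at the complement. -/
lemma quasiIso_hocolimMap [Nonempty (Below L)] (G : FreeResolution (constBelow k L)) :
    QuasiIso (hocolimMap κ υ G (Z.pullCocone 𝓙)) := by
  -- The comparison representation `p ↦ 𝓙 (U_p ∪ U)` agrees with `𝓙 (U_p)` on `P` but has the
  -- desired target as its value at `⊤`.
  have e := tensorMap_hocolimMap υ G (pullMap 𝓙 (Z.openUnionToOpen Z.compl)) (Z.pullCocone 𝓙)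
    (Z.openUnionTopIso 𝓙 Z.compl).hom fun n p hp => by
      refine ((𝓙.X n).map_comp _ _).symm.trans (Eq.trans ?_ ((𝓙.X n).map_comp _ _))
      rfl
  have h₁ := quasiIso_tensorMap_toFreeTop υ Z hκ h𝓙 G
  have h₂ := isIso_singleDesc (tensorK L κ) (freeOn k L ⊤) (pullComplex 𝓙 (Z.openUnion Z.compl))
  have h₃ := isIso_freeEvalComplex (κ := κ) υ ⊤ (pullComplex 𝓙 (Z.openUnion Z.compl))
  -- The kernel is principal at `⊤`, where `G` is acyclic.
  have h₄ : QuasiIso (tensorMap κ (𝟙 G.cplx) (pullMap 𝓙 (Z.openUnionToOpen Z.compl))) := by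
    have := epi_pullMap h𝓙 (Z.openUnionToOpen Z.compl)
    exact quasiIso_g_of_acyclic (shortExact_tensorComplex υ hκ G.isFreeComplex _
      (shortExact_kernel (pullMap 𝓙 (Z.openUnionToOpen Z.compl))))
      (acyclic_tensorComplex_of_principal G.isFreeComplex
        (G.acyclic_eval (isZero_constBelow_top k L)) (isPrincipal_kernel_openUnionToOpen h𝓙 Z))
  have h₅ : QuasiIso (tensorMap κ (toFreeTop G) (𝟙 _) ≫ singleDesc (tensorK L κ) (freeOn k L ⊤) _ ≫
      freeEvalComplex υ ⊤ _ ≫ (Z.openUnionTopIso 𝓙 Z.compl).hom) := inferInstance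
  rw [← e] at h₅
  exact quasiIso_of_comp_left (tensorMap κ (𝟙 G.cplx) (pullMap 𝓙 (Z.openUnionToOpen Z.compl))) _

end

end Hocolim

/-! ### The two arrows of the zig-zag -/

section ConeTensor

open HomologicalComplex CochainComplex.HomComplex

lemma quasiIso_of_isIso_hom {A : Type*} [Category* A] [Abelian A] {M N : CochainComplex A ℤ}
    (φ : M ⟶ N) (_ : IsIso φ) : QuasiIso φ := inferInstance

lemma IsIso.neg_hom {C : Type*} [Category* C] [Preadditive C] {A B : C} (f : A ⟶ B) [IsIso f] :
    IsIso (-f) :=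
  ⟨-inv f, by rw [Preadditive.neg_comp, Preadditive.comp_neg, neg_neg, IsIso.hom_inv_id],
    by rw [Preadditive.neg_comp, Preadditive.comp_neg, neg_neg, IsIso.inv_hom_id]⟩

/-- In degree `n` the cone is the sum of `K.X (n + 1)` and `M.X n`, and the connecting map is, up to
sign, the projection to the first summand; it becomes invertible once `F` kills the second. -/
lemma isIso_map_mappingCone_mor₃ {C D : Type*} [Category* C] [Abelian C] [Category* D]
    [Preadditive D] (F : C ⥤ D) [F.Additive] {K M : CochainComplex C ℤ} (φ : K ⟶ M) (n : ℤ)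
    (h : IsZero (F.obj (M.X n))) : IsIso (F.map ((CochainComplex.mappingCone.triangle φ).mor₃.f n)) := by
  let a := (CochainComplex.mappingCone.inl φ).v (n + 1) n (by omega)
  let b := (CochainComplex.mappingCone.fst φ).1.v n (n + 1) rfl
  have h₁ : F.map a ≫ F.map b = 𝟙 _ := by
    rw [← F.map_comp, CochainComplex.mappingCone.inl_v_fst_v, F.map_id]
  have h₂ : F.map b ≫ F.map a = 𝟙 _ := by
    have e := congrArg F.map (CochainComplex.mappingCone.id_X φ n (n + 1) rfl)
    rw [F.map_add, F.map_comp, F.map_comp,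
      h.eq_of_tgt (F.map ((CochainComplex.mappingCone.snd φ).v n n (add_zero n))) 0, zero_comp,
      add_zero, F.map_id] at e
    exact e
  have h₃ : IsIso (F.map a) := ⟨F.map b, h₁, h₂⟩
  have h₄ : IsIso (F.map (a ≫ (CochainComplex.mappingCone.triangle φ).mor₃.f n)) := by
    have e := CochainComplex.mappingCone.inl_v_triangle_mor₃_f φ (n + 1) n (by omega)
    have : IsIso (a ≫ (CochainComplex.mappingCone.triangle φ).mor₃.f n) := by
      refine (congrArg IsIso e).mpr ?_
      exact IsIso.neg_hom (K.shiftFunctorObjXIso 1 n (n + 1) rfl).inv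
    exact inferInstance
  exact @IsIso.of_isIso_comp_left _ _ _ _ _ _ _ h₃ (F.map_comp a _ ▸ h₄)

variable {k : Type u} [CommRing k] {L : Type u}
  {E : Type (u+1)} [Category.{u} E] [MonoidalCategory E] [Abelian E]
  [MonoidalPreadditive E] [HasColimitsOfSize.{u, u} E]
  {κ : ModuleCat.{u} k ⥤ E} [κ.Additive] (υ : κ.obj (𝟙_ (ModuleCat.{u} k)) ⟶ 𝟙_ E) [IsIso υ]
  [PartialOrder L]

instance (M : L ⥤ E) : ((tensorK L κ).flip.obj M).Additive where
  map_add {_ _ f g} := congrArg (fun t => NatTrans.app t M) ((tensorK L κ).map_add (f := f) (g := g))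

/-- The cone and `G[1]` differ by `k L(-, ⊤)`, whose tensor product with a term of `M` is the value
of that term at `⊤`, which is zero. So the map induced by the connecting map is an isomorphism, not
merely a quasi-isomorphism. -/
lemma quasiIso_zigzagRight [OrderTop L] (G : FreeResolution (constBelow k L))
    {M : CochainComplex (L ⥤ E) ℤ}
    {N : CochainComplex E ℤ} (α : BelowCocone M N) (hM : ∀ n, IsZero ((M.X n).obj ⊤))
    (h : QuasiIso (hocolimMap κ υ G α)) : QuasiIso (zigzagRight κ υ G α) := by
  have h₁ : IsIso (tensorMap κ (CochainComplex.mappingCone.triangle (toFreeTop G)).mor₃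
      (𝟙 (M⟦(-1 : ℤ)⟧))) := by
    refine isIso_mapBifunctorMap (tensorK L κ) _ _ fun i j => ?_
    have hz : IsZero (((tensorK L κ).flip.obj ((M⟦(-1 : ℤ)⟧).X j)).obj
        (((single _ (.up ℤ) 0).obj (freeOn k L ⊤)).X i)) := by
      by_cases hi : i = 0
      · refine IsZero.of_iso ?_ (((tensorK L κ).flip.obj ((M⟦(-1 : ℤ)⟧).X j)).mapIso
          (singleObjXIsoOfEq (.up ℤ) 0 (freeOn k L ⊤) i hi))
        exact IsZero.of_iso (hM (j + -1))
          (@asIso _ _ _ _ (freeEval κ υ ⊤ (M.X (j + -1))) (isIso_freeEval κ υ ⊤ (M.X (j + -1))))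
      · exact Functor.map_isZero _ (isZero_single_obj_X (.up ℤ) 0 _ _ hi)
    have := isIso_map_mappingCone_mor₃ ((tensorK L κ).flip.obj ((M⟦(-1 : ℤ)⟧).X j)) (toFreeTop G) i hz
    have h' : IsIso (((tensorK L κ).map
      ((CochainComplex.mappingCone.triangle (toFreeTop G)).mor₃.f i)).app ((M⟦(-1 : ℤ)⟧).X j)) := this
    rw [id_f, CategoryTheory.Functor.map_id]
    exact @IsIso.comp_isIso _ _ _ _ _ _ _ h' inferInstance
  exact quasiIso_comp_of _ _ (quasiIso_of_isIso_hom _ h₁)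
    (quasiIso_comp_of _ _ (quasiIso_of_isIso_hom _ (Iso.isIso_hom _))
      (quasiIso_comp_of _ _ (quasiIso_of_isIso_hom _ (Functor.map_isIso _ _))
        (quasiIso_comp_of _ _ (quasiIso_of_isIso_hom _ inferInstance) h)))

variable [AB4OfSize.{u} E] [AB4OfSize.{0} E]
  (hκ : ∀ (I : Type u) (S : E), PreservesColimitsOfShape (Discrete I) (κ ⋙ tensorRight S))

lemma IsPrincipal.of_iso {E : Type*} [Category* E] {p : L} {M N : L ⥤ E} (hM : IsPrincipal p M)
    (e : M ≅ N) : IsPrincipal p N where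
  isZero q h := (hM.isZero q h).of_iso (e.symm.app q)
  isIso q h := by
    have := hM.isIso q h
    exact (NatIso.isIso_map_iff e (homOfLE h)).1 this

include υ hκ in
lemma quasiIso_tensorMap_of_principal_cokernel
    {R : CochainComplex (Lᵒᵖ ⥤ ModuleCat.{u} k) ℤ} (hR : IsFreeComplex R) {p : L}
    (h : ((evalComplex _ (op p)).obj R).Acyclic) {M N : CochainComplex (L ⥤ E) ℤ} (φ : M ⟶ N)
    (hφ : ∀ n, ∃ (Y : L ⥤ E) (g : N.X n ⟶ Y) (w : φ.f n ≫ g = 0),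
      (ShortComplex.mk (φ.f n) g w).ShortExact ∧ IsPrincipal p Y) :
    QuasiIso (tensorMap κ (𝟙 R) φ) := by
  have hm : Mono φ := HomologicalComplex.mono_of_mono_f _ fun n => by
    obtain ⟨Y, g, w, h, -⟩ := hφ n
    exact h.mono_f
  have hS := shortExact_cokernel φ
  refine quasiIso_f_of_acyclic (shortExact_tensorComplex υ hκ hR _ hS)
    (acyclic_tensorComplex_of_principal hR h fun n => ?_)
  obtain ⟨Y, g, w, hY, hp⟩ := hφ n
  exact hp.of_iso (IsColimit.coconePointUniqueUpToIso hY.gIsCokernel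
    (hS.map_of_exact (eval (L ⥤ E) (.up ℤ) n)).gIsCokernel)

-- Degreewise, the quotient of the shifted cone by its second summand is the source of `c`. The
-- sequence splits, so it stays exact under the additive functor `F`; this covers the identity and
-- global sections at once.
include υ hκ in
lemma quasiIso_tensorMap_map_inr
    {R : CochainComplex (Lᵒᵖ ⥤ ModuleCat.{u} k) ℤ} (hR : IsFreeComplex R) {p : L}
    (h : ((evalComplex _ (op p)).obj R).Acyclic) {C : Type*} [Category* C] [Abelian C]
    (F : C ⥤ L ⥤ E) [F.Additive] {M N : CochainComplex C ℤ} (c : M ⟶ N)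
    (hM : ∀ n, IsPrincipal p (F.obj (M.X n))) :
    QuasiIso (tensorMap κ (𝟙 R) ((F.mapHomologicalComplex (.up ℤ)).map
      ((CochainComplex.mappingCone.inr c)⟦(-1 : ℤ)⟧'))) := by
  refine quasiIso_tensorMap_of_principal_cokernel υ hκ hR h _ fun n => ?_
  let i := (CochainComplex.mappingCone.inr c).f (n + -1)
  let b := (CochainComplex.mappingCone.fst c).1.v (n + -1) n (by omega)
  have w : i ≫ b = 0 := CochainComplex.mappingCone.inr_f_fst_v _ _ _ _
  let s : (ShortComplex.mk i b w).Splitting :=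
    { r := (CochainComplex.mappingCone.snd c).v (n + -1) (n + -1) (add_zero _)
      s := (CochainComplex.mappingCone.inl c).v n (n + -1) rfl
      f_r := CochainComplex.mappingCone.inr_f_snd_v _ _
      s_g := CochainComplex.mappingCone.inl_v_fst_v _ _ _ _
      id := by
        exact (add_comm _ _).trans (CochainComplex.mappingCone.id_X c (n + -1) n (by omega)) }
  exact ⟨_, F.map b, _, (s.map F).shortExact, hM n⟩

end ConeTensor

/-! ### The fibre of an epimorphism as a kernel -/

section KernelCone

open Pretriangulated DerivedCategory

/-- The rotated triangle of the short exact sequence of the kernel and the triangle of the cone have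
the same first map, so their third objects agree. -/
lemma nonempty_iso_kernel_mappingCone {A : Type*} [Category* A] [Abelian A]
    [HasDerivedCategory.{w} A] {M N : CochainComplex A ℤ} (θ : M ⟶ N) [Epi θ] :
    Nonempty (Q.obj ((CochainComplex.mappingCone θ)⟦(-1 : ℤ)⟧) ≅ Q.obj (kernel θ)) := by
  have hS := shortExact_kernel θ
  let i := isoTriangleOfIso₁₂ _ _ (rot_of_distTriang _ (triangleOfSES_distinguished hS))
    (mappingCone_triangle_distinguished θ) (Iso.refl _) (Iso.refl _)
    ((Category.comp_id _).trans (Category.id_comp _).symm)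
  exact ⟨(Q.commShiftIso (-1 : ℤ)).app _ ≪≫ (shiftFunctor _ (-1 : ℤ)).mapIso
    (Triangle.π₃.mapIso i).symm ≪≫ (shiftFunctorCompIsoId _ (1 : ℤ) (-1) (by simp)).app _⟩

end KernelCone

/-! ### The derived tensor product with the fibre of the restriction maps -/

section Kernel

variable {k : Type u} [CommRing k] {L : Type u}
  {E : Type (u+1)} [Category.{u} E] [MonoidalCategory E] [Abelian E]
  [MonoidalPreadditive E] [HasColimitsOfSize.{u, u} E] [AB4OfSize.{u} E] [AB4OfSize.{0} E]
  {κ : ModuleCat.{u} k ⥤ E} [κ.Additive] (υ : κ.obj (𝟙_ (ModuleCat.{u} k)) ⟶ 𝟙_ E) [IsIso υ]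
  [SemilatticeInf L] [OrderTop L] [Finite L] {X : TopCat.{u}} (Z : Arrangement X L)
  (hκ : ∀ (I : Type u) (S : E), PreservesColimitsOfShape (Discrete I) (κ ⋙ tensorRight S))
  {𝓙 : CochainComplex ((Opens X)ᵒᵖ ⥤ E) ℤ} (h𝓙 : IsFlabbyComplex 𝓙)

-- Every kernel in the filtration is principal at some `p < ⊤`, where `R` is acyclic.
include h𝓙 hκ υ in
lemma quasiIso_tensorMap_openUnionMap (R : FreeResolution (simpleTop k L)) :
    QuasiIso (tensorMap κ (𝟙 R.cplx) (pullMap 𝓙 (Z.openUnionMap (le_top : Z.compl ≤ ⊤)))) := by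
  let W : MorphismProperty (CochainComplex (L ⥤ E) ℤ) :=
    (HomologicalComplex.quasiIso E (.up ℤ)).inverseImage (totalFunctor (tensorK L κ) R.cplx)
  exact openUnionMap_induction h𝓙 Z W fun M N f _ p hp hk =>
    quasiIso_g_of_acyclic (shortExact_tensorComplex υ hκ R.isFreeComplex _ (shortExact_kernel f))
      (acyclic_tensorComplex_of_principal R.isFreeComplex
        (R.acyclic_eval (isZero_simpleTop_obj hp)) hk)

-- Since `U ⊤` is empty, the target of the restriction map vanishes at `⊤` and the kernel is
-- everything.
include h𝓙 in
lemma nonempty_iso_kernel_openUnionToOpen_top :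
    Nonempty ((evalComplex E ⊤).obj (kernel (pullMap 𝓙 (Z.openUnionToOpen Z.compl))) ≅
      (evalComplex E (op Z.compl)).obj 𝓙) := by
  have := epi_pullMap h𝓙 (Z.openUnionToOpen Z.compl)
  let ι := (evalComplex E ⊤).map (kernel.ι (pullMap 𝓙 (Z.openUnionToOpen Z.compl)))
  have (n : ℤ) : IsIso (ι.f n) := by
    have hS := ((shortExact_kernel (pullMap 𝓙 (Z.openUnionToOpen Z.compl))).map_of_exact
      (HomologicalComplex.eval _ _ n)).map_of_exact ((evaluation L E).obj ⊤)
    have hz : IsZero ((𝓙.X n).obj (op (Z.U ⊤))) := by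
      rw [Z.U_top]
      exact (h𝓙 n).isZero
    exact hS.isIso_f_iff.2 hz
  have := HomologicalComplex.Hom.isIso_of_components ι
  exact ⟨asIso ι ≪≫ Z.openUnionTopIso 𝓙 Z.compl⟩

include h𝓙 hκ υ in
/-- The derived tensor product of `simpleTop` with the fibre of the restriction to the `U_p` is the
value at the complement. -/
lemma nonempty_iso_tensorComplex_mappingCone [HasDerivedCategory.{w} E]
    [HasDerivedCategory.{w} (L ⥤ E)] (R : FreeResolution (simpleTop k L))
    {K : CochainComplex (L ⥤ E) ℤ} (e : K ≅ pullComplex 𝓙 (Z.openUnion ⊤))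
    (θ : K ⟶ pullComplex 𝓙 Z.openFunctor) (hθ : θ = e.hom ≫ pullMap 𝓙 (Z.openUnionToOpen ⊤))
    {C : CochainComplex (L ⥤ E) ℤ} (i : DerivedCategory.Q.obj C ≅
      DerivedCategory.Q.obj ((CochainComplex.mappingCone θ)⟦(-1 : ℤ)⟧)) :
    Nonempty (DerivedCategory.Q.obj (tensorComplex κ R.cplx C) ≅
      DerivedCategory.Q.obj ((evalComplex E (op Z.compl)).obj 𝓙)) := by
  have h₁ := epi_pullMap h𝓙 (Z.openUnionToOpen ⊤)
  have h₂ := epi_pullMap h𝓙 (Z.openUnionToOpen Z.compl)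
  have h₃ : Epi θ := hθ ▸ epi_comp _ _
  -- By flabbiness `θ` is an epimorphism, so the shifted cone may be replaced by the kernel of `θ`.
  obtain ⟨i₁⟩ := nonempty_iso_kernel_mappingCone θ
  obtain ⟨i₂⟩ := nonempty_iso_tensorComplex_simpleTop υ hκ R (i ≪≫ i₁)
  let σ := pullMap 𝓙 (Z.openUnionMap (le_top : Z.compl ≤ ⊤))
  have hσ : (e.hom ≫ σ) ≫ pullMap 𝓙 (Z.openUnionToOpen Z.compl) = θ := by
    rw [hθ, Category.assoc, ← pullMap_comp]
    rfl
  -- Compares restriction from `X` to `U_p` with restriction from `U_p ∪ U` to `U_p`. The targets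
  -- are equal, and the middle map becomes a quasi-isomorphism after tensoring with `R`; hence so
  -- does the map of kernels.
  let φ : ShortComplex.mk (kernel.ι θ) θ (kernel.condition θ) ⟶
      ShortComplex.mk (kernel.ι (pullMap 𝓙 (Z.openUnionToOpen Z.compl))) _ (kernel.condition _) :=
    { τ₁ := kernel.lift _ (kernel.ι θ ≫ e.hom ≫ σ) (by
        rw [Category.assoc, hσ, kernel.condition])
      τ₂ := e.hom ≫ σ
      τ₃ := 𝟙 _
      comm₁₂ := kernel.lift_ι _ _ _
      comm₂₃ := hσ.trans (Category.comp_id _).symm }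
  let T := totalFunctor (tensorK L κ) R.cplx
  have h : QuasiIso (T.map φ.τ₁) := by
    refine quasiIso_τ₁ (shortExact_tensorComplex υ hκ R.isFreeComplex _ (shortExact_kernel θ))
      (shortExact_tensorComplex υ hκ R.isFreeComplex _
        (shortExact_kernel (pullMap 𝓙 (Z.openUnionToOpen Z.compl)))) (T.mapShortComplex.map φ) ?_ ?_
    · have := quasiIso_tensorMap_openUnionMap υ Z hκ h𝓙 R
      have h' : QuasiIso (T.map e.hom ≫ T.map σ) :=
        quasiIso_comp_of _ _ (quasiIso_of_isIso_hom _ inferInstance) this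
      have h'' : QuasiIso (T.map (e.hom ≫ σ)) := by rw [T.map_comp]; exact h'
      exact h''
    · exact quasiIso_of_isIso_hom (T.map (𝟙 _)) inferInstance
  obtain ⟨f, hf⟩ := exists_quasiIso_tensorComplex_simpleTop υ R
    (isPrincipal_kernel_openUnionToOpen h𝓙 Z)
  obtain ⟨j⟩ := nonempty_iso_kernel_openUnionToOpen_top Z h𝓙
  have hf' : IsIso (DerivedCategory.Q.map f) := (DerivedCategory.isIso_Q_map_iff_quasiIso _ _).2 hf
  have hh : IsIso (DerivedCategory.Q.map (T.map φ.τ₁)) :=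
    (DerivedCategory.isIso_Q_map_iff_quasiIso _ _).2 h
  exact ⟨i₂ ≪≫ @asIso _ _ _ _ _ hh ≪≫ @asIso _ _ _ _ _ hf' ≪≫ DerivedCategory.Q.mapIso j⟩

end Kernel

/-! ### Tensor products with constant sheaves -/

section SheafTensor

variable {C : Type u} [Category.{u} C] (T : GrothendieckTopology C) (A : Type (u+1))
  [Category.{u} A] [MonoidalCategory A] [HasColimitsOfSize.{u, u} A]
  [(T.W (A := A)).IsMonoidal] [HasSheafify T A]

attribute [local instance] CategoryTheory.Sheaf.monoidalCategory

lemma isIso_η_presheafToSheaf : IsIso (Functor.OplaxMonoidal.η (presheafToSheaf T A)) :=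
  inferInstance

/-- The tensor product of a sheafification with a sheaf is a sheafification. -/
noncomputable def presheafToSheafTensorIso (S : Sheaf T A) :
    tensorRight S.obj ⋙ presheafToSheaf T A ≅ presheafToSheaf T A ⋙ tensorRight S :=
  NatIso.ofComponents
    (fun P => (Functor.Monoidal.μIso (presheafToSheaf T A) P S.obj).symm ≪≫
      whiskerLeftIso _ (asIso ((sheafificationAdjunction T A).counit.app S)))
    fun {P Q} f => by
      simp [whisker_exchange]

/-- The functor is the composite of the constant presheaf, the objectwise tensor product with `S`
and sheafification, each of which preserves these coproducts. -/
lemma preservesColimits_constantSheaf_tensorRight (I : Type u)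
    (hA : ∀ a : A, PreservesColimitsOfShape (Discrete I) (tensorRight a)) (S : Sheaf T A) :
    PreservesColimitsOfShape (Discrete I) (constantSheaf T A ⋙ tensorRight S) := by
  have h₁ : PreservesColimitsOfShape (Discrete I) (tensorRight S.obj) :=
    preservesColimitsOfShape_of_evaluation _ _ fun W =>
      inferInstanceAs (PreservesColimitsOfShape (Discrete I)
        ((evaluation _ _).obj W ⋙ tensorRight (S.obj.obj W)))
  have h₂ : PreservesColimitsOfShape (Discrete I) (Functor.const Cᵒᵖ : A ⥤ _) := inferInstance
  have h₃ : PreservesColimitsOfShape (Discrete I) (presheafToSheaf T A) :=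
    (sheafificationAdjunction T A).leftAdjoint_preservesColimits.preservesColimitsOfShape
  have h₄ : PreservesColimitsOfShape (Discrete I)
      (Functor.const Cᵒᵖ ⋙ tensorRight S.obj ⋙ presheafToSheaf T A) := inferInstance
  exact preservesColimitsOfShape_of_natIso
    (Functor.isoWhiskerLeft (Functor.const _) (presheafToSheafTensorIso T A S))

end SheafTensor

/-! ### The coefficient functors for modules and for sheaves -/

section CoefficientSheaf

variable (k : Type u) [CommRing k] (X : TopCat.{u})

lemma preservesColimits_tensorRight_module (I : Type u) (S : ModuleCat.{u} k) :
    PreservesColimitsOfShape (Discrete I) (𝟭 (ModuleCat.{u} k) ⋙ tensorRight S) :=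
  inferInstance

instance : IsIso (constShUnit k X) :=
  isIso_η_presheafToSheaf (Opens.grothendieckTopology X) (ModuleCat.{u} k)

lemma preservesColimits_constSh_tensorRight (I : Type u) (S : Sh k X) :
    PreservesColimitsOfShape (Discrete I) (constSh k X ⋙ tensorRight S) :=
  preservesColimits_constantSheaf_tensorRight (Opens.grothendieckTopology X) (ModuleCat.{u} k) I
    (fun _ => inferInstance) S

end CoefficientSheaf

/-! ### The flabby systems of a flabby sheaf, and the first assertion -/

section SheafSystem

variable {k : Type u} [CommRing k] {X : TopCat.{u}}

/-- The system `O ↦ j_* F|_O`. -/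
noncomputable def sheafSystem : Sh k X ⥤ (Opens X)ᵒᵖ ⥤ Sh k X where
  obj F :=
    { obj O := (jj O.unop).obj F
      map g := (jjMap (leOfHom g.unop)).app F
      map_id O := NatTrans.congr_app (jjMap_refl O.unop) F
      map_comp g h := (NatTrans.congr_app (jjMap_comp (leOfHom g.unop) (leOfHom h.unop)) F).symm }
  map f :=
    { app O := (jj O.unop).map f
      naturality _ _ g := ((jjMap (leOfHom g.unop)).naturality f).symm }

instance : (sheafSystem : Sh k X ⥤ _).Additive where

/-- The sections over a fixed open subset. -/
noncomputable abbrev sectionsOver (W : (Opens X)ᵒᵖ) : Sh k X ⥤ ModuleCat.{u} k :=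
  TopCat.Sheaf.forget (ModuleCat.{u} k) X ⋙ (evaluation _ _).obj W

lemma coe_image_preimage (U W : Opens X) :
    ((U.isOpenEmbedding.functor.obj ((Opens.map U.inclusion').obj W) : Opens X) : Set X) =
      (U : Set X) ∩ W := by
  ext x
  constructor
  · rintro ⟨y, hy, rfl⟩
    exact ⟨y.2, hy⟩
  · rintro ⟨h₁, h₂⟩
    exact ⟨⟨x, h₁⟩, h₂, rfl⟩

lemma isPullback_sections (F : Sh k X) {U V W T : Opens X}
    (hW : W = U ⊔ V) (hT : T = U ⊓ V) (a : op W ⟶ op U) (b : op W ⟶ op V) (c : op U ⟶ op T)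
    (d : op V ⟶ op T) : IsPullback (F.1.map a) (F.1.map b) (F.1.map c) (F.1.map d) := by
  subst hW hT
  exact ⟨⟨(F.1.map_comp a c).symm.trans (F.1.map_comp b d)⟩,
    ⟨TopCat.Sheaf.isLimitPullbackCone F U V⟩⟩

/-- The value at `O` consists of the sections of `F` on `O ∩ W`. Intersection with `W` respects
unions and intersections, so the sheaf condition for two open sets gives the cartesian squares. -/
lemma isFlabbySystem_sectionsOver {F : Sh k X} (hF : F.IsFlasque) (W : (Opens X)ᵒᵖ) :
    IsFlabbySystem (sheafSystem.obj F ⋙ sectionsOver W) where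
  epi h := hF.epi _
  isZero := by
    refine (isZero_zero _).of_iso (IsTerminal.uniqueUpToIso (F.isTerminalOfEqEmpty ?_)
      (isZero_zero _).isTerminal)
    exact Opens.ext ((coe_image_preimage ⊥ W.unop).trans (Set.empty_inter _))
  isPullback U V := by
    refine isPullback_sections F (Opens.ext ?_) (Opens.ext ?_) _ _ _ _
    · simp only [Opens.coe_sup, coe_image_preimage]
      exact Set.union_inter_distrib_right _ _ _
    · simp only [Opens.coe_inf, coe_image_preimage]
      exact Set.inter_inter_distrib_right _ _ _

lemma isFlabbySystem_sheafSystem {F : Sh k X} (hF : F.IsFlasque) :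
    IsFlabbySystem (sheafSystem.obj F) where
  epi {U V} h := by
    have (W : (Opens X)ᵒᵖ) : Epi (((sheafSystem.obj F).map h.op).1.app W) :=
      (isFlabbySystem_sectionsOver hF W).epi h
    have : Epi ((TopCat.Sheaf.forget _ X).map ((sheafSystem.obj F).map h.op)) :=
      @NatTrans.epi_of_epi_app _ _ _ _ _ _ _ this
    exact (TopCat.Sheaf.forget _ X).epi_of_epi_map this
  isZero := by
    rw [IsZero.iff_id_eq_zero]
    exact sh_hom_ext fun W => (isFlabbySystem_sectionsOver hF W).isZero.eq_of_src _ _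
  isPullback U V := by
    have w : (sheafSystem.obj F).map (homOfLE (le_sup_left : U ≤ U ⊔ V)).op ≫
        (sheafSystem.obj F).map (homOfLE (inf_le_left : U ⊓ V ≤ U)).op =
        (sheafSystem.obj F).map (homOfLE (le_sup_right : V ≤ U ⊔ V)).op ≫
        (sheafSystem.obj F).map (homOfLE (inf_le_right : U ⊓ V ≤ V)).op :=
      ((sheafSystem.obj F).map_comp _ _).symm.trans ((sheafSystem.obj F).map_comp
        (homOfLE (le_sup_right : V ≤ U ⊔ V)).op (homOfLE (inf_le_right : U ⊓ V ≤ V)).op)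
    refine IsPullback.of_map (sheafToPresheaf _ _) w ?_
    exact IsPullback.of_forall_isPullback_app fun W =>
      (isFlabbySystem_sectionsOver hF W).isPullback U V

variable (J : CochainComplex (Sh k X) ℤ)

/-- The system of complexes `O ↦ j_* J|_O`. -/
noncomputable abbrev sheafSystemComplex : CochainComplex ((Opens X)ᵒᵖ ⥤ Sh k X) ℤ :=
  ((sheafSystem (k := k) (X := X)).mapHomologicalComplex (.up ℤ)).obj J

/-- The system of complexes `O ↦ J(O)`. -/
noncomputable abbrev sectionsSystemComplex : CochainComplex ((Opens X)ᵒᵖ ⥤ ModuleCat.{u} k) ℤ :=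
  (((Functor.whiskeringRight (Opens X)ᵒᵖ _ _).obj (globalSections X)).mapHomologicalComplex
    (.up ℤ)).obj (sheafSystemComplex J)

variable {L : Type u} [SemilatticeInf L] [OrderTop L] (Z : Arrangement X L)

variable {J} (hJ : ∀ n, (J.X n).IsFlasque)

include hJ in
lemma isFlabbyComplex_sheafSystemComplex : IsFlabbyComplex (sheafSystemComplex (k := k) (X := X) J) := fun n =>
  isFlabbySystem_sheafSystem (hJ n)

include hJ in
lemma isFlabbyComplex_sectionsSystemComplex : IsFlabbyComplex (sectionsSystemComplex (k := k) (X := X) J) := fun n =>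
  isFlabbySystem_sectionsOver (hJ n) (op ⊤)

instance : AB4OfSize.{u} (Sh k X) := IsGrothendieckAbelian.ab4OfSize _
instance : AB4OfSize.{0} (Sh k X) := AB4OfSize_shrink.{0, u} _
instance : AB4OfSize.{u} (ModuleCat.{u} k) := IsGrothendieckAbelian.ab4OfSize _
instance : AB4OfSize.{0} (ModuleCat.{u} k) := AB4OfSize_shrink.{0, u} _

variable [Finite L]

lemma isPrincipal_const {E : Type*} [Category* E] (Y : E) {b : L} (hb : ∀ x, b ≤ x) :
    IsPrincipal b ((Functor.const L).obj Y) where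
  isZero q h := (h (hb q)).elim
  isIso _ _ := inferInstanceAs (IsIso (𝟙 Y))

lemma exists_bot_ne_top [Nonempty (Below L)] : ∃ b : L, b ≠ ⊤ ∧ ∀ x, b ≤ x := by
  have := Fintype.ofFinite L
  have hb : ∀ x : L, Finset.univ.inf id ≤ x := fun x => Finset.inf_le (f := id) (Finset.mem_univ x)
  exact ⟨Finset.univ.inf id, fun h => (Classical.arbitrary (Below L)).2 (top_le_iff.1 (h.ge.trans (hb _))),
    hb⟩

variable [Nonempty (Below L)] (G : FreeResolution (constBelow k L))

include hJ in
lemma quasiIso_hocolimMap_cocone :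
    QuasiIso (hocolimMap (constSh k X) (constShUnit k X) G (Z.cocone J)) :=
  quasiIso_hocolimMap (constShUnit k X) Z (preservesColimits_constSh_tensorRight k X)
    (isFlabbyComplex_sheafSystemComplex hJ) G

include hJ in
lemma quasiIso_zigzagRight_cocone :
    QuasiIso (zigzagRight (constSh k X) (constShUnit k X) G (Z.cocone J)) :=
  quasiIso_zigzagRight (constShUnit k X) G (Z.cocone J) (fun n => by
    have h := (isFlabbySystem_sheafSystem (hJ n)).isZero
    rw [← Z.U_top] at h
    exact h) (quasiIso_hocolimMap_cocone Z hJ G)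

/-- The cokernel is degreewise constant, hence principal at the least element, where a resolution of
`simpleTop` is acyclic; flabbiness plays no role. -/
lemma quasiIso_tensorMap_jToI :
    QuasiIso (tensorMap (constSh k X) (𝟙 (coneComplex G)) (Z.jToI J)) := by
  obtain ⟨R, hR⟩ := exists_freeResolution_coneComplex G
  obtain ⟨b, hb, hb'⟩ := exists_bot_ne_top (L := L)
  exact quasiIso_tensorMap_map_inr (constShUnit k X) (preservesColimits_constSh_tensorRight k X)
    (hR ▸ R.isFreeComplex) (hR ▸ R.acyclic_eval (isZero_simpleTop_obj hb)) (𝟭 _) (Z.constToJ J)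
    fun n => isPrincipal_const _ hb'

include hJ in
lemma quasiIso_hocolimMap_sectionsCocone :
    QuasiIso (hocolimMap (𝟭 (ModuleCat.{u} k)) (𝟙 _) G (Z.sectionsCocone J)) :=
  quasiIso_hocolimMap (κ := 𝟭 (ModuleCat.{u} k)) (𝟙 _) Z (preservesColimits_tensorRight_module k)
    (isFlabbyComplex_sectionsSystemComplex hJ) G

include hJ in
lemma quasiIso_zigzagRight_sectionsCocone :
    QuasiIso (zigzagRight (𝟭 (ModuleCat.{u} k)) (𝟙 _) G (Z.sectionsCocone J)) :=
  quasiIso_zigzagRight (κ := 𝟭 (ModuleCat.{u} k)) (𝟙 _) G (Z.sectionsCocone J) (fun n => by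
    have h := (isFlabbySystem_sectionsOver (hJ n) (op ⊤)).isZero
    rw [← Z.U_top] at h
    exact h) (quasiIso_hocolimMap_sectionsCocone Z hJ G)

lemma quasiIso_tensorMap_sectionsJToI :
    QuasiIso (tensorMap (𝟭 (ModuleCat.{u} k)) (𝟙 (coneComplex G)) (Z.sectionsJToI J)) := by
  obtain ⟨R, hR⟩ := exists_freeResolution_coneComplex G
  obtain ⟨b, hb, hb'⟩ := exists_bot_ne_top (L := L)
  have h := quasiIso_tensorMap_map_inr (κ := 𝟭 (ModuleCat.{u} k)) (𝟙 _)
    (preservesColimits_tensorRight_module k) (hR ▸ R.isFreeComplex)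
    (hR ▸ R.acyclic_eval (isZero_simpleTop_obj hb))
    ((Functor.whiskeringRight L _ _).obj (globalSections X)) (Z.constToJ J)
    fun n => ⟨fun q hq => (hq (hb' q)).elim, fun q hq =>
      inferInstanceAs (IsIso ((globalSections X).map (𝟙 (J.X n))))⟩
  let T := totalFunctor (tensorK L (𝟭 (ModuleCat.{u} k))) (coneComplex G)
  have h' : QuasiIso (T.map (((Arrangement.sectionsRep X L).commShiftIso (-1 : ℤ)).inv.app _) ≫
      T.map ((Arrangement.sectionsRep X L).map (Z.jToI J))) :=
    quasiIso_comp_of _ _ (quasiIso_of_isIso_hom _ inferInstance) h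
  rw [← T.map_comp] at h'
  exact h'

end SheafSystem

/-! ### The fibre of the restriction maps in terms of the flabby system -/

section Fibre

variable {k : Type u} [CommRing k] {X : TopCat.{u}}

lemma isIso_of_isIso_sections {F G : Sh k X} (f : F ⟶ G) (h : ∀ W, IsIso (f.1.app W)) : IsIso f := by
  have : IsIso f.1 := @NatIso.isIso_of_isIso_app _ _ _ _ _ _ f.1 h
  exact ⟨⟨inv f.1⟩, CategoryTheory.Sheaf.hom_ext (IsIso.hom_inv_id f.1),
    CategoryTheory.Sheaf.hom_ext (IsIso.inv_hom_id f.1)⟩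

lemma isIso_jjUnit_app {U : Opens X} (hU : U = ⊤) (F : Sh k X) : IsIso ((jjUnit U).app F) := by
  subst hU
  refine isIso_of_isIso_sections _ fun W => ?_
  have e : (⊤ : Opens X).isOpenEmbedding.functor.obj
      ((Opens.map (⊤ : Opens X).inclusion').obj W.unop) = W.unop :=
    Opens.ext ((coe_image_preimage ⊤ W.unop).trans (Set.univ_inter _))
  have : IsIso (homOfLE (image_preimage_le ⊤ W.unop)).op :=
    ⟨(eqToHom e.symm).op, Subsingleton.elim _ _, Subsingleton.elim _ _⟩
  exact inferInstanceAs (IsIso (F.1.map (homOfLE (image_preimage_le ⊤ W.unop)).op))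

variable {L : Type u} [SemilatticeInf L] [OrderTop L] (Z : Arrangement X L)

/-- The restriction map from the constant representation to `p ↦ j_* F|_{U_p ∪ X}`. -/
noncomputable def Arrangement.toOpenUnionTop : Functor.const L ⟶
    sheafSystem (k := k) ⋙ (Functor.whiskeringLeft L (Opens X)ᵒᵖ (Sh k X)).obj (Z.openUnion ⊤) where
  app F :=
    { app p := (jjUnit (Z.U p ⊔ ⊤)).app F
      naturality p q g := by
        refine (Category.id_comp _).trans ?_
        exact (NatTrans.congr_app (jjUnit_map (leOfHom ((Z.openUnion ⊤).map g).unop)) F).symm }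
  naturality F G f := by
    ext p : 2
    exact (jjUnit (Z.U p ⊔ ⊤)).naturality f

instance : IsIso (Z.toOpenUnionTop (k := k)) := by
  have (F : Sh k X) : IsIso (Z.toOpenUnionTop.app F) := by
    have (p : L) : IsIso ((Z.toOpenUnionTop.app F).app p) := isIso_jjUnit_app (sup_top_eq _) F
    exact NatIso.isIso_of_isIso_app _
  exact NatIso.isIso_of_isIso_app _

variable (J : CochainComplex (Sh k X) ℤ)

/-- The constant representation is isomorphic to `p ↦ j_* J|_{U_p ∪ X}`. -/
noncomputable def Arrangement.constIso :
    Arrangement.constComplex (L := L) J ≅ pullComplex (sheafSystemComplex J) (Z.openUnion ⊤) :=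
  (NatIso.mapHomologicalComplex (asIso Z.toOpenUnionTop) (.up ℤ)).app J

/-- Brings the map whose cone defines `iShriek` into the form required by
`nonempty_iso_tensorComplex_mappingCone`, with `U_p ∪ X` in place of `X`. -/
lemma Arrangement.constToJ_eq : Z.constToJ J = (Z.constIso J).hom ≫
    pullMap (sheafSystemComplex (k := k) (X := X) J) (Z.openUnionToOpen ⊤) := by
  ext n p
  exact (NatTrans.congr_app (jjUnit_map (le_sup_left : Z.U p ≤ Z.U p ⊔ ⊤)) (J.X n)).symm

/-- Global sections of `i_{p*} i_p^! J`. -/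
noncomputable def Arrangement.sectionsIShriekIso :
    (Arrangement.sectionsRep X L).obj (Z.iShriek J) ≅
      (CochainComplex.mappingCone ((Arrangement.sectionsRep X L).map (Z.constToJ J)))⟦(-1 : ℤ)⟧ :=
  ((Arrangement.sectionsRep X L).commShiftIso (-1 : ℤ)).app _ ≪≫
    (shiftFunctor _ (-1 : ℤ)).mapIso
      (CochainComplex.mappingCone.mapHomologicalComplexIso (Z.constToJ J) _)

variable {J} [Finite L] (hJ : ∀ n, (J.X n).IsFlasque) (R : FreeResolution (simpleTop k L))

include hJ in
lemma nonempty_iso_tensorComplex_iShriek [HasDerivedCategory.{w} (Sh k X)]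
    [HasDerivedCategory.{w} (L ⥤ Sh k X)] {C : CochainComplex (L ⥤ Sh k X) ℤ}
    (i : DerivedCategory.Q.obj C ≅ DerivedCategory.Q.obj (Z.iShriek J)) :
    Nonempty (DerivedCategory.Q.obj (tensorComplex (constSh k X) R.cplx C) ≅
      DerivedCategory.Q.obj (Z.jCompl J)) :=
  nonempty_iso_tensorComplex_mappingCone (constShUnit k X) Z
    (preservesColimits_constSh_tensorRight k X) (isFlabbyComplex_sheafSystemComplex hJ) R
    (Z.constIso J) (Z.constToJ J) (Z.constToJ_eq J) i

include hJ in
lemma nonempty_iso_tensorComplex_sectionsRep [HasDerivedCategory.{w} (ModuleCat.{u} k)]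
    [HasDerivedCategory.{w} (L ⥤ ModuleCat.{u} k)] {C : CochainComplex (L ⥤ ModuleCat.{u} k) ℤ}
    (i : DerivedCategory.Q.obj C ≅
      DerivedCategory.Q.obj ((Arrangement.sectionsRep X L).obj (Z.iShriek J))) :
    Nonempty (DerivedCategory.Q.obj (tensorComplex (𝟭 (ModuleCat.{u} k)) R.cplx C) ≅
      DerivedCategory.Q.obj ((Arrangement.sectionsComplex X).obj (Z.jCompl J))) :=
  nonempty_iso_tensorComplex_mappingCone (κ := 𝟭 (ModuleCat.{u} k)) (𝟙 _) Z
    (preservesColimits_tensorRight_module k) (isFlabbyComplex_sectionsSystemComplex hJ) R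
    ((Arrangement.sectionsRep X L).mapIso (Z.constIso J))
    ((Arrangement.sectionsRep X L).map (Z.constToJ J))
    ((congrArg (Arrangement.sectionsRep X L).map (Z.constToJ_eq J)).trans
      ((Arrangement.sectionsRep X L).map_comp _ _))
    (i ≪≫ DerivedCategory.Q.mapIso (Z.sectionsIShriekIso J))

end Fibre

/-! ### Derived functors computed by adapted classes -/

section Acyclicity

variable {C D : Type*} [Category* C] [Abelian C] [Category* D] [Abelian D]

/-- The sequence of the cycles, the terms and the next cycles of a complex. -/
noncomputable abbrev cyclesSequence (K : CochainComplex C ℤ) (n : ℤ) : ShortComplex C :=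
  ShortComplex.mk (K.iCycles n) (K.toCycles n (n + 1)) (by
    rw [← cancel_mono (K.iCycles (n + 1)), Category.assoc, HomologicalComplex.toCycles_i,
      HomologicalComplex.iCycles_d, zero_comp])

lemma shortExact_cyclesSequence {K : CochainComplex C ℤ} (hK : K.Acyclic) (n : ℤ) :
    (cyclesSequence K n).ShortExact where
  exact := by
    refine ShortComplex.exact_of_f_is_kernel _ (KernelFork.IsLimit.ofι' _ _ fun {A} a ha => ?_)
    have ha' : a ≫ K.toCycles n (n + 1) = 0 := ha
    have ha'' : a ≫ K.d n (n + 1) = 0 := by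
      have e := K.toCycles_i n (n + 1)
      exact (congrArg (a ≫ ·) e).symm.trans ((Category.assoc _ _ _).symm.trans
        ((congrArg (· ≫ K.iCycles (n + 1)) ha').trans zero_comp))
    exact ⟨K.liftCycles a (n + 1) (by simp) ha'', K.liftCycles_i _ _ _ _⟩
  mono_f := inferInstanceAs (Mono (K.iCycles n))
  epi_g := by
    have h := (ShortComplex.exact_iff_epi_toCycles _).1
      ((HomologicalComplex.exactAt_iff' K n (n + 1) (n + 1 + 1) (by simp) (by simp)).1 (hK (n + 1)))
    have e := K.toCycles_cyclesIsoSc'_hom n (n + 1) (n + 1 + 1) (by simp) (by simp)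
    have h' : Epi (K.toCycles n (n + 1) ≫
        (K.cyclesIsoSc' n (n + 1) (n + 1 + 1) (by simp) (by simp)).hom) := e ▸ h
    exact (epi_comp_iff_of_isIso _ _).1 h'

/-- A class of objects adapted to a functor: it contains the injective objects, is stable under
quotients of monomorphisms, and short exact sequences that start in the class remain exact. -/
structure IsAdapted (T : C ⥤ D) [T.Additive] (𝒜 : ObjectProperty C) : Prop where
  injective (Y : C) (_ : Injective Y) : 𝒜 Y
  quotient (S : ShortComplex C) (_ : S.ShortExact) (_ : 𝒜 S.X₁) (_ : 𝒜 S.X₂) : 𝒜 S.X₃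
  exact (S : ShortComplex C) (_ : S.ShortExact) (_ : 𝒜 S.X₁) : (S.map T).ShortExact

variable {T : C ⥤ D} [T.Additive] {𝒜 : ObjectProperty C} (hT : IsAdapted T 𝒜)

-- The cycles lie in the class, by induction on the degree starting from zero objects, as each is
-- the quotient of a term by the previous cycles. Hence `T` keeps the sequences of cycles exact, and
-- these splice together.
include hT in
lemma IsAdapted.acyclic {K : CochainComplex C ℤ} (hK : K.Acyclic) (h𝒜 : ∀ n, 𝒜 (K.X n)) (a : ℤ)
    [K.IsStrictlyGE a] : ((T.mapHomologicalComplex (.up ℤ)).obj K).Acyclic := by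
  have hz (n : ℤ) (hn : n < a) : 𝒜 (K.cycles n) :=
    hT.injective _ (((K.isZero_of_isStrictlyGE a n hn).of_mono (K.iCycles n)).injective)
  have hc (m : ℕ) : 𝒜 (K.cycles (a - 1 + m)) := by
    induction m with
    | zero => exact hz _ (by simp)
    | succ m ih =>
      have h := hT.quotient _ (shortExact_cyclesSequence hK (a - 1 + m)) ih (h𝒜 _)
      have e : a - 1 + m + 1 = a - 1 + (m + 1 : ℕ) := by push_cast; ring
      exact e ▸ h
  have hc' (n : ℤ) : 𝒜 (K.cycles n) := by
    by_cases hn : n < a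
    · exact hz n hn
    · have h := hc (n - (a - 1)).toNat
      rwa [Int.toNat_of_nonneg (by omega), add_sub_cancel] at h
  have hS (n : ℤ) := hT.exact _ (shortExact_cyclesSequence hK n) (hc' n)
  intro n
  obtain ⟨m, rfl⟩ : ∃ m, n = m + 1 := ⟨n - 1, by ring⟩
  rw [HomologicalComplex.exactAt_iff' _ m (m + 1) (m + 1 + 1) (by simp) (by simp)]
  have e (i : ℤ) : T.map (K.toCycles i (i + 1)) ≫ T.map (K.iCycles (i + 1)) = T.map (K.d i (i + 1)) := by
    rw [← T.map_comp, HomologicalComplex.toCycles_i]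
  -- Intermediate between the sequence of cycles and the complex: it differs from the former by an
  -- epimorphism on the left and from the latter by a monomorphism on the right, neither of which
  -- affects exactness in the middle.
  let S₀ : ShortComplex D := ShortComplex.mk (T.map (K.d m (m + 1)))
    (T.map (K.toCycles (m + 1) (m + 1 + 1))) (by
      rw [← T.map_comp, HomologicalComplex.d_toCycles, T.map_zero])
  let φ : S₀ ⟶ (cyclesSequence K (m + 1)).map T :=
    { τ₁ := T.map (K.toCycles m (m + 1))
      τ₂ := 𝟙 _
      τ₃ := 𝟙 _
      comm₁₂ := (e m).trans (Category.comp_id _).symm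
      comm₂₃ := (Category.id_comp _).trans (Category.comp_id _).symm }
  have h₁ : Epi φ.τ₁ := (hS m).epi_g
  have h₂ : IsIso φ.τ₂ := inferInstanceAs (IsIso (𝟙 _))
  have h₃ : Mono φ.τ₃ := inferInstanceAs (Mono (𝟙 _))
  have h₀ : S₀.Exact := (ShortComplex.exact_iff_of_epi_of_isIso_of_mono φ).2 (hS (m + 1)).exact
  let ψ : S₀ ⟶ ((T.mapHomologicalComplex (.up ℤ)).obj K).sc' m (m + 1) (m + 1 + 1) :=
    { τ₁ := 𝟙 _
      τ₂ := 𝟙 _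
      τ₃ := T.map (K.iCycles (m + 1 + 1))
      comm₁₂ := (Category.id_comp _).trans (Category.comp_id _).symm
      comm₂₃ := (Category.id_comp _).trans (e (m + 1)).symm }
  have h₁' : Epi ψ.τ₁ := inferInstanceAs (Epi (𝟙 _))
  have h₂' : IsIso ψ.τ₂ := inferInstanceAs (IsIso (𝟙 _))
  have h₃' : Mono ψ.τ₃ := (hS (m + 1 + 1)).mono_f
  exact (ShortComplex.exact_iff_of_epi_of_isIso_of_mono ψ).1 h₀

-- The cokernel of `f` is acyclic, bounded below and has terms in the class, so `T` keeps it acyclic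
-- and keeps the sequence exact.
include hT in
lemma IsAdapted.quasiIso_map {K M : CochainComplex C ℤ} (f : K ⟶ M) [Mono f] [QuasiIso f]
    (hK : ∀ n, 𝒜 (K.X n)) (hM : ∀ n, 𝒜 (M.X n)) (a : ℤ) [M.IsStrictlyGE a] :
    QuasiIso ((T.mapHomologicalComplex (.up ℤ)).map f) := by
  have hS := shortExact_cokernel f
  have hSn (n : ℤ) := hS.map_of_exact (HomologicalComplex.eval C (.up ℤ) n)
  have hQ (n : ℤ) : 𝒜 ((cokernel f).X n) := hT.quotient _ (hSn n) (hK n) (hM n)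
  have : (cokernel f).IsStrictlyGE a := by
    rw [CochainComplex.isStrictlyGE_iff]
    intro i hi
    have := (hSn i).epi_g
    exact (M.isZero_of_isStrictlyGE a i hi).of_epi ((cokernel.π f).f i)
  have hac : (cokernel f).Acyclic := hS.acyclic_X₃ ‹_›
  have hTS : ((ShortComplex.mk f (cokernel.π f) (cokernel.condition f)).map
      (T.mapHomologicalComplex (.up ℤ))).ShortExact :=
    HomologicalComplex.shortExact_of_degreewise_shortExact _ fun n => hT.exact _ (hSn n) (hK n)
  exact quasiIso_f_of_acyclic hTS (hT.acyclic hac hQ a)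

open DerivedCategory in
/-- The right derived functor is computed by injective resolutions. -/
lemma nonempty_iso_rightDerivedFunctorPlus_of_injective (T : C ⥤ D) [T.Additive]
    [EnoughInjectives C] [HasDerivedCategory C]
    [HasDerivedCategory D] {Y : C} {M : CochainComplex C ℤ} (a : ℤ) [M.IsStrictlyGE a]
    (hM : ∀ n, Injective (M.X n)) (f : (HomologicalComplex.single C (.up ℤ) 0).obj Y ⟶ M)
    [QuasiIso f] : Nonempty (Plus.ι.obj (T.rightDerivedFunctorPlus.obj ((Plus.singleFunctor C 0).obj Y)) ≅
      Q.obj ((T.mapHomologicalComplex (.up ℤ)).obj M)) := by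
  let M' : CochainComplex (InjectiveObject C) ℤ := HomologicalComplex.liftObjectProperty _ M hM
  have hM' : M'.IsStrictlyGE a := by
    rwa [← CochainComplex.isStrictlyGE_mapHomologicalComplex_obj_iff _ (InjectiveObject.ι _)]
  let K : CochainComplex.Plus (InjectiveObject C) := ⟨M', a, hM'⟩
  let P := (HomotopyCategory.Plus.quotient C).obj ((InjectiveObject.ι C).mapCochainComplexPlus.obj K)
  have : IsIso (T.rightDerivedFunctorPlusUnit.app P) := inferInstanceAs
    (IsIso (T.rightDerivedFunctorPlusUnit.app ((HomotopyCategory.Plus.quotient C).obj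
        ((InjectiveObject.ι C).mapCochainComplexPlus.obj K))))
  let i₁ : Plus.ι.obj (Plus.Qh.obj P) ≅ Plus.ι.obj ((Plus.singleFunctor C 0).obj Y) :=
    (quotientCompQhIso C).app M ≪≫ (asIso (Q.map f)).symm ≪≫ ((singleFunctorIsoCompQ C 0).app Y).symm
  let i₂ : Plus.ι.obj (Plus.Qh.obj (T.mapHomotopyCategoryPlus.obj P)) ≅
      Q.obj ((T.mapHomologicalComplex (.up ℤ)).obj M) :=
    (quotientCompQhIso D).app ((T.mapHomologicalComplex (.up ℤ)).obj M)
  exact ⟨Plus.ι.mapIso (T.rightDerivedFunctorPlus.mapIso (Plus.ι.preimageIso i₁).symm ≪≫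
    (asIso (T.rightDerivedFunctorPlusUnit.app P)).symm) ≪≫ i₂⟩

include hT in
open DerivedCategory in
/-- The right derived functor is computed by resolutions in an adapted class. -/
lemma IsAdapted.nonempty_iso [EnoughInjectives C] [HasDerivedCategory C]
    [HasDerivedCategory D] {Y : C} {K : CochainComplex C ℤ} (a : ℤ) [K.IsStrictlyGE a]
    (hK : ∀ n, 𝒜 (K.X n)) (f : (HomologicalComplex.single C (.up ℤ) 0).obj Y ⟶ K)
    [QuasiIso f] : Nonempty (Q.obj ((T.mapHomologicalComplex (.up ℤ)).obj K) ≅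
      Plus.ι.obj (T.rightDerivedFunctorPlus.obj ((Plus.singleFunctor C 0).obj Y))) := by
  -- A monomorphism into a complex of injectives, so that `IsAdapted.quasiIso_map` applies; this
  -- complex may begin one degree below `K`.
  obtain ⟨M, i, _, _, hM, _⟩ :=
    CochainComplex.Plus.modelCategoryQuillen.exists_mono_quasiIso_injective K (a - 1) a (by simp)
  obtain ⟨j⟩ := nonempty_iso_rightDerivedFunctorPlus_of_injective T (a - 1) hM (f ≫ i)
  have := hT.quasiIso_map i hK (fun n => hT.injective _ (hM n)) (a - 1)
  exact ⟨asIso (Q.map ((T.mapHomologicalComplex (.up ℤ)).map i)) ≪≫ j.symm⟩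

/-- Extension by zero of a complex in degrees `≥ 0` commutes with additive functors. -/
noncomputable def mapExtendIso (T : C ⥤ D) [T.Additive] (K : CochainComplex C ℕ) :
    (T.mapHomologicalComplex (.up ℤ)).obj (K.extend ComplexShape.embeddingUpNat) ≅
      ((T.mapHomologicalComplex (.up ℕ)).obj K).extend ComplexShape.embeddingUpNat :=
  HomologicalComplex.Hom.isoOfComponents
    (fun i => match i with
      | .ofNat n => T.mapIso (K.extendXIso ComplexShape.embeddingUpNat (i := n) rfl) ≪≫
          (((T.mapHomologicalComplex (.up ℕ)).obj K).extendXIso ComplexShape.embeddingUpNat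
            (i := n) rfl).symm
      | .negSucc n => IsZero.iso
          (T.map_isZero (K.isZero_extend_X ComplexShape.embeddingUpNat _ fun i hi => by
            exact Int.noConfusion hi))
          (HomologicalComplex.isZero_extend_X _ ComplexShape.embeddingUpNat _ fun i hi => by
            exact Int.noConfusion hi))
    (fun i j hij => by
      match i with
      | .ofNat n =>
        obtain rfl : (n : ℤ) + 1 = j := hij
        have e₁ := K.extend_d_eq ComplexShape.embeddingUpNat (i := n) (j := n + 1) rfl rfl
        have e₂ := ((T.mapHomologicalComplex (.up ℕ)).obj K).extend_d_eq
          ComplexShape.embeddingUpNat (i := n) (j := n + 1) rfl rfl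
        have key {A A' B B' : C} {P P' : D} (a : A ≅ B) (d : B ⟶ B') (a' : A' ≅ B')
            (b : P ≅ T.obj B) (b' : P' ≅ T.obj B') :
            (T.map a.hom ≫ b.inv) ≫ b.hom ≫ T.map d ≫ b'.inv =
              T.map (a.hom ≫ d ≫ a'.inv) ≫ T.map a'.hom ≫ b'.inv := by
          simp only [Category.assoc, Iso.inv_hom_id_assoc, ← T.map_comp_assoc, Iso.inv_hom_id,
            Category.comp_id]
        exact (congrArg (_ ≫ ·) e₂).trans ((key _ _ _ _ _).trans
          (congrArg (fun t => T.map t ≫ _) e₁).symm)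
      | .negSucc n => exact (T.map_isZero (K.isZero_extend_X ComplexShape.embeddingUpNat _
          fun i hi => Int.noConfusion hi)).eq_of_src _ _)

include hT in
/-- The right derived functors are computed by resolutions in an adapted class. -/
lemma IsAdapted.nonempty_homology_iso [EnoughInjectives C] {Y : C} {K : CochainComplex C ℤ} (a : ℤ)
    [K.IsStrictlyGE a] (hK : ∀ n, 𝒜 (K.X n)) (f : (HomologicalComplex.single C (.up ℤ) 0).obj Y ⟶ K)
    [QuasiIso f] (n : ℕ) : Nonempty (((T.mapHomologicalComplex (.up ℤ)).obj K).homology (n : ℤ) ≅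
      (T.rightDerived n).obj Y) := by
  let := HasDerivedCategory.standard C
  let := HasDerivedCategory.standard D
  let I := injectiveResolution Y
  obtain ⟨i⟩ := hT.nonempty_iso a hK f
  have : QuasiIso (C := C) (K := (HomologicalComplex.single C (.up ℤ) 0).obj Y) I.ι' :=
    inferInstanceAs (QuasiIso I.ι')
  obtain ⟨j⟩ := nonempty_iso_rightDerivedFunctorPlus_of_injective T 0 (M := I.cochainComplex)
    (fun _ => inferInstance) I.ι'
  let e := (DerivedCategory.homologyFunctor D (n : ℤ)).mapIso (i ≪≫ j)
  let φ := DerivedCategory.homologyFunctorFactors D (n : ℤ)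
  exact ⟨(φ.app _).symm ≪≫ e ≪≫ φ.app _ ≪≫
    (HomologicalComplex.homologyFunctor D (.up ℤ) (n : ℤ)).mapIso (mapExtendIso T I.cocomplex) ≪≫
    HomologicalComplex.extendHomologyIso _ ComplexShape.embeddingUpNat rfl ≪≫
    (I.isoRightDerivedObj T n).symm⟩

end Acyclicity

lemma shortExact_map_of_preservesFiniteLimits {C D : Type*} [Category* C] [Abelian C] [Category* D]
    [Abelian D] (T : C ⥤ D) [T.PreservesZeroMorphisms] [PreservesFiniteLimits T] {S : ShortComplex C}
    (hS : S.ShortExact) (h : Epi (T.map S.g)) : (S.map T).ShortExact :=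
  have := hS.mono_f
  { exact := hS.exact.map_of_mono_of_preservesKernel T hS.mono_f inferInstance
    mono_f := inferInstanceAs (Mono (T.map S.f))
    epi_g := h }

/-! ### Flabby sheaves of modules -/

section Flasque

variable {k : Type u} [CommRing k] {X : TopCat.{u}}

/-- The underlying sheaf of abelian groups of a sheaf of modules. -/
noncomputable abbrev toAb : Sh k X ⥤ TopCat.Sheaf AddCommGrpCat.{u} X :=
  sheafCompose (Opens.grothendieckTopology X) (forget₂ (ModuleCat.{u} k) AddCommGrpCat.{u})

instance : (toAb (k := k) (X := X)).Additive where
  map_add := rfl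

instance : PreservesFiniteLimits (toAb (k := k) (X := X)) := by
  have h₁ : PreservesFiniteLimits ((Functor.whiskeringRight (Opens X)ᵒᵖ _ _).obj
      (forget₂ (ModuleCat.{u} k) AddCommGrpCat.{u})) := inferInstance
  have h₂ : PreservesFiniteLimits
      (toAb (k := k) (X := X) ⋙ TopCat.Sheaf.forget AddCommGrpCat.{u} X) :=
    inferInstanceAs (PreservesFiniteLimits (TopCat.Sheaf.forget (ModuleCat.{u} k) X ⋙
      (Functor.whiskeringRight (Opens X)ᵒᵖ _ _).obj
      (forget₂ (ModuleCat.{u} k) AddCommGrpCat.{u})))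
  exact preservesFiniteLimits_of_reflects_of_preserves _ (TopCat.Sheaf.forget AddCommGrpCat.{u} X)

/-- Epimorphisms of sheaves are the locally surjective maps, a condition on underlying sets. -/
lemma epi_toAb_map {F G : Sh k X} (f : F ⟶ G) [Epi f] : Epi (toAb.map f) := by
  have h := (TopCat.Presheaf.isLocallySurjective_iff _).1
    ((TopCat.Sheaf.isLocallySurjective_iff_epi f).2 inferInstance)
  exact (TopCat.Sheaf.isLocallySurjective_iff_epi _).1
    ((TopCat.Presheaf.isLocallySurjective_iff _).2 h)

lemma isFlasque_toAb {F : Sh k X} (hF : F.IsFlasque) : (toAb.obj F).IsFlasque where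
  epi i := by
    have := (ModuleCat.epi_iff_surjective _).1 (hF.epi i)
    exact (AddCommGrpCat.epi_iff_surjective _).2 this

/-- Reduces to sheaves of abelian groups: the forgetful functor keeps the sequence exact and the
first sheaf flabby, and surjectivity on sections is unaffected. -/
lemma epi_sections_of_shortExact {S : ShortComplex (Sh k X)} (hS : S.ShortExact)
    (h : S.X₁.IsFlasque) (W : (Opens X)ᵒᵖ) : Epi (S.g.1.app W) := by
  have := hS.epi_g
  have h₁ := shortExact_map_of_preservesFiniteLimits (toAb (k := k) (X := X)) hS (epi_toAb_map S.g)
  have : (S.map toAb).X₁.IsFlasque := isFlasque_toAb h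
  have h₂ := TopCat.Sheaf.IsFlasque.epi_of_shortExact (U := W.unop) h₁
  exact (ModuleCat.epi_iff_surjective _).2 ((AddCommGrpCat.epi_iff_surjective _).1 h₂)

lemma isFlasque_of_shortExact {S : ShortComplex (Sh k X)} (hS : S.ShortExact)
    (h₁ : S.X₁.IsFlasque) (h₂ : S.X₂.IsFlasque) : S.X₃.IsFlasque where
  epi {U V} i := by
    have : Epi (S.g.1.app U ≫ S.X₃.obj.map i) := by
      rw [← S.g.hom.naturality i]
      exact @CategoryTheory.epi_comp' _ _ _ _ _ _ _ (h₂.epi i) (epi_sections_of_shortExact hS h₁ V)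
    exact CategoryTheory.epi_of_epi (S.g.1.app U) (S.X₃.obj.map i)

lemma epi_of_epi_sections {F G : Sh k X} (f : F ⟶ G) (h : ∀ W, Epi (f.1.app W)) : Epi f := by
  have : Epi ((TopCat.Sheaf.forget _ X).map f) := @NatTrans.epi_of_epi_app _ _ _ _ _ _ _ h
  exact (TopCat.Sheaf.forget _ X).epi_of_epi_map this

/-- The free presheaf on the presheaf represented by an open subset. -/
noncomputable abbrev freeOpen (k : Type u) [CommRing k] (U : Opens X) : (Opens X)ᵒᵖ ⥤ ModuleCat.{u} k :=
  yoneda.obj U ⋙ ModuleCat.free k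

/-- Sections on `V` are maps from the sheafified free presheaf on `V`, which embeds in the one on
`U` when `V ≤ U`. Extending such a map by injectivity extends the section. -/
lemma isFlasque_of_injective (I : Sh k X) (hI : Injective I) : I.IsFlasque where
  epi {U V} i := by
    let a := presheafToSheaf (Opens.grothendieckTopology X) (ModuleCat.{u} k)
    let adj := sheafificationAdjunction (Opens.grothendieckTopology X) (ModuleCat.{u} k)
    let m : freeOpen k V.unop ⟶ freeOpen k U.unop :=
      Functor.whiskerRight (yoneda.map i.unop) (ModuleCat.free k)
    have hm : Mono m := by
      have (W : (Opens X)ᵒᵖ) : Mono (m.app W) :=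
        (ModuleCat.mono_iff_injective _).2 (Finsupp.mapDomain_injective fun _ _ _ =>
          Subsingleton.elim (α := (W.unop ⟶ V.unop)) _ _)
      exact NatTrans.mono_of_mono_app _
    have : @Mono (Sh k X) _ _ _ (a.map m) := inferInstanceAs (Mono (a.map m))
    rw [ModuleCat.epi_iff_surjective]
    intro s
    let φ : freeOpen k V.unop ⟶ I.obj :=
      { app W := ModuleCat.freeDesc (TypeCat.ofHom fun h : W.unop ⟶ V.unop => I.obj.map h.op s)
        naturality W W' h := by
          refine ModuleCat.free_hom_ext fun g => ?_
          have e₁ := ModuleCat.free_map_apply (R := k) ((yoneda.obj V.unop).map h) g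
          have e₂ := ModuleCat.freeDesc_apply (R := k)
            (TypeCat.ofHom fun h : W'.unop ⟶ V.unop => I.obj.map h.op s) (h.unop ≫ g)
          have e₃ := ModuleCat.freeDesc_apply (R := k)
            (TypeCat.ofHom fun h : W.unop ⟶ V.unop => I.obj.map h.op s) g
          have e₄ : I.obj.map (h.unop ≫ g).op s = I.obj.map h (I.obj.map g.op s) :=
            ConcreteCategory.congr_hom (I.obj.map_comp g.op h) s
          exact (congrArg _ e₁).trans (e₂.trans (e₄.trans (congrArg (I.obj.map h) e₃.symm))) }
    obtain ⟨ψ, hψ⟩ := @Injective.factors (Sh k X) _ I hI _ _ ((adj.homEquiv _ _).symm φ) (a.map m) this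
    let χ : freeOpen k U.unop ⟶ I.obj := adj.homEquiv _ _ ψ
    have hχ : m ≫ χ = φ :=
      (adj.homEquiv_naturality_left m ψ).symm.trans
        ((congrArg (adj.homEquiv _ _) hψ).trans (Equiv.apply_symm_apply _ _))
    refine ⟨χ.app U (ModuleCat.freeMk (𝟙 U.unop)), ?_⟩
    have h₁ : I.obj.map i (χ.app U (ModuleCat.freeMk (𝟙 U.unop))) =
        χ.app V ((freeOpen k U.unop).map i (ModuleCat.freeMk (𝟙 U.unop))) :=
      (ConcreteCategory.congr_hom (χ.naturality i) _).symm
    have h₂ : (freeOpen k U.unop).map i (ModuleCat.freeMk (𝟙 U.unop)) =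
        m.app V (ModuleCat.freeMk (𝟙 V.unop)) :=
      (ModuleCat.free_map_apply (R := k) ((yoneda.obj U.unop).map i) (𝟙 U.unop)).trans
        ((congrArg ModuleCat.freeMk (Subsingleton.elim (α := (V.unop ⟶ U.unop)) _ _)).trans
          (ModuleCat.free_map_apply (R := k) ((yoneda.map i.unop).app V) (𝟙 V.unop)).symm)
    have h₃ : χ.app V (m.app V (ModuleCat.freeMk (𝟙 V.unop))) = φ.app V (ModuleCat.freeMk (𝟙 V.unop)) :=
      ConcreteCategory.congr_hom (NatTrans.congr_app hχ V) _
    refine h₁.trans ((congrArg _ h₂).trans (h₃.trans ?_))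
    refine (ModuleCat.freeDesc_apply _ _).trans ?_
    exact ConcreteCategory.congr_hom (I.obj.map_id V) s

end Flasque

/-! ### Direct images and global sections of flabby resolutions -/

section Acyclic

variable {k : Type u} [CommRing k] {X : TopCat.{u}} (U : Opens X)

/-- The flabby sheaves. -/
def flasque (k : Type u) [CommRing k] (X : TopCat.{u}) : ObjectProperty (Sh k X) := fun F => F.IsFlasque

instance : PreservesFiniteLimits (TopCat.Sheaf.forget (ModuleCat.{u} k) X) :=
  inferInstanceAs (PreservesFiniteLimits
    (sheafToPresheaf (Opens.grothendieckTopology X) (ModuleCat.{u} k)))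

instance : PreservesFiniteLimits (globalSections (k := k) X) :=
  have : PreservesFiniteLimits ((evaluation (Opens X)ᵒᵖ (ModuleCat.{u} k)).obj (op ⊤)) :=
    ⟨fun _ _ _ => inferInstance⟩
  comp_preservesFiniteLimits _ _

instance : PreservesFiniteLimits (push (k := k) U) := by
  have h : PreservesFiniteLimits (push (k := k) U ⋙ TopCat.Sheaf.forget (ModuleCat.{u} k) X) :=
    have : PreservesFiniteLimits ((Functor.whiskeringLeft _ _ (ModuleCat.{u} k)).obj
      (Opens.map U.inclusion').op) := ⟨fun _ _ _ => inferInstance⟩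
    comp_preservesFiniteLimits (TopCat.Sheaf.forget (ModuleCat.{u} k) _)
      ((Functor.whiskeringLeft _ _ _).obj (Opens.map U.inclusion').op)
  exact preservesFiniteLimits_of_reflects_of_preserves _ (TopCat.Sheaf.forget (ModuleCat.{u} k) X)

instance : PreservesFiniteLimits (restr (k := k) U) := by
  have h : PreservesFiniteLimits (restr (k := k) U ⋙ TopCat.Sheaf.forget (ModuleCat.{u} k) _) :=
    have : PreservesFiniteLimits ((Functor.whiskeringLeft _ _ (ModuleCat.{u} k)).obj
      U.isOpenEmbedding.functor.op) := ⟨fun _ _ _ => inferInstance⟩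
    comp_preservesFiniteLimits (TopCat.Sheaf.forget (ModuleCat.{u} k) X)
      ((Functor.whiskeringLeft _ _ _).obj U.isOpenEmbedding.functor.op)
  exact preservesFiniteLimits_of_reflects_of_preserves _ (TopCat.Sheaf.forget (ModuleCat.{u} k) _)

instance : (restr (k := k) U).IsLeftAdjoint :=
  Functor.isLeftAdjoint_of_iso (U.isOpenEmbedding.sheafPullbackIso (A := ModuleCat.{u} k))

instance : PreservesFiniteColimits (restr (k := k) U) :=
  ⟨fun _ _ _ => inferInstance⟩

lemma isAdapted_globalSections : IsAdapted (globalSections (k := k) X) (flasque k X) where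
  injective I hI := isFlasque_of_injective I hI
  quotient _ hS h₁ h₂ := isFlasque_of_shortExact hS h₁ h₂
  exact _ hS h := shortExact_map_of_preservesFiniteLimits _ hS (epi_sections_of_shortExact hS h _)

lemma isAdapted_push : IsAdapted (push (k := k) U) (flasque k _) where
  injective I hI := isFlasque_of_injective I hI
  quotient _ hS h₁ h₂ := isFlasque_of_shortExact hS h₁ h₂
  exact _ hS h := shortExact_map_of_preservesFiniteLimits _ hS
    (epi_of_epi_sections _ fun W => epi_sections_of_shortExact hS h (op ((Opens.map U.inclusion').obj W.unop)))

variable {F : Sh k X} (J : FlabbyResolution F)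

/-- The restriction of a flabby resolution to an open subset. -/
noncomputable abbrev restrComplex : CochainComplex (Sh k ((Opens.toTopCat X).obj U)) ℤ :=
  ((restr U).mapHomologicalComplex (.up ℤ)).obj J.cplx

/-- The restriction of a flabby resolution is a resolution. -/
noncomputable def restrCoaug :
    (HomologicalComplex.single _ (.up ℤ) 0).obj ((restr U).obj F) ⟶ restrComplex U J :=
  (HomologicalComplex.singleMapHomologicalComplex (restr U) (.up ℤ) 0).inv.app F ≫
    ((restr U).mapHomologicalComplex (.up ℤ)).map J.coaug

instance : QuasiIso (restrCoaug U J) := by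
  have := J.quasiIso
  have : QuasiIso (((restr U).mapHomologicalComplex (.up ℤ)).map J.coaug) := inferInstance
  unfold restrCoaug
  infer_instance

lemma isFlasque_restrComplex (n : ℤ) : flasque k _ ((restrComplex U J).X n) where
  epi i := (J.flabby n).epi (U.isOpenEmbedding.functor.op.map i)

instance : (restrComplex U J).IsStrictlyGE 0 := by
  have := J.isStrictlyGE
  rw [CochainComplex.isStrictlyGE_iff]
  exact fun i hi => (restr U).map_isZero (J.cplx.isZero_of_isStrictlyGE 0 i hi)

/-- Restriction to an open subset is exact and preserves flabbiness, so the restricted complex is a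
flabby resolution on `U`, to which the direct image is adapted. -/
lemma nonempty_iso_RjStar [HasDerivedCategory.{w} (Sh k X)]
    [HasDerivedCategory.{w} (Sh k ((Opens.toTopCat X).obj U))] :
    Nonempty (DerivedCategory.Q.obj (((jj U).mapHomologicalComplex (.up ℤ)).obj J.cplx) ≅ RjStar U F) :=
  (isAdapted_push U).nonempty_iso 0 (isFlasque_restrComplex U J) (restrCoaug U J)

/-- Global sections of a direct image from `U` are by definition global sections on `U`, so the same
flabby resolution on `U` serves. -/
lemma nonempty_iso_RGamma [HasDerivedCategory.{w} (ModuleCat.{u} k)]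
    [HasDerivedCategory.{w} (Sh k ((Opens.toTopCat X).obj U))] :
    Nonempty (DerivedCategory.Q.obj
      ((Arrangement.sectionsComplex X).obj (((jj U).mapHomologicalComplex (.up ℤ)).obj J.cplx)) ≅
        RGamma ((restr U).obj F)) :=
  (isAdapted_globalSections (k := k)).nonempty_iso 0 (isFlasque_restrComplex U J) (restrCoaug U J)

lemma nonempty_homology_iso_H (n : ℕ) : Nonempty (((Arrangement.sectionsComplex X).obj
    (((jj U).mapHomologicalComplex (.up ℤ)).obj J.cplx)).homology (n : ℤ) ≅ H n ((restr U).obj F)) :=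
  (isAdapted_globalSections (k := k)).nonempty_homology_iso 0 (isFlasque_restrComplex U J)
    (restrCoaug U J) n

lemma isZero_homology_sectionsComplex (i : ℤ) (hi : i < 0) : IsZero
    (((Arrangement.sectionsComplex X).obj
      (((jj U).mapHomologicalComplex (.up ℤ)).obj J.cplx)).homology i) := by
  have := J.isStrictlyGE
  refine ShortComplex.isZero_homology_of_isZero_X₂ _ ?_
  exact (globalSections X).map_isZero ((jj U).map_isZero (J.cplx.isZero_of_isStrictlyGE 0 i hi))

lemma nonempty_homology_iso_of_Q_iso {A : Type*} [Category* A] [Abelian A] [HasDerivedCategory.{w} A]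
    {K K' : CochainComplex A ℤ} (e : DerivedCategory.Q.obj K ≅ DerivedCategory.Q.obj K') (i : ℤ) :
    Nonempty (K.homology i ≅ K'.homology i) :=
  ⟨((DerivedCategory.homologyFunctorFactors A i).app K).symm ≪≫
    (DerivedCategory.homologyFunctor A i).mapIso e ≪≫
    (DerivedCategory.homologyFunctorFactors A i).app K'⟩

end Acyclic
end PosetRes

/-! ### The theorem -/

open CategoryTheory PosetRes in
theorem mainTheorem3 {k : Type u} [CommRing k] {X : TopCat.{u}} {L : Type u} [SemilatticeInf L]
    [OrderTop L] [Finite L] (Z : Arrangement X L)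
    [HasDerivedCategory.{w} (Sh k X)]
    [HasDerivedCategory.{w} (Sh k ((TopologicalSpace.Opens.toTopCat X).obj Z.compl))]
    [HasDerivedCategory.{w} (ModuleCat.{u} k)]
    [HasDerivedCategory.{w} (L ⥤ Sh k X)]
    [HasDerivedCategory.{w} (L ⥤ ModuleCat.{u} k)]
    (F : Sh k X) (J : FlabbyResolution F) :
    (Nonempty (Below L) → ∀ G : FreeResolution (constBelow k L),
      (∃ R : FreeResolution (simpleTop k L), R.cplx = coneComplex G) ∧
      (QuasiIso (hocolimMap (constSh k X) (constShUnit k X) G (Z.cocone J.cplx)) ∧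
        QuasiIso (tensorMap (constSh k X) (𝟙 (coneComplex G)) (Z.jToI J.cplx)) ∧
        QuasiIso (zigzagRight (constSh k X) (constShUnit k X) G (Z.cocone J.cplx))) ∧
      (QuasiIso (hocolimMap (𝟭 (ModuleCat.{u} k)) (𝟙 _) G (Z.sectionsCocone J.cplx)) ∧
        QuasiIso (tensorMap (𝟭 (ModuleCat.{u} k)) (𝟙 (coneComplex G)) (Z.sectionsJToI J.cplx)) ∧
        QuasiIso (zigzagRight (𝟭 (ModuleCat.{u} k)) (𝟙 _) G (Z.sectionsCocone J.cplx)))) ∧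
    Nonempty (DerivedCategory.Q.obj (Z.jCompl J.cplx) ≅ RjStar Z.compl F) ∧
    (∀ R : FreeResolution (simpleTop k L),
      (∀ C : CochainComplex (L ⥤ Sh k X) ℤ,
        Nonempty (DerivedCategory.Q.obj C ≅ DerivedCategory.Q.obj (Z.iShriek J.cplx)) →
          Nonempty (DerivedCategory.Q.obj (tensorComplex (constSh k X) R.cplx C) ≅
            RjStar Z.compl F)) ∧
      (∀ C : CochainComplex (L ⥤ ModuleCat.{u} k) ℤ,
        Nonempty (DerivedCategory.Q.obj C ≅
          DerivedCategory.Q.obj ((Arrangement.sectionsRep X L).obj (Z.iShriek J.cplx))) →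
          Nonempty (DerivedCategory.Q.obj (tensorComplex (𝟭 (ModuleCat.{u} k)) R.cplx C) ≅
            RGamma ((restr Z.compl).obj F)) ∧
          (∀ n : ℕ, Nonempty ((tensorComplex (𝟭 (ModuleCat.{u} k)) R.cplx C).homology (n : ℤ) ≅
            H n ((restr Z.compl).obj F))) ∧
          (∀ i : ℤ, i < 0 → Limits.IsZero
            ((tensorComplex (𝟭 (ModuleCat.{u} k)) R.cplx C).homology i)))) := by
  refine ⟨fun _ G => ⟨exists_freeResolution_coneComplex G,
    ⟨quasiIso_hocolimMap_cocone Z J.flabby G, quasiIso_tensorMap_jToI Z G,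
      quasiIso_zigzagRight_cocone Z J.flabby G⟩,
    ⟨quasiIso_hocolimMap_sectionsCocone Z J.flabby G, quasiIso_tensorMap_sectionsJToI Z G,
      quasiIso_zigzagRight_sectionsCocone Z J.flabby G⟩⟩,
    nonempty_iso_RjStar Z.compl J, fun R => ⟨fun C ⟨i⟩ => ?_, fun C ⟨i⟩ => ?_⟩⟩
  · obtain ⟨e⟩ := nonempty_iso_tensorComplex_iShriek Z J.flabby R i
    obtain ⟨e'⟩ := nonempty_iso_RjStar Z.compl J
    exact ⟨e ≪≫ e'⟩
  · obtain ⟨e⟩ := nonempty_iso_tensorComplex_sectionsRep Z J.flabby R i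
    obtain ⟨e'⟩ := nonempty_iso_RGamma Z.compl J
    refine ⟨⟨e ≪≫ e'⟩, fun n => ?_, fun i hi => ?_⟩
    · obtain ⟨a⟩ := nonempty_homology_iso_of_Q_iso e n
      obtain ⟨b⟩ := nonempty_homology_iso_H Z.compl J n
      exact ⟨a ≪≫ b⟩
    · obtain ⟨a⟩ := nonempty_homology_iso_of_Q_iso e i
      exact (isZero_homology_sectionsComplex Z.compl J i hi).of_iso a
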